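/- **Definitions.** For permutations $\sigma,\alpha$ of a finite set of $n$ points write $z(\pi)$ for the number of cycles of a permutation $\pi$ (fixed points included). The pair $(\sigma,\alpha)$ is a *hypermap* if the group $\langle\sigma,\alpha\rangle$ is transitive; its genus $g(\sigma,\alpha)$ is given by $n+2-2g(\sigma,\alpha)=z(\sigma)+z(\alpha)+z(\alpha^{-1}\sigma)$. A permutation $\theta$ *refines* $\gamma$ if every cycle $\gamma_i$ of $\gamma$ acts on a union of cycles of $\theta$, and the restriction $\theta_i$ of $\theta$ to the points of $\gamma_i$ satisfies $g(\theta_i,\gamma_i)=0$. A *spanning hypertree* of $(\sigma,\alpha)$ is a hypermap $(\sigma,\theta)$ of genus zero with $\theta$ a refinement of $\alpha$ and $z(\theta^{-1}\sigma)=1$. If all cycles of $\alpha$ have length at most $3$, the *associated two-colored graph* $G(\sigma,\alpha)$ has as vertices the cycles of $\sigma$ (black) and the $3$-cycles of $\alpha$ (white); each $2$-cycle $(i,j)$ of $\alpha$ gives an edge between the cycles of $\sigma$ containing $i$ and $j$, and each point $i$ on a $3$-cycle of $\alpha$ gives an edge between that white vertex and the cycle of $\sigma$ containing $i$. For an integer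 $m\ge 0$ let $(\sigma_m,\alpha_m)$ be the plane map whose underlying graph is the ladder with $m+1$ rungs, so with $m$ bounded faces, all quadrilaterals (the points are the half-edges, the cycles of $\sigma_m$ are the vertices, the cycles of $\alpha_m$ are the edges), and let * $T(m)$ be the number of spanning hypertrees of the reciprocal hypermap $(\alpha_m,\sigma_m)$; * $H(m)$ be the number of spanning trees of $G(\alpha_m,\sigma_m)$; * $F(k)$, for $k\ge1$, be the number of spanning trees of the plane graph formed by a chain of $k$ octagons in a row, obtained from the ladder with $k$ bounded faces by subdividing each edge once (so that consecutive octagons share a path of length $2$), and $F(0)=1$; * $G(k)$, for $k\ge1$, be the number of spanning trees of the plane graph obtained from that chain of $k$ octagons by replacing the octagon at one end of the chain by a hexagon (with consecutive faces still sharing a path of length $2$), and $G(0)=1$. A set of positive integers is *sparse* if it contains no two consecutive integers. **Proposition.** For every $m\ge0$, $$T(m)=H(m)+\sum_{k=1}^{\lfloor m/2\rfloor}(-4)^k\sum_{i_1<i_2<\cdots<i_k}G(i_1-1)\cdot\prod_{j=1}^{k-1}F(i_{j+1}-i_j-2)\cdot G(m-1-i_k),$$ where the inner sum runs over all sparse $k$-element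 subsets $\{i_1<i_2<\cdots<i_k\}$ of $\{1,2,\ldots,m-1\}$. -/

import Mathlib

open scoped Graph

/-! ### Hypermaps -/

/-- A collection of hypermaps: a pair of permutations of the same set of points.  The cycles of
`σ` (fixed points included) are the vertices, the cycles of `α` are the hyperedges. -/
structure HypermapCollection (X : Type*) where
  /-- the vertex permutation -/
  σ : Equiv.Perm X
  /-- the hyperedge permutation -/
  α : Equiv.Perm X

/-- The set of cycles of a permutation, fixed points included. -/
abbrev PermCycles {X : Type*} (π : Equiv.Perm X) : Type _ :=
  Quotient (Equiv.Perm.SameCycle.setoid π)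

/-- `z(π)`: the number of cycles of a permutation, fixed points included. -/
noncomputable def numCycles {X : Type*} (π : Equiv.Perm X) : ℕ :=
  Nat.card (PermCycles π)

namespace HypermapCollection

variable {X : Type*}

/-- The number `κ(σ, α)` of connected components: the orbits of the group generated by
`σ` and `α`. -/
noncomputable def numComponents (M : HypermapCollection X) : ℕ :=
  Nat.card (MulAction.orbitRel.Quotient (Subgroup.closure {M.σ, M.α}) X)

/-- A hypermap is a collection of hypermaps with exactly one connected component. -/
def IsHypermap (M : HypermapCollection X) : Prop :=
  M.numComponents = 1

/-- The genus of a collection of hypermaps (the sum of the genera of its components), given by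
`n + 2 κ - 2 g = z(σ) + z(α) + z(α⁻¹ σ)`; for a hypermap `κ = 1`. -/
noncomputable def genus (M : HypermapCollection X) : ℚ :=
  ((Nat.card X : ℚ) + 2 * M.numComponents
    - numCycles M.σ - numCycles M.α - numCycles (M.α⁻¹ * M.σ)) / 2

/-- The reciprocal swaps the roles of vertices and hyperedges. -/
def reciprocal (M : HypermapCollection X) : HypermapCollection X where
  σ := M.α
  α := M.σ

end HypermapCollection

/-- `θ` refines `γ`: every cycle of `γ` (with set of points `B`) is a union of cycles of `θ`, and
the hypermap `(θ|B, γ|B)` on the set of points `B` has genus zero. -/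
def Refines {X : Type*} (θ γ : Equiv.Perm X) : Prop :=
  ∀ x : X, ∃ h : ∀ y, γ.SameCycle x (θ y) ↔ γ.SameCycle x y,
    (HypermapCollection.mk (X := {y // γ.SameCycle x y})
      (θ.subtypePerm h)
      (γ.subtypePerm fun _ => Equiv.Perm.sameCycle_apply_right)).genus = 0

namespace HypermapCollection

variable {X : Type*}

/-- `(σ, θ)` is a spanning hypertree of `(σ, α)`: it is a hypermap, it spans `(σ, α)` (that is,
`θ` refines `α`), it is unicellular, and it has genus zero. -/
structure IsSpanningHypertree (M : HypermapCollection X) (θ : Equiv.Perm X) : Prop where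
  refines : Refines θ M.α
  isHypermap : (HypermapCollection.mk M.σ θ).IsHypermap
  unicellular : numCycles (θ⁻¹ * M.σ) = 1
  genus_eq_zero : (HypermapCollection.mk M.σ θ).genus = 0

/-- The number of spanning hypertrees. -/
noncomputable def numSpanningHypertrees (M : HypermapCollection X) : ℕ :=
  Set.ncard {θ : Equiv.Perm X | M.IsSpanningHypertree θ}

end HypermapCollection

/-! ### Spanning trees of (multi)graphs -/

/-- `H` is a spanning tree of the multigraph `G`: a subgraph with the same vertices that is
a tree (in particular it has neither loops nor parallel edges). -/
structure Graph.IsSpanningTreeOf {V E : Type*} (H G : Graph V E) : Prop where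
  isSpanningSubgraph : H ≤s G
  simple : H.Simple
  isTree : H.toSimpleGraph.IsTree

/-- The number of spanning trees of a multigraph. -/
noncomputable def Graph.numSpanningTrees {V E : Type*} (G : Graph V E) : ℕ :=
  Set.ncard {H : Graph V E | H.IsSpanningTreeOf G}

/-! ### The associated two-colored graph -/

namespace HypermapCollection

variable {X : Type*}

/-- The underlying graph of a map: the vertices are the cycles of `σ` and the edges
are the cycles of length two of `α` (buds, that is, fixed points of `α`, give no edge). -/
def underlyingGraph (M : HypermapCollection X) : Graph (PermCycles M.σ) (PermCycles M.α) where
  vertexSet := Set.univ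
  IsLink e u v := ∃ p : X, M.α p ≠ p ∧ M.α (M.α p) = p ∧
    (⟦p⟧ : PermCycles M.α) = e ∧ (⟦p⟧ : PermCycles M.σ) = u ∧ (⟦M.α p⟧ : PermCycles M.σ) = v
  isLink_symm := by
    rintro e -
    refine ⟨?_⟩
    rintro u v ⟨p, h1, h2, rfl, rfl, rfl⟩
    refine ⟨M.α p, fun h => h1 (by rw [h2] at h; exact h.symm), by rw [h2], ?_, rfl, by rw [h2]⟩
    exact Quotient.sound (Equiv.Perm.sameCycle_apply_left.2 (Equiv.Perm.SameCycle.refl _ _))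
  eq_or_eq_of_isLink_of_isLink := by
    rintro e u v u' v' ⟨p, -, h2, rfl, rfl, rfl⟩ ⟨q, -, -, hq, rfl, rfl⟩
    have hs : M.α.SameCycle p q := (Quotient.exact hq).symm
    have hpow : ∀ k : ℕ, (M.α ^ k) p = p ∨ (M.α ^ k) p = M.α p := by
      intro k
      induction k with
      | zero => exact Or.inl rfl
      | succ k ih =>
        rw [pow_succ', Equiv.Perm.mul_apply]
        rcases ih with h | h
        · exact Or.inr (by rw [h])
        · exact Or.inl (by rw [h, h2])
    obtain ⟨i, hi⟩ := hs
    have hcases : q = p ∨ q = M.α p := by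
      obtain ⟨n, rfl | rfl⟩ := i.eq_nat_or_neg
      · rw [zpow_natCast] at hi
        rw [← hi]
        exact hpow n
      · have hi' : p = (M.α ^ n) q := by
          rw [← hi, zpow_neg, zpow_natCast, ← Equiv.Perm.mul_apply, mul_inv_cancel, Equiv.Perm.one_apply]
        have hcomm : (M.α ^ n) (M.α p) = M.α ((M.α ^ n) p) := by
          rw [← Equiv.Perm.mul_apply, ← pow_succ, pow_succ', Equiv.Perm.mul_apply]
        rcases hpow n with h | h
        · exact Or.inl ((M.α ^ n).injective (by rw [← hi', h]))
        · exact Or.inr ((M.α ^ n).injective (by rw [← hi', hcomm, h, h2]))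
    rcases hcases with rfl | rfl
    · exact Or.inl rfl
    · exact Or.inr (by rw [h2])

end HypermapCollection

/-- The point `x` lies on a cycle of length three of `π`. -/
def OnThreeCycle {X : Type*} (π : Equiv.Perm X) (x : X) : Prop :=
  π x ≠ x ∧ π (π (π x)) = x

theorem onThreeCycle_apply_iff {X : Type*} (π : Equiv.Perm X) (x : X) :
    OnThreeCycle π (π x) ↔ OnThreeCycle π x := by
  unfold OnThreeCycle
  rw [ne_eq, ne_eq, π.apply_eq_iff_eq, π.apply_eq_iff_eq]

theorem onThreeCycle_symm_apply_iff {X : Type*} (π : Equiv.Perm X) (x : X) :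
    OnThreeCycle π (π.symm x) ↔ OnThreeCycle π x := by
  rw [← onThreeCycle_apply_iff π (π.symm x), π.apply_symm_apply]

namespace HypermapCollection

variable {X : Type*}

open Classical in
/-- The associated collection of two-colored maps of a collection of hypermaps whose hyperedges
have at most three points.  The black points are the points `x` of `X`; there is one white point
`x'` for each point `x` on a `3`-cycle of `α`.  The vertex permutation has
the cycles of `σ` and a white cycle `(i', k', j')` for each `3`-cycle `(i, j, k)` of `α`;
the edge permutation has the `2`-cycles of `α` and the `2`-cycles `(i, i')`. -/
noncomputable def twoColoredMap (M : HypermapCollection X) :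
    HypermapCollection (X ⊕ {x : X // OnThreeCycle M.α x}) where
  σ := Equiv.sumCongr M.σ (Equiv.Perm.subtypePerm M.α.symm (onThreeCycle_symm_apply_iff M.α))
  α :=
    { toFun := Sum.elim
        (fun x => if h : OnThreeCycle M.α x then Sum.inr ⟨x, h⟩ else Sum.inl (M.α x))
        (fun y => Sum.inl y.1)
      invFun := Sum.elim
        (fun x => if h : OnThreeCycle M.α x then Sum.inr ⟨x, h⟩ else Sum.inl (M.α.symm x))
        (fun y => Sum.inl y.1)
      left_inv := by
        rintro (x | ⟨x, hx⟩)
        · by_cases h : OnThreeCycle M.α x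
          · simp [h]
          · simp [h, onThreeCycle_apply_iff]
        · simp [hx]
      right_inv := by
        rintro (x | ⟨x, hx⟩)
        · by_cases h : OnThreeCycle M.α x
          · simp [h]
          · simp [h, onThreeCycle_symm_apply_iff]
        · simp [hx] }

/-- The associated two-colored graph `G(σ, α)` of a hypermap whose hyperedges have at most three
points. -/
noncomputable def twoColoredGraph (M : HypermapCollection X) :
    Graph (PermCycles M.twoColoredMap.σ) (PermCycles M.twoColoredMap.α) :=
  M.twoColoredMap.underlyingGraph

end HypermapCollection

/-! ### The ladder map -/

/-- The darts (half-edges) of the ladder graph with `m` bounded faces on one of its two rails.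
The ladder has rungs `0, …, m` from left to right, and on each rail there is an edge between the
ends of rung `i` and rung `i + 1`, for `i < m`. -/
inductive RailDart (m : ℕ) : Type
  /-- the half of rung `i` that is incident to this rail -/
  | rung (i : Fin (m + 1)) : RailDart m
  /-- the half of the `i`-th rail edge at its left end, on rung `i`: it leaves to the right -/
  | right (i : Fin m) : RailDart m
  /-- the half of the `i`-th rail edge at its right end, on rung `i + 1`: it leaves to the left -/
  | left (i : Fin m) : RailDart m

/-- The rotation around the vertices of the upper rail, counterclockwise: the cyclic order
is right, left, rung (where a dart that does not exist is skipped).  Its inverse is the rotation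
around the vertices of the lower rail, where the counterclockwise order is right, rung, left. -/
def upperRotation (m : ℕ) : Equiv.Perm (RailDart m) where
  toFun
    | .rung i =>
      if h : i.val < m then .right ⟨i.val, h⟩
      else if h' : 0 < i.val then .left ⟨i.val - 1, by omega⟩
      else .rung i
    | .right i =>
      if h : 0 < i.val then .left ⟨i.val - 1, by omega⟩ else .rung i.castSucc
    | .left i => .rung i.succ
  invFun
    | .rung i =>
      if h : 0 < i.val then .left ⟨i.val - 1, by omega⟩
      else if h' : i.val < m then .right ⟨i.val, h'⟩
      else .rung i
    | .right i => .rung i.castSucc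
    | .left i =>
      if h : i.val + 1 < m then .right ⟨i.val + 1, h⟩ else .rung i.succ
  left_inv := by
    rintro (⟨i, hi⟩ | ⟨i, hi⟩ | ⟨i, hi⟩)
    · by_cases h : i < m
      · simp [h]
      · by_cases h' : 0 < i
        · have h1 : ¬ (i - 1 + 1 < m) := by omega
          have h2 : i - 1 + 1 = i := by omega
          simp [h, h', h2]
        · simp [h, h']
    · by_cases h : 0 < i
      · have h2 : i - 1 + 1 = i := by omega
        simp [h, h2, hi]
      · simp [h, hi]
    · simp
  right_inv := by
    rintro (⟨i, hi⟩ | ⟨i, hi⟩ | ⟨i, hi⟩)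
    · by_cases h : 0 < i
      · have h2 : i - 1 + 1 = i := by omega
        simp [h, h2]
      · by_cases h' : i < m
        · simp [h, h']
        · simp [h, h']
    · simp [hi]
    · by_cases h : i + 1 < m
      · simp [h]
      · simp [h]

/-- The other half of the edge to which a dart belongs; a dart is a pair consisting of a
`RailDart` and the rail (`true` for the upper one, `false` for the lower one). -/
def ladderOpposite (m : ℕ) : RailDart m × Bool → RailDart m × Bool
  | (.rung i, t) => (.rung i, !t)
  | (.right i, t) => (.left i, t)
  | (.left i, t) => (.right i, t)

theorem ladderOpposite_involutive (m : ℕ) : Function.Involutive (ladderOpposite m) := by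
  rintro ⟨i | i | i, t⟩ <;> simp [ladderOpposite]

/-- The ladder map `(σ_m, α_m)`: the plane map whose underlying graph is the ladder graph with `m`
bounded faces, each of which is a quadrilateral. -/
def ladderMap (m : ℕ) : HypermapCollection (RailDart m × Bool) where
  σ :=
    { toFun := fun d => (cond d.2 (upperRotation m d.1) ((upperRotation m).symm d.1), d.2)
      invFun := fun d => (cond d.2 ((upperRotation m).symm d.1) (upperRotation m d.1), d.2)
      left_inv := by rintro ⟨d, _ | _⟩ <;> simp
      right_inv := by rintro ⟨d, _ | _⟩ <;> simp }
  α := (ladderOpposite_involutive m).toPerm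

/-! ### Chains of polygons -/

/-- A plane graph in the strip `[a, b] × [0, 2]`: its vertices are the integer points on the two
horizontal lines at heights `0` and `2`, and the midpoints at height `1` of the vertical
rungs at the abscissas in `R`; its edges are the unit segments of the two horizontal lines and
of the rungs.  If `a` and `b` belong to `R`, then the bounded faces are the rectangles between
consecutive rungs; if these are at distance `d`, the face has `2 d + 4` sides. -/
def polygonChain (a b : ℕ) (R : Set ℕ) :
    SimpleGraph {p : ℕ × Fin 3 // a ≤ p.1 ∧ p.1 ≤ b ∧ (p.2 = 1 → p.1 ∈ R)} where
  Adj p q :=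
    (p.1.1 = q.1.1 ∧ (p.1.2.val + 1 = q.1.2.val ∨ q.1.2.val + 1 = p.1.2.val)) ∨
    (p.1.2 = q.1.2 ∧ p.1.2 ≠ 1 ∧ (p.1.1 + 1 = q.1.1 ∨ q.1.1 + 1 = p.1.1))
  symm := by
    refine ⟨?_⟩
    rintro p q (⟨h, h'⟩ | ⟨h, h', h''⟩)
    · exact Or.inl ⟨h.symm, h'.symm⟩
    · exact Or.inr ⟨h.symm, h ▸ h', h''.symm⟩
  loopless := by
    refine ⟨?_⟩
    rintro p (⟨-, h⟩ | ⟨-, -, h⟩) <;> omega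

/-- A chain of `k` octagons, consecutive ones sharing a path of length two: the rungs are at the
abscissas `0, 2, 4, …, 2 k`. -/
def octagonChain (k : ℕ) := polygonChain 0 (2 * k) {x | Even x}

/-- For `k ≥ 1`, a chain of one hexagon, at an end of the chain, and `k - 1` octagons, consecutive
polygons sharing a path of length two: the rungs are at the abscissas `1, 2, 4, …, 2 k`. -/
def hexagonOctagonChain (k : ℕ) := polygonChain 1 (2 * k) {x | x = 1 ∨ Even x}

/-! ### The counting functions -/

/-- `T(m)`: the number of spanning hypertrees of the reciprocal `(α_m, σ_m)` of the ladder map. -/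
noncomputable def ladderT (m : ℕ) : ℕ :=
  (ladderMap m).reciprocal.numSpanningHypertrees

/-- `F(k)`: the number of spanning trees of the chain of `k` octagons, with `F(0) = 1`. -/
noncomputable def ladderF (k : ℕ) : ℕ :=
  if k = 0 then 1 else (Graph.ofSimpleGraph (octagonChain k)).numSpanningTrees

/-- `G(k)`: the number of spanning trees of the chain of a hexagon and `k - 1` octagons, with
`G(0) = 1`. -/
noncomputable def ladderG (k : ℕ) : ℕ :=
  if k = 0 then 1 else (Graph.ofSimpleGraph (hexagonOctagonChain k)).numSpanningTrees

/-- `H(m)`: the number of spanning trees of the associated two-colored graph `G(α_m, σ_m)`. -/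
noncomputable def ladderH (m : ℕ) : ℕ :=
  (ladderMap m).reciprocal.twoColoredGraph.numSpanningTrees

/-! ### Sparse sets -/

/-- A set of integers is sparse if it contains no two consecutive integers. -/
def IsSparse (s : Finset ℕ) : Prop :=
  ∀ i ∈ s, i + 1 ∉ s

/-- The sparse subsets with `k` elements of `{1, …, m - 1}`. -/
noncomputable def sparseSubsets (m k : ℕ) : Finset (Finset ℕ) :=
  open Classical in ((Finset.Icc 1 (m - 1)).powersetCard k).filter IsSparse

/-- `i_j`: the `j`-th smallest element (`1 ≤ j ≤ k`) of a set `{i_1 < i_2 < ⋯ < i_k}`. -/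
noncomputable def ithElement (s : Finset ℕ) (j : ℕ) : ℕ :=
  Nat.nth (fun x => x ∈ s) (j - 1)

/-! All four numbers count spanning trees of one graph, the ladder with every edge subdivided. It is
the incidence graph of the vertices and edges of the ladder, and its own edges are the darts.
Prescribing darts amounts to contracting them. `F` counts all trees, `G` those containing the two
rail darts at one end, `H` those containing the rail darts at all four corners
(`numSpanningTrees_polygonChain`, `numSpanningTrees_twoColoredGraph`).

For `T`, the connected, unicellular, genus zero pairs of permutations are those whose incidence
graph is a tree (`isIncidenceTree_univ_iff`). The cycles of `σ_m` have length at most three, and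
there a genus zero refinement is the first return map to a set of darts. Deleting the leaves given
by its fixed points yields a tree in the subdivided ladder (`numSpanningHypertrees_eq`). So `T`
counts the trees counted by `H` in which, moreover, a vertex of degree three that is a leaf hangs on
its rung.

Trees are handled through rational potentials: a graph is connected if only constant potentials have
zero differences along its edges, and acyclic if all differences can be prescribed. When the ladder
is built from left to right, a partial tree matters only through whether the ends of the two rails
are already connected. Hence every count is a row vector times a power of a 2×2 matrix times a
column vector. An inner rung contributes the matrix with rows (4, 12), (1, 4) for `F`, `G`, `H`, and
with rows (4, 8), (1, 4) for `T`.

The two matrices differ by -4 in a single entry, a matrix of rank one. Expanding the power for `T`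
around the other matrix (`transfer_eight`) gives a sum over the sets of rungs at which this
difference is inserted. Each insertion contributes -4, and rank one makes the product split into
scalars: a value of `G` at each end and a value of `F` in each gap. Insertions at consecutive rungs
give a zero entry, so only sparse sets remain. -/

/-! ### Spanning trees and potentials -/

/-- For a connected system of edges, the number of edges is one less than the number of vertices
exactly when every function on the edges is the coboundary of a potential. -/
theorem card_add_one_eq_iff_forall_exists_potential {V E : Type*} [Finite V] [Finite E]
    [Nonempty V] (s t : E → V)
    (hconn : ∀ φ : V → ℚ, (∀ e, φ (s e) = φ (t e)) → ∀ u v, φ u = φ v) :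
    Nat.card E + 1 = Nat.card V ↔ ∀ g : E → ℚ, ∃ φ : V → ℚ, ∀ e, φ (s e) - φ (t e) = g e := by
  have := Fintype.ofFinite V
  have := Fintype.ofFinite E
  let δ : (V → ℚ) →ₗ[ℚ] (E → ℚ) :=
    LinearMap.funLeft ℚ ℚ s - LinearMap.funLeft ℚ ℚ t
  have hδ : ∀ φ e, δ φ e = φ (s e) - φ (t e) := fun φ e => rfl
  -- Connectedness makes the kernel of the coboundary the line of constants, so its rank is one less
  -- than the number of vertices, and surjectivity is an edge count.
  have hker : Module.finrank ℚ (LinearMap.ker δ) = 1 := by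
    have hk : LinearMap.ker δ = Submodule.span ℚ {(fun _ => 1 : V → ℚ)} := by
      ext φ
      rw [LinearMap.mem_ker, Submodule.mem_span_singleton]
      constructor
      · intro h
        obtain ⟨v⟩ := ‹Nonempty V›
        refine ⟨φ v, funext fun u => ?_⟩
        have := hconn φ (fun e => by
          have := congrFun h e
          rw [hδ] at this
          exact sub_eq_zero.1 this) v u
        simp [this]
      · rintro ⟨c, rfl⟩
        ext e
        simp [hδ]
    rw [hk]
    refine finrank_span_singleton fun h => ?_
    obtain ⟨v⟩ := ‹Nonempty V›
    exact one_ne_zero (congrFun h v)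
  have hrn := LinearMap.finrank_range_add_finrank_ker δ
  rw [hker, Module.finrank_fintype_fun_eq_card] at hrn
  rw [Nat.card_eq_fintype_card, Nat.card_eq_fintype_card, ← hrn, Nat.add_right_cancel_iff]
  have hsurj : (∀ g : E → ℚ, ∃ φ : V → ℚ, ∀ e, φ (s e) - φ (t e) = g e) ↔
      LinearMap.range δ = ⊤ := by
    rw [LinearMap.range_eq_top]
    exact forall_congr' fun g => exists_congr fun φ =>
      ⟨fun h => funext h, fun h e => by rw [← hδ, h]⟩
  rw [hsurj, ← Module.finrank_fintype_fun_eq_card ℚ (η := E)]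
  exact ⟨fun h => Submodule.eq_top_of_finrank_eq h.symm, fun h => by rw [h, finrank_top]⟩

/-- A simple graph is connected as soon as the potentials that agree along its edges are
constant. -/
theorem SimpleGraph.connected_of_forall_potential {V : Type*} [Nonempty V] (G : SimpleGraph V)
    (h : ∀ φ : V → ℚ, (∀ u v, G.Adj u v → φ u = φ v) → ∀ u v, φ u = φ v) : G.Connected := by
  classical
  refine ⟨fun u v => ?_⟩
  -- The test potential is the indicator of the component of `u`.
  have := h (fun w => if G.Reachable u w then 1 else 0) (fun a b hab => by
    have : G.Reachable u a ↔ G.Reachable u b :=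
      ⟨fun h => h.trans hab.reachable, fun h => h.trans hab.symm.reachable⟩
    simp [this]) u v
  by_contra hv
  simp [hv] at this

theorem SimpleGraph.Connected.potential_eq {V : Type*} {G : SimpleGraph V} (hG : G.Connected)
    (φ : V → ℚ) (h : ∀ u v, G.Adj u v → φ u = φ v) (u v : V) : φ u = φ v := by
  obtain ⟨p⟩ := hG.preconnected u v
  induction p with
  | nil => rfl
  | cons hadj _ ih => exact (h _ _ hadj).trans ih

/-- Trees among multigraphs, in terms of potentials on the vertices. -/
theorem Graph.simple_and_isTree_iff_potential {V E : Type*} [Finite V] [Nonempty V]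
    (H : Graph V E) (hV : V(H) = Set.univ) (hE : E(H).Finite) (s t : E(H) → V)
    (hst : ∀ e : E(H), H.IsLink e.1 (s e) (t e)) :
    (H.Simple ∧ H.toSimpleGraph.IsTree) ↔
      (∀ φ : V → ℚ, (∀ e, φ (s e) = φ (t e)) → ∀ u v, φ u = φ v) ∧
      (∀ g : E(H) → ℚ, ∃ φ : V → ℚ, ∀ e, φ (s e) - φ (t e) = g e) := by
  have := hE.to_subtype
  have hmem : ∀ v, v ∈ V(H) := fun v => hV ▸ Set.mem_univ v
  have hne : Nonempty V(H) := ⟨⟨Classical.arbitrary V, hmem _⟩⟩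
  have hcardV : Nat.card V(H) = Nat.card V := by rw [hV, Nat.card_univ]
  have hadj : ∀ u v, H.Adj u v → ∃ e : E(H), (s e = u ∧ t e = v) ∨ (s e = v ∧ t e = u) := by
    rintro u v ⟨e, he⟩
    refine ⟨⟨e, he.edge_mem⟩, ?_⟩
    exact (hst ⟨e, he.edge_mem⟩).eq_and_eq_or_eq_and_eq he
  constructor
  · rintro ⟨hs, ht⟩
    have hconn : ∀ φ : V → ℚ, (∀ e, φ (s e) = φ (t e)) → ∀ u v, φ u = φ v := by
      intro φ hφ u v
      refine ht.connected.potential_eq (fun x => φ x.1) ?_ ⟨u, hmem u⟩ ⟨v, hmem v⟩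
      rintro ⟨a, ha⟩ ⟨b, hb⟩ ⟨-, hab⟩
      obtain ⟨e, ⟨rfl, rfl⟩ | ⟨rfl, rfl⟩⟩ := hadj a b hab
      · exact hφ e
      · exact (hφ e).symm
    refine ⟨hconn, (card_add_one_eq_iff_forall_exists_potential s t hconn).1 ?_⟩
    rw [← hcardV, ← (SimpleGraph.isTree_iff_connected_and_card.1 ht).2, Nat.add_right_cancel_iff]
    refine Nat.card_congr (Equiv.ofBijective
      (fun e => ⟨s(⟨s e, hmem _⟩, ⟨t e, hmem _⟩), ?_, ?_⟩) ⟨?_, ?_⟩)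
    · exact fun h => (hst e).ne (congrArg Subtype.val h)
    · exact ⟨e.1, hst e⟩
    · intro e f hef
      have hef := congrArg Subtype.val hef
      simp only [Sym2.eq_iff, Subtype.mk.injEq] at hef
      refine Subtype.ext ?_
      rcases hef with ⟨h1, h2⟩ | ⟨h1, h2⟩
      · refine (hst e).eq ?_
        rw [h1, h2]; exact hst f
      · refine (hst e).eq ?_
        rw [h1, h2]; exact (hst f).symm
    · rintro ⟨e, he⟩
      induction e with | h u v =>
      obtain ⟨u, hu⟩ := u
      obtain ⟨v, hv⟩ := v
      obtain ⟨e, h⟩ := hadj u v he.2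
      refine ⟨e, Subtype.ext ?_⟩
      rcases h with ⟨rfl, rfl⟩ | ⟨rfl, rfl⟩
      · rfl
      · exact Sym2.eq_swap
  · rintro ⟨hconn, hsurj⟩
    have hcard := (card_add_one_eq_iff_forall_exists_potential s t hconn).2 hsurj
    constructor
    -- Differences vanish along a loop and agree up to sign along parallel edges, so neither is
    -- compatible with prescribing arbitrary differences.
    · refine { not_isLoopAt := fun e x he => ?_, eq_of_isLink := fun e f x y he hf => ?_ }
      · obtain ⟨φ, hφ⟩ := hsurj fun _ => 1
        have h1 := hφ ⟨e, he.edge_mem⟩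
        have h2 := (hst ⟨e, he.edge_mem⟩).eq_and_eq_or_eq_and_eq he
        rcases h2 with ⟨h2, h3⟩ | ⟨h2, h3⟩ <;> simp [h2, h3] at h1
      · classical
        by_contra hef
        obtain ⟨φ, hφ⟩ := hsurj fun d => if d.1 = e then 1 else 0
        have h1 := hφ ⟨e, he.edge_mem⟩
        have h2 := hφ ⟨f, hf.edge_mem⟩
        have h3 := (hst ⟨e, he.edge_mem⟩).eq_and_eq_or_eq_and_eq he
        have h4 := (hst ⟨f, hf.edge_mem⟩).eq_and_eq_or_eq_and_eq hf
        have h5 : ¬ f = e := fun h => hef h.symm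
        simp only [if_true, h5, if_false] at h1 h2
        rcases h3 with ⟨h3, h3'⟩ | ⟨h3, h3'⟩ <;> rcases h4 with ⟨h4, h4'⟩ | ⟨h4, h4'⟩ <;>
          rw [h3, h3'] at h1 <;> rw [h4, h4'] at h2 <;> linarith
    · have hc : H.toSimpleGraph.Connected := by
        refine SimpleGraph.connected_of_forall_potential _ fun φ hφ u v => ?_
        refine hconn (fun x => φ ⟨x, hmem x⟩) (fun e => ?_) u.1 v.1
        by_cases hl : s e = t e
        · rw [hl]
        · exact hφ _ _ ⟨fun h => hl (congrArg Subtype.val h), ⟨e.1, hst e⟩⟩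
      -- Connectedness bounds the number of edges from below. The upper bound comes from choosing,
      -- for each edge of the simple graph, an edge of `H` above it.
      refine SimpleGraph.isTree_iff_connected_and_card.2 ⟨hc, le_antisymm ?_
        hc.card_vert_le_card_edgeSet_add_one⟩
      rw [hcardV, ← hcard, Nat.add_le_add_iff_right]
      have hch : ∀ d : H.toSimpleGraph.edgeSet, ∃ e : E(H),
          s((⟨s e, hmem _⟩ : V(H)), ⟨t e, hmem _⟩) = d.1 := by
        rintro ⟨d, hd⟩
        induction d with | h u v =>
        obtain ⟨u, hu⟩ := u
        obtain ⟨v, hv⟩ := v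
        obtain ⟨e, h⟩ := hadj u v hd.2
        refine ⟨e, ?_⟩
        rcases h with ⟨rfl, rfl⟩ | ⟨rfl, rfl⟩
        · rfl
        · exact Sym2.eq_swap
      choose c hc' using hch
      exact Nat.card_le_card_of_injective c fun d d' h => Subtype.ext (by rw [← hc', ← hc', h])

/-! ### Spanning trees of the incidence graph of a pair of permutations -/

/-- The points of `A`, seen as edges between the cycles of `α` and the cycles of `γ` that contain
them, form a spanning tree of the incidence graph of these cycles. -/
def IsIncidenceTree {X : Type*} (α γ : Equiv.Perm X) (A : Set X) : Prop :=
  (∀ g : X → ℚ, ∃ φ ψ : X → ℚ, (∀ x, φ (α x) = φ x) ∧ (∀ x, ψ (γ x) = ψ x) ∧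
    ∀ x ∈ A, φ x - ψ x = g x) ∧
  ∀ φ ψ : X → ℚ, (∀ x, φ (α x) = φ x) → (∀ x, ψ (γ x) = ψ x) → (∀ x ∈ A, φ x = ψ x) →
    ∀ x y, φ x = ψ y

/-- Two spanning subgraphs with the same edges are equal. -/
theorem Graph.IsSpanningSubgraph.eq_of_edgeSet_eq {V E : Type*} {G H K : Graph V E}
    (hH : H ≤s G) (hK : K ≤s G) (h : E(H) = E(K)) : H = K :=
  (Graph.Compatible.of_le_le hH.le hK.le).ext (hH.vertexSet_eq.trans hK.vertexSet_eq.symm) h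

theorem Graph.restrict_isSpanningSubgraph {V E : Type*} (G : Graph V E) (S : Set E) :
    G.restrict S ≤s G :=
  { le := Graph.restrict_le, vertexSet_eq := rfl }

/-- The spanning trees of a graph obtained from the incidence graph of the cycles of two
permutations by contracting the edges of a set `F`, which contains at most one point of each cycle
of `γ`, correspond to the spanning trees of the incidence graph that contain `F`. -/
theorem Graph.numSpanningTrees_eq_ncard_isIncidenceTree {X V E : Type*} [Finite X] [Finite V]
    [Nonempty V] (α γ : Equiv.Perm X) (F : Set X) (G : Graph V E) (hG : V(G) = Set.univ)
    (b w : X → V) (ε : X → E) (hb : ∀ x, b (α x) = b x) (hw : ∀ x, w (γ x) = w x)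
    (hbw : ∀ v, (∃ x, b x = v) ∨ ∃ x, w x = v)
    (hF : ∀ x ∈ F, b x = w x) (hε : ∀ x ∉ F, G.IsLink (ε x) (b x) (w x))
    (hinj : Set.InjOn ε Fᶜ) (hE : ∀ e ∈ E(G), ∃ x ∉ F, ε x = e)
    (hlift : ∀ φ ψ : X → ℚ, (∀ x, φ (α x) = φ x) → (∀ x, ψ (γ x) = ψ x) →
      (∀ x ∈ F, φ x = ψ x) → ∃ χ : V → ℚ, ∀ x, χ (b x) = φ x ∧ χ (w x) = ψ x)
    (hsolve : ∀ g : X → ℚ, ∃ ψ : X → ℚ, (∀ x, ψ (γ x) = ψ x) ∧ ∀ x ∈ F, ψ x = g x) :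
    G.numSpanningTrees = Set.ncard {A : Set X | F ⊆ A ∧ IsIncidenceTree α γ A} := by
  -- Both halves of the potential criterion pass through the contraction of `F`: potentials on `V`
  -- are the pairs of potentials that agree on `F`.
  have key : ∀ A : Set X, F ⊆ A → ∀ H : Graph V E, H ≤s G → E(H) = ε '' (A \ F) →
      (H.IsSpanningTreeOf G ↔ IsIncidenceTree α γ A) := by
    intro A hA H hH hEH
    have hlink : ∀ x ∈ A \ F, H.IsLink (ε x) (b x) (w x) := fun x hx => by
      refine (Graph.IsSubgraph.isLink_iff hH.le ?_).2 (hε x hx.2)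
      rw [hEH]
      exact ⟨x, hx, rfl⟩
    have hch : ∀ e : E(H), ∃ x, x ∈ A \ F ∧ ε x = e.1 := by
      rintro ⟨e, he⟩
      rw [hEH] at he
      exact he
    choose r hr hr' using hch
    have hre : ∀ x (hx : x ∈ A \ F) (hm : ε x ∈ E(H)), r ⟨ε x, hm⟩ = x := fun x hx hm =>
      hinj (hr _).2 hx.2 (hr' _)
    have hmemE : ∀ x ∈ A \ F, ε x ∈ E(H) := fun x hx => (hlink x hx).edge_mem
    have hfin : E(H).Finite := hEH ▸ (Set.toFinite _).image _
    have htree := Graph.simple_and_isTree_iff_potential H (hH.vertexSet_eq.trans hG) hfin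
      (fun e => b (r e)) (fun e => w (r e)) (fun e => hr' e ▸ hlink _ (hr e))
    have : H.IsSpanningTreeOf G ↔ (H.Simple ∧ H.toSimpleGraph.IsTree) :=
      ⟨fun h => ⟨h.simple, h.isTree⟩, fun h => ⟨hH, h.1, h.2⟩⟩
    rw [this, htree, IsIncidenceTree, and_comm]
    refine and_congr ⟨fun h g => ?_, fun h g => ?_⟩ ⟨fun h φ ψ hφ hψ he x y => ?_, fun h χ hχ => ?_⟩
    -- First `ψ` absorbs the prescribed values on `F`; what remains is zero there and can be solved
    -- in the contracted graph.
    · obtain ⟨ψ, hψ, hψF⟩ := hsolve g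
      obtain ⟨χ, hχ⟩ := h fun e => g (r e) - ψ (r e)
      refine ⟨χ ∘ b, fun x => χ (w x) - ψ x, fun x => by simp [hb], fun x => by simp [hw, hψ],
        fun x hx => ?_⟩
      by_cases hxF : x ∈ F
      · simp [hF x hxF, hψF x hxF]
      · have := hχ ⟨ε x, hmemE x ⟨hx, hxF⟩⟩
        simp only [hre x ⟨hx, hxF⟩] at this
        simp only [Function.comp_apply]
        linarith
    · classical
      obtain ⟨φ, ψ, hφ, hψ, h1⟩ := h fun x =>
        if hx : x ∈ A \ F then g ⟨ε x, hmemE x hx⟩ else 0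
      obtain ⟨χ, hχ⟩ := hlift φ ψ hφ hψ (fun x hx => by
        have := h1 x (hA hx)
        simp only [Set.mem_sdiff, hx, not_true, and_false, dif_neg, not_false_eq_true] at this
        linarith)
      refine ⟨χ, fun e => ?_⟩
      have := h1 (r e) (hr e).1
      rw [dif_pos (hr e)] at this
      rw [(hχ _).1, (hχ _).2, this]
      congr 1
      exact Subtype.ext (hr' e)
    · obtain ⟨χ, hχ⟩ := hlift φ ψ hφ hψ fun x hx => he x (hA hx)
      rw [← (hχ x).1, ← (hχ y).2]
      exact h χ (fun e => by rw [(hχ _).1, (hχ _).2]; exact he _ (hr e).1) _ _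
    · have h1 := h (χ ∘ b) (χ ∘ w) (fun x => by simp [hb]) (fun x => by simp [hw]) (fun x hx => by
        by_cases hxF : x ∈ F
        · simp [hF x hxF]
        · have := hχ ⟨ε x, hmemE x ⟨hx, hxF⟩⟩
          simp only [hre x ⟨hx, hxF⟩] at this
          exact this)
      simp only [Function.comp_apply] at h1
      intro u v
      rcases hbw u with ⟨x, rfl⟩ | ⟨x, rfl⟩ <;> rcases hbw v with ⟨y, rfl⟩ | ⟨y, rfl⟩
      · rw [h1 x x, h1 y x]
      · exact h1 x y
      · exact (h1 y x).symm
      · rw [← h1 x x, ← h1 x y]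
  symm
  refine Set.ncard_congr (fun A _ => G.restrict (ε '' (A \ F))) ?_ ?_ ?_
  · rintro A ⟨hA, hT⟩
    refine (key A hA _ (G.restrict_isSpanningSubgraph _) ?_).2 hT
    rw [Graph.edgeSet_restrict, Set.inter_eq_right]
    rintro _ ⟨x, hx, rfl⟩
    exact (hε x hx.2).edge_mem
  · rintro A B ⟨hA, -⟩ ⟨hB, -⟩ h
    have h1 := congrArg Graph.edgeSet h
    have h2 : ∀ A : Set X, E(G) ∩ (ε '' (A \ F)) = ε '' (A \ F) := by
      intro A
      rw [Set.inter_eq_right]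
      rintro _ ⟨x, hx, rfl⟩
      exact (hε x hx.2).edge_mem
    rw [Graph.edgeSet_restrict, Graph.edgeSet_restrict, h2, h2] at h1
    have h3 := (hinj.image_eq_image_iff (fun x hx => hx.2) (fun x hx => hx.2)).1 h1
    rw [← Set.sdiff_union_of_subset hA, ← Set.sdiff_union_of_subset hB, h3]
  · intro H hH
    have hEH : E(H) = ε '' (((ε ⁻¹' E(H) ∩ Fᶜ) ∪ F) \ F) := by
      ext e
      constructor
      · intro he
        obtain ⟨x, hx, rfl⟩ := hE e (hH.isSpanningSubgraph.le.edgeSet_mono he)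
        exact ⟨x, ⟨Or.inl ⟨he, hx⟩, hx⟩, rfl⟩
      · rintro ⟨x, ⟨hx | hx, hx'⟩, rfl⟩
        · exact hx.1
        · exact absurd hx hx'
    refine ⟨(ε ⁻¹' E(H) ∩ Fᶜ) ∪ F, ⟨Set.subset_union_right, (key _ Set.subset_union_right H
      hH.isSpanningSubgraph hEH).1 hH⟩, ?_⟩
    refine Graph.IsSpanningSubgraph.eq_of_edgeSet_eq (G.restrict_isSpanningSubgraph _)
      hH.isSpanningSubgraph ?_
    rw [Graph.edgeSet_restrict, ← hEH, Set.inter_eq_right]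
    exact hH.isSpanningSubgraph.le.edgeSet_mono


/-! ### Counting cycles and components -/

theorem Equiv.Perm.apply_inv_apply {X : Type*} (π : Equiv.Perm X) (x : X) : π (π⁻¹ x) = x :=
  Equiv.apply_symm_apply π x

theorem Equiv.Perm.inv_apply_apply {X : Type*} (π : Equiv.Perm X) (x : X) : π⁻¹ (π x) = x :=
  Equiv.symm_apply_apply π x

theorem Equiv.Perm.SameCycle.apply_eq_of_invariant {X Y : Type*} {π : Equiv.Perm X} {f : X → Y}
    (hf : ∀ x, f (π x) = f x) {x y : X} (h : π.SameCycle x y) : f x = f y := by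
  obtain ⟨i, rfl⟩ := h
  induction i with
  | zero => rfl
  | succ n ih => rw [add_comm, zpow_add, zpow_one, Equiv.Perm.mul_apply, hf, ih]
  | pred n ih => rw [ih, ← hf ((π ^ (-(n : ℤ) - 1)) x), ← Equiv.Perm.mul_apply, ← zpow_one_add,
      add_sub_cancel]

theorem numCycles_congr {X Y : Type*} (e : X ≃ Y) {π : Equiv.Perm X} {ρ : Equiv.Perm Y}
    (h : ∀ x, e (π x) = ρ (e x)) : numCycles π = numCycles ρ := by
  refine Nat.card_congr (Quotient.congr e fun x y => ?_)
  have h2 : ρ = e.symm.trans (π.trans e) := by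
    ext y
    simp [h]
  change π.SameCycle x y ↔ ρ.SameCycle (e x) (e y)
  constructor
  · exact fun hxy => hxy.apply_eq_of_invariant
      (f := fun z => (⟦e z⟧ : PermCycles ρ)) (fun z => by
        rw [h]
        exact Quotient.sound (Equiv.Perm.sameCycle_apply_left.2 (Equiv.Perm.SameCycle.refl _ _)))
      |> Quotient.exact
  · intro hxy
    have := hxy.apply_eq_of_invariant
      (f := fun z => (⟦e.symm z⟧ : PermCycles π)) (fun z => by
        have : e.symm (ρ z) = π (e.symm z) := by rw [e.symm_apply_eq, h, e.apply_symm_apply]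
        rw [this]
        exact Quotient.sound (Equiv.Perm.sameCycle_apply_left.2 (Equiv.Perm.SameCycle.refl _ _)))
    simp only [Equiv.symm_apply_apply] at this
    exact Quotient.exact this

theorem numCycles_eq_one {X : Type*} [Nonempty X] {π : Equiv.Perm X}
    (h : ∀ x y, π.SameCycle x y) : numCycles π = 1 := by
  refine Nat.card_eq_one_iff_exists.2 ⟨⟦Classical.arbitrary X⟧, fun q => ?_⟩
  induction q using Quotient.inductionOn with | h x =>
  exact Quotient.sound (h _ _)

theorem numCycles_eq_one_of_forall_invariant {X : Type*} [Nonempty X] {π : Equiv.Perm X}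
    (h : ∀ f : X → ℚ, (∀ x, f (π x) = f x) → ∀ x y, f x = f y) : numCycles π = 1 := by
  classical
  refine numCycles_eq_one fun x y => ?_
  have := h (fun z => if π.SameCycle x z then 1 else 0) (fun z => by simp) x y
  by_contra hxy
  simp only [hxy, if_false, Equiv.Perm.SameCycle.refl, if_true] at this
  exact one_ne_zero this

/-- Indicators of orbits are invariant functions. This puts transitivity into the same language of
potentials as the connectedness of graphs. -/
theorem HypermapCollection.isHypermap_iff_forall_invariant {X : Type*} [Nonempty X]
    (M : HypermapCollection X) : M.IsHypermap ↔
      ∀ f : X → ℚ, (∀ x, f (M.σ x) = f x) → (∀ x, f (M.α x) = f x) → ∀ x y, f x = f y := by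
  classical
  constructor
  · intro h f hσ hα x y
    have := (Nat.card_eq_one_iff_unique.1 h).1
    have h1 : (⟦y⟧ : MulAction.orbitRel.Quotient (Subgroup.closure {M.σ, M.α}) X) = ⟦x⟧ :=
      Subsingleton.elim _ _
    obtain ⟨⟨g, hg⟩, rfl⟩ := Quotient.exact h1
    change f x = f (g x)
    induction hg using Subgroup.closure_induction generalizing x with
    | mem g hg =>
      rcases hg with rfl | rfl
      · exact (hσ x).symm
      · exact (hα x).symm
    | one => rfl
    | mul g g' _ _ h h' =>
      rw [Equiv.Perm.mul_apply, ← h (g' x) (Subsingleton.elim _ _),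
        ← h' x (Subsingleton.elim _ _)]
    | inv g _ h =>
      have := h (g⁻¹ x) (Subsingleton.elim _ _)
      rw [Equiv.Perm.apply_inv_apply] at this
      exact this.symm
  · intro h
    obtain ⟨x₀⟩ := ‹Nonempty X›
    let q : X → MulAction.orbitRel.Quotient (Subgroup.closure {M.σ, M.α}) X := fun x => ⟦x⟧
    have hq : ∀ g ∈ ({M.σ, M.α} : Set (Equiv.Perm X)), ∀ x, q (g x) = q x := fun g hg x =>
      Quotient.sound ⟨⟨g, Subgroup.subset_closure hg⟩, rfl⟩
    refine Nat.card_eq_one_iff_exists.2 ⟨q x₀, fun p => ?_⟩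
    induction p using Quotient.inductionOn with | h x =>
    have := h (fun z => if q z = q x₀ then 1 else 0)
      (fun z => by simp only [hq M.σ (by simp)]) (fun z => by simp only [hq M.α (by simp)]) x x₀
    by_contra hx
    simp only [if_true] at this
    rw [if_neg hx] at this
    exact zero_ne_one this

/-! ### Hypertrees and incidence trees -/

/-- If the incidence graph of the cycles of `σ` and `θ` is a tree, then `θ⁻¹ σ` is a cycle. -/
theorem IsIncidenceTree.numCycles_inv_mul_eq_one {X : Type*} [Finite X] [Nonempty X]
    {σ θ : Equiv.Perm X} (h : IsIncidenceTree σ θ Set.univ) : numCycles (θ⁻¹ * σ) = 1 := by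
  have := Fintype.ofFinite X
  refine numCycles_eq_one_of_forall_invariant fun f hf => ?_
  obtain ⟨φ, ψ, hφ, hψ, hfg⟩ := h.1 f
  have hφ' : ∀ x, φ (σ⁻¹ x) = φ x := fun x => by
    rw [← hφ (σ⁻¹ x), Equiv.Perm.apply_inv_apply]
  -- Invariance of `f = φ - ψ` is evaluated at `σ⁻¹ (θ x)`, where `φ` has the same value as at `θ
  -- x`.
  have key : ∀ x, φ x - φ (θ x) = ψ x - ψ (σ⁻¹ (θ x)) := by
    intro x
    have h1 := hf (σ⁻¹ (θ x))
    simp only [Equiv.Perm.mul_apply, Equiv.Perm.apply_inv_apply, Equiv.Perm.inv_apply_apply] at h1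
    rw [← hfg _ (Set.mem_univ _), ← hfg _ (Set.mem_univ _), hφ'] at h1
    linarith
  -- After substituting `key`, reindexing by `θ` and by `σ` turns both sums into the sum of `φ * ψ`.
  have h1 : ∑ x, φ (θ x) * (φ x - φ (θ x)) = 0 := by
    simp only [key, mul_sub, Finset.sum_sub_distrib]
    rw [sub_eq_zero, Equiv.sum_comp θ (fun w => φ w * ψ (σ⁻¹ w)),
      ← Equiv.sum_comp σ (fun w => φ w * ψ (σ⁻¹ w)), ← Equiv.sum_comp θ (fun w => φ (σ w) * _)]
    simp [hφ, hψ]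
  -- An energy argument: the vanishing sum of squares makes `φ` invariant under both permutations,
  -- hence constant by connectedness; then the same holds for `ψ`.
  have h2 : ∑ x, (φ x - φ (θ x)) ^ 2 = 0 := by
    have h3 : ∀ x, (φ x - φ (θ x)) ^ 2 =
      φ x ^ 2 - φ (θ x) ^ 2 - 2 * (φ (θ x) * (φ x - φ (θ x))) := fun x => by ring
    simp only [h3, Finset.sum_sub_distrib, ← Finset.mul_sum, h1]
    rw [Equiv.sum_comp θ (fun w => φ w ^ 2)]
    ring
  have h3 : ∀ x, φ (θ x) = φ x := by
    intro x
    have := (Finset.sum_eq_zero_iff_of_nonneg (fun x _ => sq_nonneg _)).1 h2 x (Finset.mem_univ _)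
    have := pow_eq_zero_iff (two_ne_zero) |>.1 this
    linarith
  have h4 : ∀ x, ψ (σ x) = ψ x := by
    intro x
    have := key (θ⁻¹ (σ x))
    rw [← h3 (θ⁻¹ (σ x)), ← hψ (θ⁻¹ (σ x)), Equiv.Perm.apply_inv_apply,
      Equiv.Perm.inv_apply_apply] at this
    linarith
  intro x y
  rw [← hfg x trivial, ← hfg y trivial, h.2 φ φ hφ h3 (fun _ _ => rfl) x y,
    h.2 ψ ψ h4 hψ (fun _ _ => rfl) x y]

/-- For a connected unicellular pair, genus zero says that the number of points plus one is `z(σ) +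
z(θ)`, which is Euler's count for a tree with the points as edges. Conversely a tree is
automatically unicellular by `IsIncidenceTree.numCycles_inv_mul_eq_one`. -/
theorem HypermapCollection.isIncidenceTree_univ_iff {X : Type*} [Finite X] [Nonempty X]
    (σ θ : Equiv.Perm X) : IsIncidenceTree σ θ Set.univ ↔
      (HypermapCollection.mk σ θ).IsHypermap ∧ numCycles (θ⁻¹ * σ) = 1 ∧
        (HypermapCollection.mk σ θ).genus = 0 := by
  have hinv : IsIncidenceTree σ θ Set.univ ↔
      (∀ g : X → ℚ, ∃ φ ψ : X → ℚ, (∀ x, φ (σ x) = φ x) ∧ (∀ x, ψ (θ x) = ψ x) ∧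
        ∀ x, φ x - ψ x = g x) ∧ (HypermapCollection.mk σ θ).IsHypermap := by
    rw [HypermapCollection.isHypermap_iff_forall_invariant]
    simp only [IsIncidenceTree, Set.mem_univ, forall_const]
    refine and_congr_right fun _ => ⟨fun h f h1 h2 => h f f h1 h2 fun _ => rfl,
      fun h φ ψ h1 h2 h3 x y => ?_⟩
    rw [← h3 y]
    exact h φ h1 (fun z => by rw [h3, h3, h2]) x y
  have hcard : (HypermapCollection.mk σ θ).IsHypermap →
      ((∀ g : X → ℚ, ∃ φ ψ : X → ℚ, (∀ x, φ (σ x) = φ x) ∧ (∀ x, ψ (θ x) = ψ x) ∧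
        ∀ x, φ x - ψ x = g x) ↔ Nat.card X + 1 = numCycles σ + numCycles θ) := by
    intro h
    rw [HypermapCollection.isHypermap_iff_forall_invariant] at h
    have : Nonempty (PermCycles σ) := ⟨⟦Classical.arbitrary X⟧⟩
    have hcl : ∀ (π : Equiv.Perm X) x, (⟦π x⟧ : PermCycles π) = ⟦x⟧ := fun π x =>
      Quotient.sound (Equiv.Perm.sameCycle_apply_left.2 (Equiv.Perm.SameCycle.refl _ _))
    rw [numCycles, numCycles, ← Nat.card_sum, card_add_one_eq_iff_forall_exists_potential
      (fun x => Sum.inl (⟦x⟧ : PermCycles σ)) (fun x => Sum.inr (⟦x⟧ : PermCycles θ))]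
    · refine forall_congr' fun g => ⟨?_, ?_⟩
      · rintro ⟨φ, ψ, hφ, hψ, h⟩
        exact ⟨Sum.elim
          (Quotient.lift φ fun _ _ hxy => Equiv.Perm.SameCycle.apply_eq_of_invariant hφ hxy)
          (Quotient.lift ψ fun _ _ hxy => Equiv.Perm.SameCycle.apply_eq_of_invariant hψ hxy),
          fun x => h x⟩
      · rintro ⟨χ, hχ⟩
        exact ⟨fun x => χ (Sum.inl ⟦x⟧), fun x => χ (Sum.inr ⟦x⟧),
          fun x => by simp only [hcl], fun x => by simp only [hcl], hχ⟩
    · intro χ hχ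
      have h1 := h (fun x => χ (Sum.inl ⟦x⟧)) (fun x => by simp only [hcl])
        (fun x => by simp only [hχ, hcl])
      rintro (u | u) (v | v) <;> induction u using Quotient.inductionOn with | h x => ?_ <;>
        induction v using Quotient.inductionOn with | h y => ?_
      · exact h1 x y
      · rw [← hχ]; exact h1 x y
      · rw [← hχ]; exact h1 x y
      · rw [← hχ, ← hχ]; exact h1 x y
  constructor
  · intro h
    have h' := hinv.1 h
    refine ⟨h'.2, h.numCycles_inv_mul_eq_one, ?_⟩
    have h1 := (hcard h'.2).1 h'.1
    have h2 : (HypermapCollection.mk σ θ).numComponents = 1 := h'.2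
    simp only [HypermapCollection.genus, h.numCycles_inv_mul_eq_one, h2]
    have h3 : (Nat.card X : ℚ) + 1 = numCycles σ + numCycles θ := by exact_mod_cast h1
    push_cast
    linarith
  · rintro ⟨h, h1, h2⟩
    refine hinv.2 ⟨(hcard h).2 ?_, h⟩
    have h3 : (HypermapCollection.mk σ θ).numComponents = 1 := h
    simp only [HypermapCollection.genus, h1, h3] at h2
    have : (Nat.card X : ℚ) + 1 = numCycles σ + numCycles θ := by
      push_cast at h2
      linarith
    exact_mod_cast this

/-! ### Refinements of permutations with cycles of length at most three -/

instance PermCycles.instFintype {X : Type*} [Fintype X] [DecidableEq X] (π : Equiv.Perm X) :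
    Fintype (PermCycles π) :=
  @Quotient.fintype X _ (Equiv.Perm.SameCycle.setoid π)
    (fun x y => inferInstanceAs (Decidable (π.SameCycle x y)))

theorem card_permCycles_fin_one : ∀ θ : Equiv.Perm (Fin 1),
    Fintype.card (PermCycles θ) + Fintype.card (PermCycles ((finRotate 1)⁻¹ * θ)) = 2 := by
  decide

theorem card_permCycles_fin_two : ∀ θ : Equiv.Perm (Fin 2),
    Fintype.card (PermCycles θ) + Fintype.card (PermCycles ((finRotate 2)⁻¹ * θ)) = 3 := by
  decide

/-- Five of the six permutations correspond to the noncrossing partitions of three points; only the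
inverse rotation has positive genus. -/
theorem card_permCycles_fin_three : ∀ θ : Equiv.Perm (Fin 3),
    Fintype.card (PermCycles θ) + Fintype.card (PermCycles ((finRotate 3)⁻¹ * θ)) = 4 ↔
      ¬ ∀ i, finRotate 3 (θ i) = i := by
  decide

theorem HypermapCollection.genus_eq_zero_iff_of_sameCycle {Y : Type*} [Nonempty Y]
    (θ γ : Equiv.Perm Y) (h : ∀ x y, γ.SameCycle x y) :
    (HypermapCollection.mk θ γ).genus = 0 ↔
      numCycles θ + numCycles (γ⁻¹ * θ) = Nat.card Y + 1 := by
  have h1 : (HypermapCollection.mk θ γ).numComponents = 1 :=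
    (HypermapCollection.isHypermap_iff_forall_invariant _).2 fun f _ hf x y =>
      (h x y).apply_eq_of_invariant hf
  simp only [HypermapCollection.genus, h1, numCycles_eq_one h]
  rw [← @Nat.cast_inj ℚ]
  push_cast
  constructor <;> intro h <;> linarith

/-- Transports a single cycle to `Fin k`, where the genus condition is decidable by enumeration. -/
theorem HypermapCollection.genus_eq_zero_iff_of_finRotate {Y : Type*} [Nonempty Y] {k : ℕ}
    (θ γ : Equiv.Perm Y) (h : ∀ x y, γ.SameCycle x y) (e : Fin k ≃ Y)
    (he : ∀ i, e (finRotate k i) = γ (e i)) :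
    ∃ ρ : Equiv.Perm (Fin k), (∀ i, e (ρ i) = θ (e i)) ∧
      ((HypermapCollection.mk θ γ).genus = 0 ↔
        Fintype.card (PermCycles ρ) + Fintype.card (PermCycles ((finRotate k)⁻¹ * ρ)) = k + 1) := by
  have hρ : ∀ i, e ((e.trans (θ.trans e.symm)) i) = θ (e i) := fun i => by simp
  refine ⟨e.trans (θ.trans e.symm), hρ, ?_⟩
  rw [HypermapCollection.genus_eq_zero_iff_of_sameCycle θ γ h, ← numCycles_congr e hρ,
    ← numCycles_congr e (π := (finRotate k)⁻¹ * (e.trans (θ.trans e.symm))) (ρ := γ⁻¹ * θ),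
    ← Nat.card_congr e, Nat.card_fin, numCycles, numCycles, Nat.card_eq_fintype_card,
    Nat.card_eq_fintype_card]
  intro i
  rw [Equiv.Perm.mul_apply, Equiv.Perm.mul_apply, Equiv.Perm.eq_inv_iff_eq, ← he,
    Equiv.Perm.apply_inv_apply, hρ]

theorem Equiv.Perm.sameCycle_iff_of_cycle_le_three {X : Type*} {γ : Equiv.Perm X}
    (hγ : ∀ x, γ (γ x) = x ∨ γ (γ (γ x)) = x) (x y : X) :
    γ.SameCycle x y ↔ y = x ∨ y = γ x ∨ y = γ (γ x) := by
  constructor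
  · intro h
    have := h.apply_eq_of_invariant (f := fun y => (y = x ∨ y = γ x ∨ y = γ (γ x) : Prop))
      (fun z => by
        have := hγ x
        have := hγ z
        have := γ.injective.eq_iff (a := z) (b := x)
        have := γ.injective.eq_iff (a := z) (b := γ x)
        have := γ.injective.eq_iff (a := z) (b := γ (γ x))
        ext
        grind)
    simpa using this
  · rintro (rfl | rfl | rfl) <;> simp [Equiv.Perm.SameCycle.refl]

/-- On a cycle of length at most three the genus condition forbids only the inverse of a 3-cycle.
Refinement thus becomes a system of equations between points. -/
theorem refines_iff_of_cycle_le_three {X : Type*} (θ γ : Equiv.Perm X)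
    (hγ : ∀ x, γ (γ x) = x ∨ γ (γ (γ x)) = x) :
    Refines θ γ ↔ (∀ x, θ x = x ∨ θ x = γ x ∨ θ x = γ (γ x)) ∧
      ∀ x, γ x ≠ x → γ (γ (γ x)) = x →
        ¬ (θ x = γ (γ x) ∧ θ (γ x) = x ∧ θ (γ (γ x)) = γ x) := by
  have hpres : (∀ x, θ x = x ∨ θ x = γ x ∨ θ x = γ (γ x)) ↔
      ∀ x, ∀ y, γ.SameCycle x (θ y) ↔ γ.SameCycle x y := by
    constructor
    · intro h x y
      have hy : γ.SameCycle y (θ y) := (Equiv.Perm.sameCycle_iff_of_cycle_le_three hγ _ _).2 (h y)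
      exact ⟨fun h => h.trans hy.symm, fun h => h.trans hy⟩
    · exact fun h x => (Equiv.Perm.sameCycle_iff_of_cycle_le_three hγ _ _).1
        ((h x x).2 (Equiv.Perm.SameCycle.refl _ _))
  have key : ∀ x (h : ∀ y, γ.SameCycle x (θ y) ↔ γ.SameCycle x y),
      (HypermapCollection.mk (X := {y // γ.SameCycle x y}) (θ.subtypePerm h)
        (γ.subtypePerm fun _ => Equiv.Perm.sameCycle_apply_right)).genus = 0 ↔
      (γ x ≠ x → γ (γ (γ x)) = x →
        ¬ (θ x = γ (γ x) ∧ θ (γ x) = x ∧ θ (γ (γ x)) = γ x)) := by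
    intro x h
    have : Nonempty {y // γ.SameCycle x y} := ⟨⟨x, Equiv.Perm.SameCycle.refl _ _⟩⟩
    have hsame : ∀ a b : {y // γ.SameCycle x y}, (γ.subtypePerm (p := fun y => γ.SameCycle x y)
        fun _ => Equiv.Perm.sameCycle_apply_right).SameCycle a b := by
      rintro ⟨a, ha⟩ ⟨b, hb⟩
      rw [Equiv.Perm.sameCycle_subtypePerm]
      exact ha.symm.trans hb
    have hx0 : γ.SameCycle x x := Equiv.Perm.SameCycle.refl _ _
    have hx1 : γ.SameCycle x (γ x) := Equiv.Perm.sameCycle_apply_right.2 hx0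
    have hx2 : γ.SameCycle x (γ (γ x)) := Equiv.Perm.sameCycle_apply_right.2 hx1
    have hmem : ∀ y, γ.SameCycle x y → y = x ∨ y = γ x ∨ y = γ (γ x) := fun y =>
      (Equiv.Perm.sameCycle_iff_of_cycle_le_three hγ x y).1
    by_cases h1 : γ x = x
    · let e : Fin 1 ≃ {y // γ.SameCycle x y} := Equiv.ofBijective ![⟨x, hx0⟩] ⟨by
        intro i j _; exact Subsingleton.elim _ _, by
        rintro ⟨y, hy⟩
        refine ⟨0, Subtype.ext ?_⟩
        have := hmem y hy
        simp only [h1, or_self] at this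
        simp [this]⟩
      obtain ⟨ρ, -, hρ⟩ := HypermapCollection.genus_eq_zero_iff_of_finRotate
        (θ.subtypePerm h) _ hsame e (by
          intro i
          fin_cases i
          exact Subtype.ext h1.symm)
      rw [hρ]
      simp only [card_permCycles_fin_one ρ, h1, ne_eq, not_true, false_imp_iff]
    by_cases h2 : γ (γ x) = x
    · let e : Fin 2 ≃ {y // γ.SameCycle x y} := Equiv.ofBijective ![⟨x, hx0⟩, ⟨γ x, hx1⟩] ⟨by
        intro i j hij
        have hv := congrArg Subtype.val hij
        fin_cases i <;> fin_cases j <;> first | rfl | (exfalso; simp at hv; grind), by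
        rintro ⟨y, hy⟩
        rcases hmem y hy with rfl | rfl | rfl
        · exact ⟨0, rfl⟩
        · exact ⟨1, rfl⟩
        · exact ⟨0, Subtype.ext h2.symm⟩⟩
      obtain ⟨ρ, -, hρ⟩ := HypermapCollection.genus_eq_zero_iff_of_finRotate
        (θ.subtypePerm h) _ hsame e (by
          intro i
          fin_cases i
          · exact Subtype.ext rfl
          · exact Subtype.ext h2.symm)
      rw [hρ]
      simp only [card_permCycles_fin_two ρ, h2, true_iff]
      intro _ h3
      exact absurd h3 h1
    have h3 : γ (γ (γ x)) = x := (hγ x).resolve_left h2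
    have h4 : γ (γ x) ≠ γ x := fun h => h1 (γ.injective h)
    let e : Fin 3 ≃ {y // γ.SameCycle x y} := Equiv.ofBijective
        ![⟨x, hx0⟩, ⟨γ x, hx1⟩, ⟨γ (γ x), hx2⟩] ⟨by
      intro i j hij
      have hv := congrArg Subtype.val hij
      fin_cases i <;> fin_cases j <;> first | rfl | (exfalso; simp at hv; grind), by
      rintro ⟨y, hy⟩
      rcases hmem y hy with rfl | rfl | rfl
      · exact ⟨0, rfl⟩
      · exact ⟨1, rfl⟩
      · exact ⟨2, rfl⟩⟩
    obtain ⟨ρ, hρ', hρ⟩ := HypermapCollection.genus_eq_zero_iff_of_finRotate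
      (θ.subtypePerm h) _ hsame e (by
        intro i
        fin_cases i
        · exact Subtype.ext rfl
        · exact Subtype.ext rfl
        · exact Subtype.ext h3.symm)
    have hrot : ∀ i, (e (finRotate 3 i)).1 = γ (e i).1 := by
      intro i
      fin_cases i
      · rfl
      · rfl
      · exact h3.symm
    have hi : ∀ i, finRotate 3 (ρ i) = i ↔ γ (θ (e i).1) = (e i).1 := by
      intro i
      rw [← e.injective.eq_iff, ← Subtype.coe_injective.eq_iff, hrot, hρ']
      rfl
    have h5 : (∀ i, finRotate 3 (ρ i) = i) ↔
        (θ x = γ (γ x) ∧ θ (γ x) = x ∧ θ (γ (γ x)) = γ x) := by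
      simp only [hi, Fin.forall_fin_succ]
      have e0 : (e 0).1 = x := rfl
      have e1 : (e 1).1 = γ x := rfl
      have e2 : (e 2).1 = γ (γ x) := rfl
      have i0 := γ.injective.eq_iff (a := θ x) (b := γ (γ x))
      have i1 := γ.injective.eq_iff (a := θ (γ x)) (b := x)
      have i2 := γ.injective.eq_iff (a := θ (γ (γ x))) (b := γ x)
      rw [h3] at i0
      simp [e0, e1, e2, i0, i1, i2]
    rw [hρ, card_permCycles_fin_three, h5]
    simp [h1, h3]
  constructor
  · intro h
    have h0 := fun x => (h x).choose
    exact ⟨hpres.2 h0, fun x => (key x (h0 x)).1 (h x).choose_spec⟩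
  · intro h x
    exact ⟨hpres.1 h.1 x, (key x (hpres.1 h.1 x)).2 (h.2 x)⟩


/-! ### Spanning hypertrees as incidence trees -/

open Classical in
/-- The first return map to `A` of a permutation `γ` whose cycles have length at most three,
extended by the identity outside `A`. -/
noncomputable def firstReturn {X : Type*} (γ : Equiv.Perm X) (A : Set X) (x : X) : X :=
  if x ∈ A then (if γ x ∈ A then γ x else if γ (γ x) ∈ A then γ (γ x) else x) else x

/-- The cycles of `γ` have length at most three, and `S` contains exactly one point of each. -/
structure IsShortTransversal {X : Type*} (γ : Equiv.Perm X) (S : Set X) : Prop where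
  short : ∀ x, γ (γ x) = x ∨ γ (γ (γ x)) = x
  exists_mem : ∀ x, x ∈ S ∨ γ x ∈ S ∨ γ (γ x) ∈ S
  apply_eq : ∀ x ∈ S, γ x ∈ S → γ x = x
  apply_apply_eq : ∀ x ∈ S, γ (γ x) ∈ S → γ (γ x) = x

/-- Every cycle of `γ` meets `A`, and if it does so in one point, this point belongs to `S`. -/
def LeavesIn {X : Type*} (γ : Equiv.Perm X) (S A : Set X) : Prop :=
  ∀ x ∈ S, x ∈ A ∨ (γ x ∈ A ∧ γ (γ x) ∈ A)

namespace IsShortTransversal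

variable {X : Type*} {γ : Equiv.Perm X} {S : Set X}

theorem firstReturn_injective (h : IsShortTransversal γ S) (A : Set X) :
    Function.Injective (firstReturn γ A) := by
  intro x y hxy
  have := h.short x
  have := h.short y
  have := h.short (γ x)
  have := h.short (γ y)
  have hi := γ.injective
  unfold firstReturn at hxy
  grind [Function.Injective]

/-- If `A` has at least two points on a cycle, they are the points moved there. If it has only one,
the return map is the identity on the cycle and `S` tells which point it is. -/
theorem mem_iff_firstReturn (h : IsShortTransversal γ S) {A : Set X} (hA : LeavesIn γ S A)
    (x : X) : x ∈ A ↔ (firstReturn γ A x ≠ x ∨ (x ∈ S ∧ firstReturn γ A x = x ∧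
      firstReturn γ A (γ x) = γ x ∧ firstReturn γ A (γ (γ x)) = γ (γ x))) := by
  have := h.short x
  have := h.exists_mem x
  have := h.apply_eq x
  have := h.apply_apply_eq x
  have := h.apply_eq (γ x)
  have := h.apply_eq (γ (γ x))
  have := h.apply_apply_eq (γ x)
  have := hA x
  have := hA (γ x)
  have := hA (γ (γ x))
  unfold firstReturn
  grind

/-- The set of points from which a refinement of `γ` can be recovered by first returns. -/
def support (_ : IsShortTransversal γ S) (θ : Equiv.Perm X) : Set X :=
  {x | θ x ≠ x ∨ (x ∈ S ∧ θ x = x ∧ θ (γ x) = γ x ∧ θ (γ (γ x)) = γ (γ x))}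

/-- Three points leave room for only one nontrivial cycle of `θ`, and genus zero makes it run in the
direction of `γ`. -/
theorem firstReturn_support (h : IsShortTransversal γ S) {θ : Equiv.Perm X} (hθ : Refines θ γ)
    (x : X) : firstReturn γ (h.support θ) x = θ x := by
  rw [refines_iff_of_cycle_le_three θ γ h.short] at hθ
  have := h.short x
  have := h.exists_mem x
  have := h.apply_eq x
  have := h.apply_apply_eq x
  have := h.apply_eq (γ x)
  have := h.apply_eq (γ (γ x))
  have := h.apply_apply_eq (γ x)
  have := hθ.1 x
  have := hθ.1 (γ x)
  have := hθ.1 (γ (γ x))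
  have := hθ.2 x
  have := θ.injective.eq_iff (a := x) (b := γ x)
  have := θ.injective.eq_iff (a := x) (b := γ (γ x))
  have := θ.injective.eq_iff (a := γ x) (b := γ (γ x))
  unfold firstReturn support
  simp only [Set.mem_ofPred_eq]
  grind

theorem leavesIn_support (h : IsShortTransversal γ S) {θ : Equiv.Perm X} (hθ : Refines θ γ) :
    LeavesIn γ S (h.support θ) := by
  rw [refines_iff_of_cycle_le_three θ γ h.short] at hθ
  intro x hx
  have := h.short x
  have := hθ.1 x
  have := hθ.1 (γ x)
  have := hθ.1 (γ (γ x))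
  have := θ.injective.eq_iff (a := x) (b := γ x)
  have := θ.injective.eq_iff (a := x) (b := γ (γ x))
  have := θ.injective.eq_iff (a := γ x) (b := γ (γ x))
  unfold support
  simp only [Set.mem_ofPred_eq]
  grind

theorem refines_of_firstReturn (h : IsShortTransversal γ S) {A : Set X} {θ : Equiv.Perm X}
    (hθ : ∀ x, θ x = firstReturn γ A x) : Refines θ γ := by
  rw [refines_iff_of_cycle_le_three θ γ h.short]
  refine ⟨fun x => ?_, fun x => ?_⟩
  · rw [hθ]
    unfold firstReturn
    grind
  · have := h.short x
    rw [hθ, hθ, hθ]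
    unfold firstReturn
    grind

open Classical in
/-- The function that has the same values as `ψ` on `A` and is constant on the cycles of `γ`, for
a function `ψ` that is constant on the intersections of these cycles with `A`. -/
theorem exists_invariant_extension (h : IsShortTransversal γ S) {A : Set X}
    (hA : LeavesIn γ S A) (ψ : X → ℚ) (hψ : ∀ x, ψ (firstReturn γ A x) = ψ x) :
    ∃ χ : X → ℚ, (∀ x, χ (γ x) = χ x) ∧ ∀ x ∈ A, χ x = ψ x := by
  refine ⟨fun x => if x ∈ A then ψ x else if γ x ∈ A then ψ (γ x) else ψ (γ (γ x)),
    fun x => ?_, fun x hx => if_pos hx⟩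
  have := h.short x
  have := h.exists_mem x
  have := hA x
  have := hA (γ x)
  have := hA (γ (γ x))
  have h1 := hψ x
  have h2 := hψ (γ x)
  have h3 := hψ (γ (γ x))
  unfold firstReturn at h1 h2 h3
  grind

/-- A point outside `A` is a fixed point of `θ`, hence a leaf of the incidence graph of `σ` and `θ`.
Once these leaves are deleted, each cycle of `γ` carries exactly one remaining cycle of `θ`, its
intersection with `A`, which can stand for the cycle of `γ`. -/
theorem isIncidenceTree_firstReturn_iff (h : IsShortTransversal γ S) {A : Set X}
    (hA : LeavesIn γ S A) {σ θ : Equiv.Perm X} (hθ : ∀ x, θ x = firstReturn γ A x) :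
    IsIncidenceTree σ θ Set.univ ↔ IsIncidenceTree σ γ A := by
  have hmove : ∀ x, θ x ≠ x → x ∈ A ∧ θ x ∈ A ∧ (θ x = γ x ∨ θ x = γ (γ x)) := by
    intro x
    rw [hθ]
    unfold firstReturn
    grind
  have hmeet : ∀ x, x ∈ A ∨ γ x ∈ A ∨ γ (γ x) ∈ A := by
    intro x
    have := h.short x
    have := h.exists_mem x
    have := hA x
    have := hA (γ x)
    have := hA (γ (γ x))
    grind
  have hinv : ∀ ψ : X → ℚ, (∀ x, ψ (γ x) = ψ x) → ∀ f : X → ℚ, (∀ x ∈ A, f x = ψ x) →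
      ∀ x, f (θ x) = f x := by
    intro ψ hψ f hf x
    by_cases hx : θ x = x
    · rw [hx]
    · obtain ⟨h1, h2, h3⟩ := hmove x hx
      rw [hf _ h1, hf _ h2]
      rcases h3 with h3 | h3 <;> simp [h3, hψ]
  constructor
  · rintro ⟨h1, h2⟩
    constructor
    · intro g
      obtain ⟨φ, ψ, hφ, hψ, hg⟩ := h1 g
      obtain ⟨χ, hχ, hχA⟩ := h.exists_invariant_extension hA ψ fun x => by rw [← hθ, hψ]
      exact ⟨φ, χ, hφ, hχ, fun x hx => by rw [hχA x hx, hg x trivial]⟩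
    · intro φ ψ hφ hψ hφψ x y
      have h3 := h2 φ φ hφ (hinv ψ hψ φ hφψ) fun _ _ => rfl
      rcases hmeet y with hy | hy | hy
      · rw [← hφψ y hy]; exact h3 _ _
      · rw [← hψ, ← hφψ _ hy]; exact h3 _ _
      · rw [← hψ, ← hψ, ← hφψ _ hy]; exact h3 _ _
  · rintro ⟨h1, h2⟩
    constructor
    · intro g
      obtain ⟨φ, ψ, hφ, hψ, hg⟩ := h1 g
      refine ⟨φ, fun x => φ x - g x, hφ, hinv ψ hψ (fun x => φ x - g x) fun x hx => ?_,
        fun x _ => by ring⟩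
      have := hg x hx
      linarith
    · intro φ ψ hφ hψ hφψ x y
      obtain ⟨χ, hχ, hχA⟩ := h.exists_invariant_extension hA ψ fun x => by rw [← hθ, hψ]
      have h3 := h2 φ χ hφ hχ fun x hx => by rw [hχA x hx, hφψ x trivial]
      rw [← hφψ y trivial, h3 x x, h3 y x]

/-- Spanning hypertrees correspond to the spanning trees of the incidence graph such that every
cycle of `α` that is a leaf is attached to the tree by its point in `S`. -/
theorem numSpanningHypertrees_eq [Finite X] [Nonempty X] {M : HypermapCollection X}
    (h : IsShortTransversal M.α S) : M.numSpanningHypertrees =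
      Set.ncard {A : Set X | LeavesIn M.α S A ∧ IsIncidenceTree M.σ M.α A} := by
  have hiff : ∀ (A : Set X) (θ : Equiv.Perm X), LeavesIn M.α S A →
      (∀ x, θ x = firstReturn M.α A x) → (M.IsSpanningHypertree θ ↔ IsIncidenceTree M.σ M.α A) := by
    intro A θ hA hθ
    rw [← h.isIncidenceTree_firstReturn_iff hA hθ, HypermapCollection.isIncidenceTree_univ_iff]
    exact ⟨fun h => ⟨h.isHypermap, h.unicellular, h.genus_eq_zero⟩,
      fun h' => ⟨h.refines_of_firstReturn hθ, h'.1, h'.2.1, h'.2.2⟩⟩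
  symm
  refine Set.ncard_congr (fun A _ => Equiv.ofBijective (firstReturn M.α A)
    (Finite.injective_iff_bijective.1 (h.firstReturn_injective A))) ?_ ?_ ?_
  · rintro A ⟨hA, hT⟩
    exact (hiff A _ hA fun x => rfl).2 hT
  · rintro A B ⟨hA, -⟩ ⟨hB, -⟩ hAB
    have hAB' : firstReturn M.α A = firstReturn M.α B :=
      funext fun x => congrArg (fun e : Equiv.Perm X => e x) hAB
    ext x
    rw [h.mem_iff_firstReturn hA, h.mem_iff_firstReturn hB, hAB']
  · intro θ hθ
    have h1 := h.firstReturn_support hθ.refines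
    have h2 := h.leavesIn_support hθ.refines
    exact ⟨h.support θ, ⟨h2, (hiff _ θ h2 fun x => (h1 x).symm).1 hθ⟩, Equiv.ext h1⟩

end IsShortTransversal


/-! ### The two-colored graph as a contraction of the incidence graph -/

namespace IsShortTransversal

variable {X : Type*} {S : Set X}

open Classical in
/-- The spanning trees of the two-colored graph correspond to the spanning trees of the incidence
graph that contain the chosen point of each cycle of `α` of length at most two. -/
theorem numSpanningTrees_twoColoredGraph [Finite X] [Nonempty X] {M : HypermapCollection X}
    (h : IsShortTransversal M.α S) : M.twoColoredGraph.numSpanningTrees =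
      Set.ncard {A : Set X | {x ∈ S | ¬ OnThreeCycle M.α x} ⊆ A ∧
        IsIncidenceTree M.σ M.α A} := by
  have hcl : ∀ {Y : Type _} (π : Equiv.Perm Y) y, (⟦π y⟧ : PermCycles π) = ⟦y⟧ := fun π y =>
    Quotient.sound (Equiv.Perm.sameCycle_apply_left.2 (Equiv.Perm.SameCycle.refl _ _))
  have hσl : ∀ x, M.twoColoredMap.σ (Sum.inl x) = Sum.inl (M.σ x) := fun x => rfl
  have hσr : ∀ x : {x // OnThreeCycle M.α x}, M.twoColoredMap.σ
      (Sum.inr ⟨M.α x.1, (onThreeCycle_apply_iff _ _).2 x.2⟩) = Sum.inr x := fun x =>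
    congrArg Sum.inr (Subtype.ext (M.α.symm_apply_apply x.1))
  have hα3 : ∀ x (hx : OnThreeCycle M.α x), M.twoColoredMap.α (Sum.inl x) = Sum.inr ⟨x, hx⟩ :=
    fun x hx => dif_pos hx
  have hα2 : ∀ x (hx : ¬ OnThreeCycle M.α x), M.twoColoredMap.α (Sum.inl x) = Sum.inl (M.α x) :=
    fun x hx => dif_neg hx
  have hαr : ∀ x : {x // OnThreeCycle M.α x}, M.twoColoredMap.α (Sum.inr x) = Sum.inl x.1 :=
    fun x => rfl
  have hthree : ∀ x, ¬ OnThreeCycle M.α x → M.α (M.α x) = x := by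
    intro x hx
    by_contra h'
    refine hx ⟨fun h1 => h' (by rw [h1, h1]), (h.short x).resolve_left h'⟩
  have hS2 : ∀ x, ¬ OnThreeCycle M.α x → x ∉ S → M.α x ∈ S := fun x hx hxS => by
    have := h.exists_mem x
    rw [hthree x hx] at this
    tauto
  have hS2' : ∀ x, x ∈ S → M.α x ∈ S → M.α x = x := h.apply_eq
  have : Nonempty (PermCycles M.twoColoredMap.σ) := ⟨⟦Sum.inl (Classical.arbitrary X)⟧⟩
  -- A 3-cycle keeps its white vertex. A shorter cycle is merged with the black vertex of its chosen
  -- point; its other point, if any, then becomes the edge between two black vertices.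
  refine Graph.numSpanningTrees_eq_ncard_isIncidenceTree M.σ M.α
    {x ∈ S | ¬ OnThreeCycle M.α x} M.twoColoredGraph rfl
    (fun x => ⟦Sum.inl x⟧)
    (fun x => if hx : OnThreeCycle M.α x then ⟦Sum.inr ⟨x, hx⟩⟧
      else ⟦Sum.inl (if x ∈ S then x else M.α x)⟧)
    (fun x => ⟦Sum.inl x⟧) ?_ ?_ ?_ ?_ ?_ ?_ ?_ ?_ ?_
  · intro x
    exact hcl M.twoColoredMap.σ (Sum.inl x)
  · intro x
    by_cases hx : OnThreeCycle M.α x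
    · have hx' := (onThreeCycle_apply_iff M.α x).2 hx
      rw [dif_pos hx, dif_pos hx', ← hσr ⟨x, hx⟩, hcl]
    · have hx' := mt (onThreeCycle_apply_iff M.α x).1 hx
      rw [dif_neg hx, dif_neg hx']
      have := hthree x hx
      have := hS2 x hx
      have := hS2' x
      grind
  · intro v
    induction v using Quotient.inductionOn with | h y =>
    rcases y with x | ⟨x, hx⟩
    · exact Or.inl ⟨x, rfl⟩
    · exact Or.inr ⟨x, dif_pos hx⟩
  · rintro x ⟨hxS, hx⟩
    rw [dif_neg hx, if_pos hxS]
  · intro x hxF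
    by_cases hx : OnThreeCycle M.α x
    · rw [dif_pos hx]
      refine ⟨Sum.inl x, ?_, ?_, rfl, rfl, ?_⟩
      · rw [hα3 x hx]; exact Sum.inr_ne_inl
      · rw [hα3 x hx, hαr]
      · rw [hα3 x hx]
    · have hxS : x ∉ S := fun hxS => hxF ⟨hxS, hx⟩
      rw [dif_neg hx, if_neg hxS]
      refine ⟨Sum.inl x, ?_, ?_, rfl, rfl, ?_⟩
      · rw [hα2 x hx]
        intro h1
        exact hxS ((Sum.inl_injective h1) ▸ hS2 x hx hxS)
      · rw [hα2 x hx, hα2 _ (mt (onThreeCycle_apply_iff M.α x).1 hx), hthree x hx]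
      · rw [hα2 x hx]
  · intro x hx y hy hxy
    -- This function is constant on each edge and the identity on uncontracted points, so an edge
    -- determines its uncontracted point.
    have := (Quotient.exact hxy : M.twoColoredMap.α.SameCycle _ _).apply_eq_of_invariant
      (f := Sum.elim (fun x => if x ∈ S ∧ ¬ OnThreeCycle M.α x then M.α x else x)
        (fun x => x.1)) (by
      rintro (z | ⟨z, hz⟩)
      · by_cases hz : OnThreeCycle M.α z
        · rw [hα3 z hz]
          simp [hz]
        · have hz' := mt (onThreeCycle_apply_iff M.α z).1 hz
          rw [hα2 z hz]
          have := hthree z hz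
          have := hS2 z hz
          have := hS2' z
          simp only [Sum.elim_inl, hz, hz', not_false_eq_true, and_true]
          grind
      · rw [hαr]
        simp [hz])
    have hx' : ¬ (x ∈ S ∧ ¬ OnThreeCycle M.α x) := hx
    have hy' : ¬ (y ∈ S ∧ ¬ OnThreeCycle M.α y) := hy
    simpa only [Sum.elim_inl, if_neg hx', if_neg hy'] using this
  · intro e he
    obtain ⟨u, v, p, h1, -, rfl, -, -⟩ := Graph.exists_isLink_of_mem_edgeSet he
    have h3 : ∀ x (hx : OnThreeCycle M.α x), x ∉ {x ∈ S | ¬ OnThreeCycle M.α x} :=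
      fun x hx hx' => hx'.2 hx
    rcases p with x | ⟨x, hx⟩
    · by_cases hx : OnThreeCycle M.α x
      · exact ⟨x, h3 x hx, rfl⟩
      · by_cases hxS : x ∈ S
        · refine ⟨M.α x, fun h2 => h1 ?_, ?_⟩
          · rw [hα2 x hx, hS2' x hxS h2.1]
          · rw [← hα2 x hx, hcl]
        · exact ⟨x, fun h => hxS h.1, rfl⟩
    · exact ⟨x, h3 x hx, by rw [← hαr ⟨x, hx⟩, hcl]⟩
  · intro φ ψ hφ hψ hF
    refine ⟨Quotient.lift (Sum.elim φ fun x => ψ x.1) ?_, fun x => ⟨rfl, ?_⟩⟩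
    · intro a b hab
      refine Equiv.Perm.SameCycle.apply_eq_of_invariant (π := M.twoColoredMap.σ) ?_ hab
      rintro (x | x)
      · rw [hσl]
        exact hφ x
      · obtain ⟨y, rfl⟩ : ∃ y : {x // OnThreeCycle M.α x},
            x = ⟨M.α y.1, (onThreeCycle_apply_iff _ _).2 y.2⟩ :=
          ⟨⟨M.α.symm x.1, (onThreeCycle_symm_apply_iff _ _).2 x.2⟩, Subtype.ext (by simp)⟩
        rw [hσr]
        exact (hψ _).symm
    · by_cases hx : OnThreeCycle M.α x
      · rw [dif_pos hx]
        rfl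
      · rw [dif_neg hx]
        by_cases hxS : x ∈ S
        · rw [if_pos hxS]
          exact hF x ⟨hxS, hx⟩
        · rw [if_neg hxS]
          exact (hF _ ⟨hS2 x hx hxS, mt (onThreeCycle_apply_iff M.α x).1 hx⟩).trans (hψ x)
  · intro g
    refine ⟨fun x => g (if x ∈ S then x else if M.α x ∈ S then M.α x else M.α (M.α x)),
      fun x => ?_, fun x hx => ?_⟩
    · have := h.short x
      have := h.exists_mem x
      have := h.apply_eq x
      have := h.apply_apply_eq x
      have := h.apply_eq (M.α x)
      grind
    · exact congrArg g (if_pos hx.1)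

end IsShortTransversal


/-! ### The ladder -/

section ladder

variable {m : ℕ} {Y : Type*}

@[simp] theorem ladderMap_α_rung (i : Fin (m + 1)) (t : Bool) :
    (ladderMap m).α (.rung i, t) = (.rung i, !t) := rfl

@[simp] theorem ladderMap_α_right (i : Fin m) (t : Bool) :
    (ladderMap m).α (.right i, t) = (.left i, t) := rfl

@[simp] theorem ladderMap_α_left (i : Fin m) (t : Bool) :
    (ladderMap m).α (.left i, t) = (.right i, t) := rfl

theorem ladderMap_σ_true (d : RailDart m) :
    (ladderMap m).σ (d, true) = (upperRotation m d, true) := rfl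

theorem ladderMap_σ_false (d : RailDart m) :
    (ladderMap m).σ (d, false) = ((upperRotation m).symm d, false) := rfl

theorem upperRotation_rung (i : Fin (m + 1)) : upperRotation m (.rung i) =
    if h : i.val < m then .right ⟨i.val, h⟩
      else if h' : 0 < i.val then .left ⟨i.val - 1, by omega⟩ else .rung i := rfl

theorem upperRotation_right (i : Fin m) : upperRotation m (.right i) =
    if h : 0 < i.val then .left ⟨i.val - 1, by omega⟩ else .rung i.castSucc := rfl

theorem upperRotation_left (i : Fin m) : upperRotation m (.left i) = .rung i.succ := rfl

theorem upperRotation_symm_rung (i : Fin (m + 1)) : (upperRotation m).symm (.rung i) =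
    if h : 0 < i.val then .left ⟨i.val - 1, by omega⟩
      else if h' : i.val < m then .right ⟨i.val, h'⟩ else .rung i := rfl

theorem upperRotation_symm_right (i : Fin m) :
    (upperRotation m).symm (.right i) = .rung i.castSucc := rfl

theorem upperRotation_symm_left (i : Fin m) : (upperRotation m).symm (.left i) =
    if h : i.val + 1 < m then .right ⟨i.val + 1, h⟩ else .rung i.succ := rfl

/-- The functions on the darts of the ladder that only depend on the edge. -/
theorem ladderMap_forall_α_iff (φ : RailDart m × Bool → Y) :
    (∀ x, φ ((ladderMap m).α x) = φ x) ↔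
      (∀ i, φ (.rung i, false) = φ (.rung i, true)) ∧ ∀ i t, φ (.left i, t) = φ (.right i, t) := by
  constructor
  · exact fun h => ⟨fun i => h (.rung i, true), fun i t => h (.right i, t)⟩
  · rintro ⟨h1, h2⟩ ⟨i | i | i, t⟩
    · cases t <;> simp [h1]
    · simp [h2]
    · simp [h2]

/-- The functions on the darts of the ladder that only depend on the vertex. -/
theorem ladderMap_forall_σ_iff (ψ : RailDart m × Bool → Y) :
    (∀ x, ψ ((ladderMap m).σ x) = ψ x) ↔
      (∀ i t, ψ (.right i, t) = ψ (.rung i.castSucc, t)) ∧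
        ∀ i t, ψ (.left i, t) = ψ (.rung i.succ, t) := by
  constructor
  · intro h
    have hl : ∀ i, ψ (.left i, true) = ψ (.rung i.succ, true) := fun i =>
      (h (.left i, true)).symm
    have hr : ∀ i, ψ (.right i, false) = ψ (.rung i.castSucc, false) := fun i =>
      (h (.right i, false)).symm
    constructor
    · rintro i (_ | _)
      · exact hr i
      · have := h (.right i, true)
        rw [ladderMap_σ_true, upperRotation_right] at this
        split_ifs at this with h1
        · rw [← this, hl]
          congr 3
          ext
          simp
          omega
        · exact this.symm
    · rintro i (_ | _)
      · have := h (.left i, false)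
        rw [ladderMap_σ_false, upperRotation_symm_left] at this
        split_ifs at this with h1
        · rw [← this, hr]
          rfl
        · exact this.symm
      · exact hl i
  · rintro ⟨h1, h2⟩ ⟨d, t⟩
    cases t
    · rw [ladderMap_σ_false]
      rcases d with i | i | i
      · rw [upperRotation_symm_rung]
        split_ifs with h h'
        · rw [h2]
          congr 3
          ext
          simp
          omega
        · rw [h1]
          rfl
        · rfl
      · rw [upperRotation_symm_right, h1]
      · rw [upperRotation_symm_left]
        split_ifs with h
        · rw [h1, h2]
          rfl
        · rw [h2]
    · rw [ladderMap_σ_true]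
      rcases d with i | i | i
      · rw [upperRotation_rung]
        split_ifs with h h'
        · rw [h1]
          rfl
        · rw [h2]
          congr 3
          ext
          simp
          omega
        · rfl
      · rw [upperRotation_right]
        split_ifs with h
        · rw [h1, h2]
          congr 3
          ext
          simp
          omega
        · rw [h1]
      · rw [upperRotation_left, h2]

instance RailDart.instFinite : Finite (RailDart m) :=
  Finite.of_injective
    (fun d => match d with
      | .rung i => Sum.inl i
      | .right i => Sum.inr (Sum.inl i)
      | .left i => Sum.inr (Sum.inr i) : RailDart m → Fin (m + 1) ⊕ Fin m ⊕ Fin m)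
    (by rintro (i | i | i) (j | j | j) h <;> simp_all)

instance RailDart.instNonempty : Nonempty (RailDart m) := ⟨.rung 0⟩

end ladder

/-! ### Chains of octagons and hexagons -/

/-- The height of the lower and of the upper rail in a chain of polygons. -/
def railHeight (t : Bool) : Fin 3 := if t then 2 else 0

/-- The position of the midpoint of an edge of the ladder in the chain of polygons that starts at
the abscissa `a ≤ 1`. -/
def edgePosition (a : ℕ) {m : ℕ} : RailDart m × Bool → ℕ × Fin 3
  | (.rung i, _) => (max a (2 * i), 1)
  | (.right i, t) => (2 * i + 1, railHeight t)
  | (.left i, t) => (2 * i + 1, railHeight t)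

/-- The position of a vertex of the ladder in the chain of polygons that starts at the abscissa
`a ≤ 1`. -/
def vertexPosition (a : ℕ) {m : ℕ} : RailDart m × Bool → ℕ × Fin 3
  | (.rung i, t) => (max a (2 * i), railHeight t)
  | (.right i, t) => (max a (2 * i), railHeight t)
  | (.left i, t) => (2 * i + 2, railHeight t)

/-- The first darts of the two rails, if `a = 1`. -/
def firstRailDarts (a m : ℕ) : Set (RailDart m × Bool) :=
  {x | a = 1 ∧ ∃ i : Fin m, i.val = 0 ∧ x.1 = .right i}

theorem railHeight_ne_one (t : Bool) : railHeight t ≠ 1 := by cases t <;> decide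

theorem exists_railHeight_eq {h : Fin 3} (hh : h ≠ 1) : ∃ t, railHeight t = h := by
  revert h
  decide

theorem railHeight_injective : Function.Injective railHeight := by decide

section polygonChain

variable {a m : ℕ}

theorem edgePosition_mem (ha : a ≤ 1) (hm : 1 ≤ m) (x : RailDart m × Bool) : a ≤ (edgePosition a x).1 ∧
    (edgePosition a x).1 ≤ 2 * m ∧ ((edgePosition a x).2 = 1 →
      (edgePosition a x).1 ∈ {x | x = a ∨ Even x}) := by
  rcases x with ⟨⟨i, hi⟩ | ⟨i, hi⟩ | ⟨i, hi⟩, t⟩ <;>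
    refine ⟨?_, ?_, fun h => ?_⟩ <;>
    simp only [edgePosition, Set.mem_ofPred_eq, Nat.even_iff, railHeight_ne_one] at * <;> omega

theorem vertexPosition_mem (ha : a ≤ 1) (hm : 1 ≤ m) (x : RailDart m × Bool) : a ≤ (vertexPosition a x).1 ∧
    (vertexPosition a x).1 ≤ 2 * m ∧ ((vertexPosition a x).2 = 1 →
      (vertexPosition a x).1 ∈ {x | x = a ∨ Even x}) := by
  rcases x with ⟨⟨i, hi⟩ | ⟨i, hi⟩ | ⟨i, hi⟩, t⟩ <;>
    refine ⟨?_, ?_, fun h => ?_⟩ <;>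
    simp only [vertexPosition, railHeight_ne_one] at * <;> omega

/-- Each unit segment is one dart. On a rail the parity of its left end decides whether the dart
leaves its vertex to the right or to the left. -/
theorem exists_dart_of_polygonChain_step (ha : a ≤ 1) (p q : ℕ × Fin 3) (hp : a ≤ p.1 ∧ p.1 ≤ 2 * m ∧
    (p.2 = 1 → p.1 ∈ {x | x = a ∨ Even x})) (hq : a ≤ q.1 ∧ q.1 ≤ 2 * m ∧
    (q.2 = 1 → q.1 ∈ {x | x = a ∨ Even x}))
    (h : (p.1 = q.1 ∧ p.2.val + 1 = q.2.val) ∨ (p.2 = q.2 ∧ p.2 ≠ 1 ∧ p.1 + 1 = q.1)) :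
    ∃ x : RailDart m × Bool, x ∉ firstRailDarts a m ∧
      ((edgePosition a x = p ∧ vertexPosition a x = q) ∨
        (edgePosition a x = q ∧ vertexPosition a x = p)) := by
  obtain ⟨c, k⟩ := p
  obtain ⟨d, l⟩ := q
  simp only [Set.mem_ofPred_eq, Nat.even_iff] at hp hq h
  rcases h with ⟨rfl, h⟩ | ⟨rfl, h, rfl⟩
  · have hrung : ∀ t, ((.rung ⟨c / 2, by omega⟩, t) : RailDart m × Bool) ∉ firstRailDarts a m := by
      rintro t ⟨-, i, -, hi⟩
      cases hi
    fin_cases k <;> fin_cases l <;> simp at h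
    · refine ⟨_, hrung false, Or.inr ?_⟩
      have := hq.2.2 rfl
      constructor <;> refine Prod.ext ?_ rfl <;> simp only [edgePosition, vertexPosition] <;> omega
    · refine ⟨_, hrung true, Or.inl ?_⟩
      have := hp.2.2 rfl
      constructor <;> refine Prod.ext ?_ rfl <;> simp only [edgePosition, vertexPosition] <;> omega
  · obtain ⟨t, rfl⟩ := exists_railHeight_eq h
    rcases Nat.mod_two_eq_zero_or_one c with h2 | h2
    · refine ⟨(.right ⟨c / 2, by omega⟩, t), ?_, Or.inr ?_⟩
      · rintro ⟨rfl, i, hi, hi'⟩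
        cases hi'
        simp only at hi
        omega
      · constructor <;> refine Prod.ext ?_ rfl <;> simp only [edgePosition, vertexPosition] <;>
          omega
    · refine ⟨(.left ⟨c / 2, by omega⟩, t), ?_, Or.inl ?_⟩
      · rintro ⟨-, i, -, hi'⟩
        cases hi'
      · constructor <;> refine Prod.ext ?_ rfl <;> simp only [edgePosition, vertexPosition] <;>
          omega

theorem edgePosition_vertexPosition_injOn (ha : a ≤ 1) {x y : RailDart m × Bool} (hx : x ∉ firstRailDarts a m)
    (hy : y ∉ firstRailDarts a m)
    (h : (edgePosition a x = edgePosition a y ∧ vertexPosition a x = vertexPosition a y) ∨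
      (edgePosition a x = vertexPosition a y ∧ vertexPosition a x = edgePosition a y)) :
    x = y := by
  have h1 := railHeight_ne_one
  have h1' := fun t => (railHeight_ne_one t).symm
  have h0 : ∀ (i : Fin m) t, ((.right i, t) : RailDart m × Bool) ∉ firstRailDarts a m →
      a = 0 ∨ 0 < i.val := by
    intro i t h
    by_contra h'
    exact h ⟨by omega, i, by omega, rfl⟩
  rcases x with ⟨⟨i, hi⟩ | ⟨i, hi⟩ | ⟨i, hi⟩, t⟩ <;>
    rcases y with ⟨⟨j, hj⟩ | ⟨j, hj⟩ | ⟨j, hj⟩, s⟩ <;>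
    simp only [edgePosition, vertexPosition, Prod.mk.injEq, railHeight_injective.eq_iff, h1, h1',
      RailDart.rung.injEq, RailDart.right.injEq, RailDart.left.injEq, Fin.mk.injEq, and_false,
      false_and, or_false, reduceCtorEq, and_true] at h ⊢ <;>
    (try replace hx := h0 _ _ hx) <;> (try replace hy := h0 _ _ hy) <;> (try simp only at hx hy) <;>
    first | omega | exact ⟨by omega, by tauto⟩

/-- The darts in `firstRailDarts` have to be left out: for `a = 1` their two positions coincide.
This is the contraction that turns the first octagon into a hexagon. -/
theorem isLink_polygonChain (ha : a ≤ 1) (hm : 1 ≤ m) {x : RailDart m × Bool}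
    (hx : x ∉ firstRailDarts a m) :
    (polygonChain a (2 * m) {x | x = a ∨ Even x}).Adj
      ⟨edgePosition a x, edgePosition_mem ha hm x⟩
      ⟨vertexPosition a x, vertexPosition_mem ha hm x⟩ := by
  rcases x with ⟨⟨i, hi⟩ | ⟨i, hi⟩ | ⟨i, hi⟩, t⟩
  · refine Or.inl ⟨rfl, ?_⟩
    cases t
    · exact Or.inr rfl
    · exact Or.inl rfl
  · refine Or.inr ⟨rfl, railHeight_ne_one t, Or.inr ?_⟩
    have : a = 0 ∨ 0 < i := by
      by_contra h
      exact hx ⟨by omega, ⟨i, hi⟩, by simp; omega, rfl⟩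
    simp only [edgePosition, vertexPosition]
    omega
  · exact Or.inr ⟨rfl, railHeight_ne_one t, Or.inl rfl⟩

theorem exists_potential_polygonChain (ha : a ≤ 1) (hm : 1 ≤ m) (φ ψ : RailDart m × Bool → ℚ)
    (hφ : ∀ x, φ ((ladderMap m).α x) = φ x) (hψ : ∀ x, ψ ((ladderMap m).σ x) = ψ x)
    (h : ∀ x ∈ firstRailDarts a m, φ x = ψ x) :
    ∃ χ : ℕ × Fin 3 → ℚ, ∀ x, χ (edgePosition a x) = φ x ∧ χ (vertexPosition a x) = ψ x := by
  obtain ⟨hφ1, hφ2⟩ := (ladderMap_forall_α_iff φ).1 hφ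
  obtain ⟨hψ1, hψ2⟩ := (ladderMap_forall_σ_iff ψ).1 hψ
  let rung (f : RailDart m × Bool → ℚ) (i : ℕ) (t : Bool) : ℚ :=
    if h : i < m + 1 then f (.rung ⟨i, h⟩, t) else 0
  let right (f : RailDart m × Bool → ℚ) (i : ℕ) (t : Bool) : ℚ :=
    if h : i < m then f (.right ⟨i, h⟩, t) else 0
  have hrung : ∀ f (i : Fin (m + 1)) t, rung f i t = f (.rung i, t) := fun f i t => dif_pos i.2
  have hright : ∀ f (i : Fin m) t, right f i t = f (.right i, t) := fun f i t => dif_pos i.2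
  let χ : ℕ × Fin 3 → ℚ := fun p => if p.2 = 1 then rung φ (p.1 / 2) true
    else if Even p.1 then rung ψ (p.1 / 2) (decide (p.2 = 2))
    else right φ (p.1 / 2) (decide (p.2 = 2))
  have ht : ∀ t, decide (railHeight t = 2) = t := by decide
  have hχ1 : ∀ c, χ (c, 1) = rung φ (c / 2) true := fun c => if_pos rfl
  have hχ2 : ∀ c t, Even c → χ (c, railHeight t) = rung ψ (c / 2) t := fun c t hc => by
    simp only [χ, railHeight_ne_one, hc, if_false, if_true, ht]
  have hχ3 : ∀ c t, ¬ Even c → χ (c, railHeight t) = right φ (c / 2) t := fun c t hc => by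
    simp only [χ, railHeight_ne_one, hc, if_false, ht]
  have hodd : ∀ i t, χ (2 * i + 1, railHeight t) = right φ i t := fun i t => by
    rw [hχ3 _ _ (by simp), show (2 * i + 1) / 2 = i by omega]
  have hw : ∀ (i : Fin (m + 1)) t, χ (max a (2 * i), railHeight t) = ψ (.rung i, t) := by
    intro i t
    -- Only here does a vertex of the ladder sit at an odd abscissa, where `χ` takes the value of
    -- the rail edge; the hypothesis `h` reconciles the two values.
    by_cases hi : a = 1 ∧ i.val = 0
    · obtain ⟨rfl, hi⟩ := hi
      have := hodd 0 t
      rw [hi, show max 1 (2 * 0) = 2 * 0 + 1 by omega, this, hright φ ⟨0, hm⟩,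
        h (.right ⟨0, hm⟩, t) ⟨rfl, _, rfl, rfl⟩, hψ1]
      congr 3
      exact Fin.ext hi.symm
    · rw [show max a (2 * i.val) = 2 * i by omega, hχ2 _ _ (by simp),
        show (2 * i.val) / 2 = i by omega, hrung]
  refine ⟨χ, ?_⟩
  rintro ⟨i | i | i, t⟩
  · refine ⟨?_, hw i t⟩
    rw [edgePosition, hχ1, show (max a (2 * i.val)) / 2 = i by omega, hrung]
    cases t
    · exact (hφ1 i).symm
    · rfl
  · refine ⟨?_, ?_⟩
    · rw [edgePosition, hodd, hright]
    · rw [vertexPosition, hψ1]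
      exact hw i.castSucc t
  · refine ⟨?_, ?_⟩
    · rw [edgePosition, hodd, hright, hφ2]
    · rw [vertexPosition, hψ2, ← hw, Fin.val_succ,
        show max a (2 * (i.val + 1)) = 2 * i.val + 2 by omega]

/-- The spanning trees of a chain of octagons, or of a hexagon and octagons, correspond to spanning
trees of the incidence graph of the vertices and edges of the ladder. -/
theorem numSpanningTrees_polygonChain (ha : a ≤ 1) (hm : 1 ≤ m) :
    (Graph.ofSimpleGraph (polygonChain a (2 * m) {x | x = a ∨ Even x})).numSpanningTrees =
      Set.ncard {A : Set (RailDart m × Bool) | firstRailDarts a m ⊆ A ∧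
        IsIncidenceTree (ladderMap m).α (ladderMap m).σ A} := by
  have hfin : Finite {p : ℕ × Fin 3 // a ≤ p.1 ∧ p.1 ≤ 2 * m ∧
      (p.2 = 1 → p.1 ∈ {x | x = a ∨ Even x})} :=
    Finite.of_injective (fun p => ((⟨p.1.1, by omega⟩ : Fin (2 * m + 1)), p.1.2)) (by
      rintro ⟨⟨_, _⟩, _⟩ ⟨⟨_, _⟩, _⟩ h
      simpa using h)
  have hne : Nonempty {p : ℕ × Fin 3 // a ≤ p.1 ∧ p.1 ≤ 2 * m ∧
      (p.2 = 1 → p.1 ∈ {x | x = a ∨ Even x})} :=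
    ⟨⟨_, edgePosition_mem ha hm (.rung 0, true)⟩⟩
  refine Graph.numSpanningTrees_eq_ncard_isIncidenceTree _ _ _ _ rfl
    (fun x => ⟨edgePosition a x, edgePosition_mem ha hm x⟩)
    (fun x => ⟨vertexPosition a x, vertexPosition_mem ha hm x⟩)
    (fun x => s(⟨edgePosition a x, edgePosition_mem ha hm x⟩,
      ⟨vertexPosition a x, vertexPosition_mem ha hm x⟩)) ?_ ?_ ?_ ?_ ?_ ?_ ?_ ?_ ?_
  · rintro ⟨i | i | i, t⟩ <;> rfl
  · refine (ladderMap_forall_σ_iff fun x => (⟨vertexPosition a x, vertexPosition_mem ha hm x⟩ :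
      {p : ℕ × Fin 3 // a ≤ p.1 ∧ p.1 ≤ 2 * m ∧ (p.2 = 1 → p.1 ∈ {x | x = a ∨ Even x})})).2
      ⟨fun i t => rfl, fun i t => Subtype.ext ?_⟩
    refine Prod.ext ?_ rfl
    simp only [vertexPosition, Fin.val_succ]
    omega
  · rintro ⟨⟨c, k⟩, hp⟩
    by_cases hk : k = 1
    · refine Or.inl ⟨(.rung ⟨c / 2, by simp only at hp; omega⟩, true), Subtype.ext ?_⟩
      have := hp.2.2 hk
      simp only [Set.mem_ofPred_eq, Nat.even_iff] at this
      refine Prod.ext ?_ hk.symm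
      simp only [edgePosition]
      omega
    · obtain ⟨t, rfl⟩ := exists_railHeight_eq hk
      simp only at hp
      rcases Nat.mod_two_eq_zero_or_one c with h2 | h2
      · refine Or.inr ⟨(.rung ⟨c / 2, by omega⟩, t), Subtype.ext (Prod.ext ?_ rfl)⟩
        simp only [vertexPosition]
        omega
      · refine Or.inl ⟨(.right ⟨c / 2, by omega⟩, t), Subtype.ext (Prod.ext ?_ rfl)⟩
        simp only [edgePosition]
        omega
  · rintro ⟨d, t⟩ ⟨rfl, i, hi, hd⟩
    simp only at hd
    subst hd
    refine Subtype.ext (Prod.ext ?_ rfl)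
    simp only [edgePosition, vertexPosition]
    omega
  · intro x hx
    exact ⟨rfl, isLink_polygonChain ha hm hx⟩
  · intro x hx y hy hxy
    simp only [Sym2.eq_iff, Subtype.mk.injEq] at hxy
    exact edgePosition_vertexPosition_injOn ha hx hy hxy
  · intro e he
    induction e with | h p q =>
    have hstep : ∀ p q : {p : ℕ × Fin 3 // a ≤ p.1 ∧ p.1 ≤ 2 * m ∧
        (p.2 = 1 → p.1 ∈ {x | x = a ∨ Even x})},
        ((p.1.1 = q.1.1 ∧ p.1.2.val + 1 = q.1.2.val) ∨
          (p.1.2 = q.1.2 ∧ p.1.2 ≠ 1 ∧ p.1.1 + 1 = q.1.1)) →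
        ∃ x : RailDart m × Bool, x ∉ firstRailDarts a m ∧
          s((⟨edgePosition a x, edgePosition_mem ha hm x⟩ : {p : ℕ × Fin 3 // a ≤ p.1 ∧
            p.1 ≤ 2 * m ∧ (p.2 = 1 → p.1 ∈ {x | x = a ∨ Even x})}),
            ⟨vertexPosition a x, vertexPosition_mem ha hm x⟩) = s(p, q) := by
      intro p q hpq
      obtain ⟨x, hx, h⟩ := exists_dart_of_polygonChain_step ha p.1 q.1 p.2 q.2 hpq
      refine ⟨x, hx, ?_⟩
      rw [Sym2.eq_iff, Subtype.ext_iff, Subtype.ext_iff, Subtype.ext_iff, Subtype.ext_iff]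
      exact h
    have hadj : (polygonChain a (2 * m) {x | x = a ∨ Even x}).Adj p q := he
    rcases hadj with ⟨h1, h2 | h2⟩ | ⟨h1, h2, h3 | h3⟩
    · exact hstep p q (Or.inl ⟨h1, h2⟩)
    · rw [Sym2.eq_swap]
      exact hstep q p (Or.inl ⟨h1.symm, h2⟩)
    · exact hstep p q (Or.inr ⟨h1, h2, h3⟩)
    · rw [Sym2.eq_swap]
      exact hstep q p (Or.inr ⟨h1.symm, h1 ▸ h2, h3⟩)
  · intro φ ψ hφ hψ h
    obtain ⟨χ, hχ⟩ := exists_potential_polygonChain ha hm φ ψ hφ hψ h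
    exact ⟨fun p => χ p.1, hχ⟩
  · intro g
    let ψ : RailDart m × Bool → ℚ := fun x => match x with
      | (.rung i, t) => if i.val = 0 then g (.right ⟨0, hm⟩, t) else 0
      | (.right i, t) => if i.val = 0 then g (.right ⟨0, hm⟩, t) else 0
      | (.left _, _) => 0
    refine ⟨ψ, (ladderMap_forall_σ_iff ψ).2 ⟨fun i t => rfl, fun i t => by simp [ψ]⟩, ?_⟩
    rintro ⟨d, t⟩ ⟨-, ⟨i, hi'⟩, hi, hd⟩
    simp only at hd hi
    subst hd hi
    rfl

end polygonChain


/-! ### The vertices of the ladder -/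

section vertices

variable {n : ℕ}

theorem ladderMap_σ_right_zero (t : Bool) :
    (ladderMap (n + 1)).σ (.right 0, t) = (.rung 0, t) := by
  cases t
  · rfl
  · rw [ladderMap_σ_true, upperRotation_right]
    simp

theorem ladderMap_σ_rung_zero (t : Bool) :
    (ladderMap (n + 1)).σ (.rung 0, t) = (.right 0, t) := by
  cases t
  · rw [ladderMap_σ_false, upperRotation_symm_rung]
    simp
  · rw [ladderMap_σ_true, upperRotation_rung]
    simp

theorem ladderMap_σ_left_last (t : Bool) :
    (ladderMap (n + 1)).σ (.left (Fin.last n), t) = (.rung (Fin.last (n + 1)), t) := by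
  cases t
  · rw [ladderMap_σ_false, upperRotation_symm_left]
    simp
  · rfl

theorem ladderMap_σ_rung_last (t : Bool) :
    (ladderMap (n + 1)).σ (.rung (Fin.last (n + 1)), t) = (.left (Fin.last n), t) := by
  cases t
  · rw [ladderMap_σ_false, upperRotation_symm_rung]
    simp [Fin.last]
  · rw [ladderMap_σ_true, upperRotation_rung]
    simp [Fin.last]

theorem ladderMap_σ_rung_true (i : Fin n) : (ladderMap (n + 1)).σ (.rung i.castSucc.succ, true) =
    (.right i.succ, true) := by
  rw [ladderMap_σ_true, upperRotation_rung]
  simp [Fin.ext_iff]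

theorem ladderMap_σ_right_true (i : Fin n) : (ladderMap (n + 1)).σ (.right i.succ, true) =
    (.left i.castSucc, true) := by
  rw [ladderMap_σ_true, upperRotation_right]
  simp [Fin.ext_iff]

theorem ladderMap_σ_left_true (i : Fin n) : (ladderMap (n + 1)).σ (.left i.castSucc, true) =
    (.rung i.castSucc.succ, true) := rfl

theorem ladderMap_σ_rung_false (i : Fin n) : (ladderMap (n + 1)).σ (.rung i.castSucc.succ, false) =
    (.left i.castSucc, false) := by
  rw [ladderMap_σ_false, upperRotation_symm_rung]
  simp [Fin.ext_iff]

theorem ladderMap_σ_left_false (i : Fin n) : (ladderMap (n + 1)).σ (.left i.castSucc, false) =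
    (.right i.succ, false) := by
  rw [ladderMap_σ_false, upperRotation_symm_left]
  simp [Fin.ext_iff]

theorem ladderMap_σ_right_false (i : Fin n) : (ladderMap (n + 1)).σ (.right i.succ, false) =
    (.rung i.castSucc.succ, false) := rfl

/-- Case distinction according to the kind of vertex to which a dart belongs. -/
theorem RailDart.forall_iff {P : RailDart (n + 1) → Prop} : (∀ d, P d) ↔
    (P (.rung 0) ∧ P (.right 0)) ∧
      (∀ i : Fin n, P (.left i.castSucc) ∧ P (.rung i.castSucc.succ) ∧ P (.right i.succ)) ∧
      P (.left (Fin.last n)) ∧ P (.rung (Fin.last (n + 1))) := by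
  constructor
  · exact fun h => ⟨⟨h _, h _⟩, fun i => ⟨h _, h _, h _⟩, h _, h _⟩
  · rintro ⟨⟨h1, h2⟩, h3, h4, h5⟩ (i | i | i)
    · induction i using Fin.cases with
      | zero => exact h1
      | succ i =>
        induction i using Fin.lastCases with
        | last => exact h5
        | cast i => exact (h3 i).2.1
    · induction i using Fin.cases with
      | zero => exact h2
      | succ i => exact (h3 i).2.2
    · induction i using Fin.lastCases with
      | last => exact h4
      | cast i => exact (h3 i).1

/-- One dart at each vertex of the ladder: the dart on a rail at the corners, the dart on a rung at
the other vertices. -/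
def chosenDarts (m : ℕ) : Set (RailDart m × Bool) :=
  {x | match x.1 with
    | .rung i => 0 < i.val ∧ i.val < m
    | .right i => i.val = 0
    | .left i => i.val + 1 = m}

theorem rung_mem_chosenDarts {m : ℕ} (i : Fin (m + 1)) (t : Bool) :
    (.rung i, t) ∈ chosenDarts m ↔ 0 < i.val ∧ i.val < m := Iff.rfl

theorem right_mem_chosenDarts {m : ℕ} (i : Fin m) (t : Bool) :
    (.right i, t) ∈ chosenDarts m ↔ i.val = 0 := Iff.rfl

theorem left_mem_chosenDarts {m : ℕ} (i : Fin m) (t : Bool) :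
    (.left i, t) ∈ chosenDarts m ↔ i.val + 1 = m := Iff.rfl

theorem forall_dart_iff {P : RailDart (n + 1) × Bool → Prop} : (∀ x, P x) ↔
    (∀ t, P (.rung 0, t) ∧ P (.right 0, t)) ∧
      (∀ (i : Fin n) t, P (.left i.castSucc, t) ∧ P (.rung i.castSucc.succ, t) ∧
        P (.right i.succ, t)) ∧
      ∀ t, P (.left (Fin.last n), t) ∧ P (.rung (Fin.last (n + 1)), t) := by
  rw [Prod.forall, RailDart.forall_iff]
  simp only [forall_and]

/-- At least one face is needed: for `m = 0` the set `chosenDarts` is empty. -/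
theorem isShortTransversal_chosenDarts :
    IsShortTransversal (ladderMap (n + 1)).σ (chosenDarts (n + 1)) := by
  constructor <;> rw [forall_dart_iff] <;> refine ⟨fun t => ?_, fun i t => ?_, fun t => ?_⟩ <;>
    (try cases t) <;>
    simp [ladderMap_σ_right_zero, ladderMap_σ_rung_zero, ladderMap_σ_left_last,
      ladderMap_σ_rung_last, ladderMap_σ_rung_true, ladderMap_σ_right_true, ladderMap_σ_left_true,
      ladderMap_σ_rung_false, ladderMap_σ_right_false, ladderMap_σ_left_false,
      rung_mem_chosenDarts, right_mem_chosenDarts, left_mem_chosenDarts] <;> omega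

/-- This is the local condition for `T`. At a corner, of degree two, it forces the rail dart; at an
inner vertex it lets a leaf hang only on the rung. -/
theorem leavesIn_chosenDarts_iff (A : Set (RailDart (n + 1) × Bool)) :
    LeavesIn (ladderMap (n + 1)).σ (chosenDarts (n + 1)) A ↔
      (∀ t, (.right 0, t) ∈ A) ∧
      (∀ (i : Fin n) t, (.rung i.castSucc.succ, t) ∈ A ∨
        ((.left i.castSucc, t) ∈ A ∧ (.right i.succ, t) ∈ A)) ∧
      ∀ t, (.left (Fin.last n), t) ∈ A := by
  rw [LeavesIn, forall_dart_iff]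
  refine and_congr ?_ (and_congr ?_ ?_)
  · simp [ladderMap_σ_right_zero, ladderMap_σ_rung_zero, rung_mem_chosenDarts,
      right_mem_chosenDarts]
    tauto
  · refine forall_congr' fun i => forall_congr' fun t => ?_
    have h1 : ¬ i.val = n := by omega
    have h2 : i.val < n := by omega
    cases t <;> simp [ladderMap_σ_rung_true, ladderMap_σ_right_true, ladderMap_σ_rung_false,
      ladderMap_σ_left_false, rung_mem_chosenDarts, right_mem_chosenDarts, left_mem_chosenDarts,
      h1, h2, and_comm]
  · simp [ladderMap_σ_left_last, ladderMap_σ_rung_last, rung_mem_chosenDarts,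
      left_mem_chosenDarts]
    tauto

/-- This is the local condition for `H`. Inner vertices impose nothing, being 3-cycles, so the
middle clause for `T` is the whole difference between the two counts. -/
theorem chosenDarts_subset_iff (A : Set (RailDart (n + 1) × Bool)) :
    {x ∈ chosenDarts (n + 1) | ¬ OnThreeCycle (ladderMap (n + 1)).σ x} ⊆ A ↔
      (∀ t, (.right 0, t) ∈ A) ∧ ∀ t, (.left (Fin.last n), t) ∈ A := by
  have h : {x ∈ chosenDarts (n + 1) | ¬ OnThreeCycle (ladderMap (n + 1)).σ x} ⊆ A ↔
    ∀ x, x ∈ chosenDarts (n + 1) ∧ ¬ OnThreeCycle (ladderMap (n + 1)).σ x → x ∈ A := Iff.rfl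
  rw [h, forall_dart_iff]
  have h2 : (∀ (i : Fin n) (t : Bool),
      ((.left i.castSucc, t) ∈ chosenDarts (n + 1) ∧
        ¬ OnThreeCycle (ladderMap (n + 1)).σ (.left i.castSucc, t) → (.left i.castSucc, t) ∈ A) ∧
      ((.rung i.castSucc.succ, t) ∈ chosenDarts (n + 1) ∧
        ¬ OnThreeCycle (ladderMap (n + 1)).σ (.rung i.castSucc.succ, t) →
          (.rung i.castSucc.succ, t) ∈ A) ∧
      ((.right i.succ, t) ∈ chosenDarts (n + 1) ∧
        ¬ OnThreeCycle (ladderMap (n + 1)).σ (.right i.succ, t) → (.right i.succ, t) ∈ A)) := by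
    intro i t
    have h1 : ¬ i.val = n := by omega
    cases t <;> simp [OnThreeCycle, ladderMap_σ_rung_true, ladderMap_σ_right_true,
      ladderMap_σ_rung_false, ladderMap_σ_left_false, ladderMap_σ_left_true,
      ladderMap_σ_right_false, right_mem_chosenDarts, left_mem_chosenDarts, h1]
  rw [and_iff_right h2]
  refine and_congr ?_ ?_
  · simp [OnThreeCycle, ladderMap_σ_right_zero, ladderMap_σ_rung_zero, rung_mem_chosenDarts,
      right_mem_chosenDarts]
  · simp [OnThreeCycle, ladderMap_σ_left_last, ladderMap_σ_rung_last, rung_mem_chosenDarts,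
      left_mem_chosenDarts]

end vertices


/-! ### Spanning trees of a ladder as accepted words -/

/-- The entry of a pair of booleans on the upper (`true`) or lower (`false`) rail. -/
def onRail (c : Bool × Bool) (t : Bool) : Bool := cond t c.1 c.2

/-- The steps in which a ladder is built from left to right, together with the choice of the edges
that belong to a subgraph: an edge on each rail, or a rung that is subdivided into two edges. -/
inductive LadderStep : Type
  | rails (c : Bool × Bool)
  | rung (c : Bool × Bool)

namespace LadderStep

/-- The potentials `y` (on the rails) and `r` (on the midpoints of the rungs) have the differences
`g` along the chosen edges. -/
def Sat : List LadderStep → (ℕ → Bool → ℚ) → (ℕ → Bool → ℚ) → (ℕ → ℚ) → Prop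
  | [], _, _, _ => True
  | rails c :: w, g, y, r => (∀ t, onRail c t → y 1 t - y 0 t = g 0 t) ∧
      Sat w (fun k => g (k + 1)) (fun k => y (k + 1)) fun k => r (k + 1)
  | rung c :: w, g, y, r => (∀ t, y 1 t = y 0 t) ∧ (∀ t, onRail c t → r 0 - y 0 t = g 0 t) ∧
      Sat w (fun k => g (k + 1)) (fun k => y (k + 1)) fun k => r (k + 1)

/-- The potentials are equal to `c` on all vertices. -/
def AllEq : List LadderStep → ℚ → (ℕ → Bool → ℚ) → (ℕ → ℚ) → Prop
  | [], c, y, _ => ∀ t, y 0 t = c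
  | rails _ :: w, c, y, r => (∀ t, y 0 t = c) ∧
      AllEq w c (fun k => y (k + 1)) fun k => r (k + 1)
  | rung _ :: w, c, y, r => (∀ t, y 0 t = c) ∧ r 0 = c ∧
      AllEq w c (fun k => y (k + 1)) fun k => r (k + 1)

/-- The chosen edges form a spanning tree of the ladder, whose first two vertices are joined by an
additional edge if `s` is true. -/
def IsTree (w : List LadderStep) (s : Bool) : Prop :=
  (∀ g c, ∃ y r, Sat w g y r ∧ (s = true → y 0 true - y 0 false = c)) ∧
  ∀ y r, Sat w (fun _ _ => 0) y r → (s = true → y 0 true = y 0 false) → AllEq w (y 0 true) y r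

/-- The effect of a step on whether the two ends of the rails are connected; no value if the
subgraph cannot be completed to a spanning tree. -/
def step : LadderStep → Bool → Option Bool
  | rails (true, true), s => some s
  | rails (false, false), _ => none
  | rails _, s => if s then some false else none
  | rung (true, true), s => if s then none else some true
  | rung (false, false), _ => none
  | rung _, s => some s

/-- The effect of a sequence of steps. -/
def run : List LadderStep → Bool → Option Bool
  | [], s => some s
  | o :: w, s => (step o s).bind (run w)

theorem run_append (v w : List LadderStep) (s : Bool) :
    run (v ++ w) s = (run v s).bind (run w) := by
  induction v generalizing s with
  | nil => rfl
  | cons o v ih =>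
    simp only [List.cons_append, run, Option.bind_assoc]
    congr 1
    exact funext ih

theorem sat_const (w : List LadderStep) (c : ℚ) :
    Sat w (fun _ _ => 0) (fun _ _ => c) fun _ => c := by
  induction w with
  | nil => trivial
  | cons o w ih => cases o <;> simp [Sat, ih]

theorem AllEq.apply_zero {w : List LadderStep} {c : ℚ} {y : ℕ → Bool → ℚ} {r : ℕ → ℚ}
    (h : AllEq w c y r) (t : Bool) : y 0 t = c := by
  cases w with
  | nil => exact h t
  | cons o w =>
    cases o
    · exact h.1 t
    · exact h.1 t

/-- Prepend a value to a sequence. -/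
def prepend {Y : Type*} (a : Y) (y : ℕ → Y) : ℕ → Y
  | 0 => a
  | k + 1 => y k

theorem exists_onRail_of_one {c : Bool × Bool} (hc : c = (true, false) ∨ c = (false, true)) :
    ∃ t₀, onRail c t₀ = true ∧ ∀ t, onRail c t = true → t = t₀ := by
  revert c
  decide

/-- Contracting the two rail edges moves the additional edge, if present, to the next pair of
vertices. -/
theorem isTree_rails_both (w : List LadderStep) (s : Bool) :
    IsTree (rails (true, true) :: w) s ↔ IsTree w s := by
  constructor
  · rintro ⟨h1, h2⟩
    refine ⟨fun g c => ?_, fun y r hS hs => ?_⟩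
    · obtain ⟨y, r, ⟨hy, hS⟩, hc⟩ := h1 (prepend (fun _ => 0) g) c
      refine ⟨_, _, hS, fun hs => ?_⟩
      have e1 := hy true rfl
      have e2 := hy false rfl
      have := hc hs
      simp only [prepend] at e1 e2
      linarith
    · exact (h2 (prepend (y 0) y) (prepend 0 r) ⟨fun t _ => sub_self _, hS⟩ hs).2
  · rintro ⟨h1, h2⟩
    refine ⟨fun g c => ?_, ?_⟩
    · obtain ⟨y, r, hS, hc⟩ := h1 (fun k => g (k + 1)) (c + g 0 true - g 0 false)
      refine ⟨prepend (fun t => y 0 t - g 0 t) y, prepend 0 r,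
        ⟨fun t _ => by simp [prepend], hS⟩, fun hs => ?_⟩
      have := hc hs
      simp only [prepend]
      linarith
    · rintro y r ⟨hy, hS⟩ hs
      have e : ∀ t, y 1 t = y 0 t := fun t => sub_eq_zero.1 (hy t (by cases t <;> rfl))
      have hV := h2 _ _ hS (by simpa [e] using hs)
      simp only [zero_add, e] at hV
      exact ⟨fun t => by rw [← e]; exact hV.apply_zero t, hV⟩

theorem not_isTree_rails_none (w : List LadderStep) (s : Bool) :
    ¬ IsTree (rails (false, false) :: w) s := by
  rintro ⟨-, h2⟩
  -- With no rail edge the left pair is cut off, so the potential 0 on the left and 1 on the right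
  -- is not excluded.
  have := (h2 (prepend (fun _ => 0) fun _ _ => 1) (prepend 0 fun _ => 1)
    ⟨fun t ht => (by cases t <;> cases ht), sat_const w 1⟩ fun _ => rfl).2
  exact one_ne_zero (this.apply_zero true)

theorem not_isTree_rails_one {c : Bool × Bool} (hc : c = (true, false) ∨ c = (false, true))
    (w : List LadderStep) : ¬ IsTree (rails c :: w) false := by
  rintro ⟨-, h2⟩
  rcases hc with rfl | rfl
  · have := h2 (prepend (fun t => cond t 0 1) fun _ _ => 0) (prepend 0 fun _ => 0)
      ⟨fun t ht => by cases t <;> simp [onRail, prepend] at ht ⊢, sat_const w 0⟩ (by simp)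
    exact one_ne_zero (this.apply_zero false)
  · have := h2 (prepend (fun t => cond t 0 1) fun _ _ => 1) (prepend 0 fun _ => 1)
      ⟨fun t ht => by cases t <;> simp [onRail, prepend] at ht ⊢, sat_const w 1⟩ (by simp)
    exact one_ne_zero (this.apply_zero false)

/-- The additional edge and the single rail edge form a path hanging on the rest of the ladder at
one point; it can be pruned, and the next two ends start disconnected. -/
theorem isTree_rails_one {c : Bool × Bool} (hc : c = (true, false) ∨ c = (false, true))
    (w : List LadderStep) : IsTree (rails c :: w) true ↔ IsTree w false := by
  obtain ⟨t₀, h0, hon⟩ := exists_onRail_of_one hc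
  constructor
  · rintro ⟨h1, h2⟩
    refine ⟨fun g c => ?_, fun y r hS hs => ?_⟩
    · obtain ⟨y, r, ⟨hy, hS⟩, hc⟩ := h1 (prepend (fun _ => 0) g) 0
      exact ⟨_, _, hS, by simp⟩
    · have := (h2 (prepend (fun _ => y 0 t₀) y) (prepend 0 r)
        ⟨fun t ht => by rw [hon t ht]; exact sub_self _, hS⟩ fun _ => rfl).2
      have e : y 0 true = y 0 t₀ := this.apply_zero true
      rw [e]
      exact this
  · rintro ⟨h1, h2⟩
    refine ⟨fun g c => ?_, ?_⟩
    · obtain ⟨y, r, hS, -⟩ := h1 (fun k => g (k + 1)) 0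
      -- The vertex on rail `t₀` is fixed by the rail edge and the other one by the additional edge,
      -- with a sign depending on which rail is the upper one.
      refine ⟨prepend (fun t => if t = t₀ then y 0 t₀ - g 0 t₀ else
        if t₀ then y 0 t₀ - g 0 t₀ - c else y 0 t₀ - g 0 t₀ + c) y, prepend 0 r,
        ⟨fun t ht => by simp [prepend, hon t ht], hS⟩, fun _ => ?_⟩
      cases t₀ <;> simp [prepend]
    · rintro y r ⟨hy, hS⟩ hs
      have hV := h2 _ _ hS (by simp)
      have e : y 1 t₀ = y 0 t₀ := sub_eq_zero.1 (hy t₀ h0)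
      have e1 := hV.apply_zero t₀
      have e2 := hs rfl
      have e3 : ∀ t, y 0 t = y 0 true := fun t => by cases t <;> simp [e2]
      simp only [zero_add] at hV e1
      rw [← e1, e, e3] at hV
      exact ⟨e3, hV⟩

theorem not_isTree_rung_none (w : List LadderStep) (s : Bool) :
    ¬ IsTree (rung (false, false) :: w) s := by
  rintro ⟨-, h2⟩
  have := (h2 (fun _ _ => 0) (prepend 1 fun _ => 0)
    ⟨fun _ => rfl, fun t ht => (by cases t <;> cases ht), sat_const w 0⟩ fun _ => rfl).2.1
  exact one_ne_zero this

/-- The midpoint of the rung is a leaf and can be pruned. -/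
theorem isTree_rung_one {c : Bool × Bool} (hc : c = (true, false) ∨ c = (false, true))
    (w : List LadderStep) (s : Bool) : IsTree (rung c :: w) s ↔ IsTree w s := by
  obtain ⟨t₀, h0, hon⟩ := exists_onRail_of_one hc
  constructor
  · rintro ⟨h1, h2⟩
    refine ⟨fun g c => ?_, fun y r hS hs => ?_⟩
    · obtain ⟨y, r, ⟨hy, -, hS⟩, hc⟩ := h1 (prepend (fun _ => 0) g) c
      exact ⟨_, _, hS, by simpa [hy] using hc⟩
    · exact (h2 (prepend (y 0) y) (prepend (y 0 t₀) r)
        ⟨fun t => rfl, fun t ht => by rw [hon t ht]; exact sub_self _, hS⟩ hs).2.2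
  · rintro ⟨h1, h2⟩
    refine ⟨fun g c => ?_, ?_⟩
    · obtain ⟨y, r, hS, hc⟩ := h1 (fun k => g (k + 1)) c
      exact ⟨prepend (y 0) y, prepend (y 0 t₀ + g 0 t₀) r,
        ⟨fun _ => rfl, fun t ht => by simp [prepend, hon t ht], hS⟩, hc⟩
    · rintro y r ⟨hy, hr, hS⟩ hs
      have hV := h2 _ _ hS (by simpa [hy] using hs)
      simp only [zero_add, hy] at hV
      have e1 : ∀ t, y 0 t = y 0 true := fun t => by rw [← hy]; exact hV.apply_zero t
      exact ⟨e1, by rw [← e1 t₀]; exact sub_eq_zero.1 (hr t₀ h0), hV⟩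

/-- The two halves of the rung close a cycle with the additional edge. -/
theorem not_isTree_rung_both (w : List LadderStep) : ¬ IsTree (rung (true, true) :: w) true := by
  rintro ⟨h1, -⟩
  obtain ⟨y, r, ⟨-, hr, -⟩, hc⟩ := h1 (fun _ _ => 0) 1
  have := hr true rfl
  have := hr false rfl
  have := hc rfl
  linarith

/-- The two halves of the rung are edges in series, so they act as the additional edge for the
remaining word. -/
theorem isTree_rung_both (w : List LadderStep) :
    IsTree (rung (true, true) :: w) false ↔ IsTree w true := by
  constructor
  · rintro ⟨h1, h2⟩
    refine ⟨fun g c => ?_, fun y r hS hs => ?_⟩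
    · obtain ⟨y, r, ⟨hy, hr, hS⟩, -⟩ := h1 (prepend (fun t => cond t 0 c) g) 0
      refine ⟨_, _, hS, fun _ => ?_⟩
      have e1 := hr true rfl
      have e2 := hr false rfl
      simp only [prepend, cond_true, cond_false] at e1 e2
      simp only [zero_add, hy]
      linarith
    · exact (h2 (prepend (y 0) y) (prepend (y 0 true) r) ⟨fun t => rfl, fun t _ => by
        cases t
        · simp [prepend, hs]
        · simp [prepend], hS⟩ (by simp)).2.2
  · rintro ⟨h1, h2⟩
    refine ⟨fun g c => ?_, ?_⟩
    · obtain ⟨y, r, hS, hc⟩ := h1 (fun k => g (k + 1)) (g 0 false - g 0 true)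
      refine ⟨prepend (y 0) y, prepend (y 0 true + g 0 true) r,
        ⟨fun _ => rfl, fun t _ => ?_, hS⟩, by simp⟩
      have := hc rfl
      cases t
      · simp only [prepend]
        linarith
      · simp [prepend]
    · rintro y r ⟨hy, hr, hS⟩ -
      have e1 := hr true rfl
      have e2 := hr false rfl
      have hV := h2 _ _ hS (by simp only [zero_add, hy]; intro; linarith)
      simp only [zero_add, hy] at hV
      exact ⟨fun t => by rw [← hy]; exact hV.apply_zero t, by linarith, hV⟩

theorem isTree_nil (s : Bool) : IsTree [] s ↔ s = true := by
  constructor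
  · rintro ⟨-, h2⟩
    by_contra h
    have := h2 (fun _ t => cond t 0 1) (fun _ => 0) trivial (by simp [h])
    exact one_ne_zero (this false)
  · rintro rfl
    refine ⟨fun g c => ⟨fun _ t => cond t c 0, fun _ => 0, trivial, by simp⟩,
      fun y r _ hs t => ?_⟩
    cases t
    · exact (hs rfl).symm
    · rfl

/-- The sequences of steps that yield a spanning tree are those that are accepted by `run`. -/
theorem isTree_iff_run (w : List LadderStep) (s : Bool) : IsTree w s ↔ run w s = some true := by
  induction w generalizing s with
  | nil => simp [isTree_nil, run]
  | cons o w ih =>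
    rcases o with ⟨u, l⟩ | ⟨u, l⟩ <;> cases u <;> cases l <;> cases s <;>
      simp [run, step, ← ih, isTree_rails_both, not_isTree_rails_none, not_isTree_rails_one,
        isTree_rails_one, not_isTree_rung_none, isTree_rung_one, not_isTree_rung_both,
        isTree_rung_both]

end LadderStep


/-! ### Subgraphs of the subdivided ladder as words -/

/-- A set of darts of the ladder with `n + 1` faces, sorted by the rungs: for the first rung, the
halves of this rung and the darts to its right; for the `n` inner rungs, the darts to the left, the
halves of the rung, and the darts to the right; for the last rung, the darts to its left, and the
halves of the rung. -/
abbrev LadderConfig (n : ℕ) : Type :=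
  ((Bool × Bool) × (Bool × Bool)) × (Fin n → (Bool × Bool) × (Bool × Bool) × (Bool × Bool)) ×
    ((Bool × Bool) × (Bool × Bool))

namespace LadderConfig

open LadderStep

variable {n : ℕ}

/-- Whether a dart belongs to a set of darts. -/
def bit (c : LadderConfig n) : RailDart (n + 1) × Bool → Bool
  | (.rung j, t) => Fin.cases (onRail c.1.1 t)
      (fun j => Fin.lastCases (onRail c.2.2.2 t) (fun i => onRail (c.2.1 i).2.1 t) j) j
  | (.right j, t) => Fin.cases (onRail c.1.2 t) (fun i => onRail (c.2.1 i).2.2 t) j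
  | (.left j, t) => Fin.lastCases (onRail c.2.2.1 t) (fun i => onRail (c.2.1 i).1 t) j

@[simp] theorem bit_rung_zero (c : LadderConfig n) (t : Bool) :
    c.bit (.rung 0, t) = onRail c.1.1 t := rfl

@[simp] theorem bit_right_zero (c : LadderConfig n) (t : Bool) :
    c.bit (.right 0, t) = onRail c.1.2 t := rfl

@[simp] theorem bit_left_castSucc (c : LadderConfig n) (i : Fin n) (t : Bool) :
    c.bit (.left i.castSucc, t) = onRail (c.2.1 i).1 t := by
  simp [bit]

@[simp] theorem bit_rung_succ (c : LadderConfig n) (i : Fin n) (t : Bool) :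
    c.bit (.rung i.castSucc.succ, t) = onRail (c.2.1 i).2.1 t := by
  simp only [bit, Fin.cases_succ, Fin.lastCases_castSucc]

@[simp] theorem bit_right_succ (c : LadderConfig n) (i : Fin n) (t : Bool) :
    c.bit (.right i.succ, t) = onRail (c.2.1 i).2.2 t := rfl

@[simp] theorem bit_left_last (c : LadderConfig n) (t : Bool) :
    c.bit (.left (Fin.last n), t) = onRail c.2.2.1 t := by
  simp [bit]

@[simp] theorem bit_rung_last (c : LadderConfig n) (t : Bool) :
    c.bit (.rung (Fin.last (n + 1)), t) = onRail c.2.2.2 t := by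
  rw [← Fin.succ_last]
  simp only [bit, Fin.cases_succ, Fin.lastCases_last]

/-- The set of darts described by a configuration. -/
def toSet (c : LadderConfig n) : Set (RailDart (n + 1) × Bool) := {x | c.bit x = true}

@[simp] theorem mem_toSet (c : LadderConfig n) (x : RailDart (n + 1) × Bool) :
    x ∈ c.toSet ↔ c.bit x = true := Iff.rfl

theorem onRail_injective {c d : Bool × Bool} (h : ∀ t, onRail c t = onRail d t) : c = d :=
  Prod.ext (h true) (h false)

theorem toSet_bijective : Function.Bijective (toSet : LadderConfig n → _) := by
  classical
  constructor
  · intro c d h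
    have h' : ∀ x, c.bit x = d.bit x := fun x => by
      have := congrArg (fun A => x ∈ A) h
      simpa using this
    rw [forall_dart_iff] at h'
    simp only [bit_rung_zero, bit_right_zero, bit_left_castSucc, bit_rung_succ, bit_right_succ,
      bit_left_last, bit_rung_last] at h'
    obtain ⟨h1, h2, h3⟩ := h'
    refine Prod.ext (Prod.ext ?_ ?_) (Prod.ext (funext fun i => Prod.ext ?_ (Prod.ext ?_ ?_))
      (Prod.ext ?_ ?_)) <;> refine onRail_injective fun t => ?_
    · exact (h1 t).1
    · exact (h1 t).2
    · exact (h2 i t).1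
    · exact (h2 i t).2.1
    · exact (h2 i t).2.2
    · exact (h3 t).1
    · exact (h3 t).2
  · intro A
    let f : RailDart (n + 1) → Bool × Bool := fun d => (decide ((d, true) ∈ A),
      decide ((d, false) ∈ A))
    have hf : ∀ d t, onRail (f d) t = true ↔ (d, t) ∈ A := by
      rintro d (_ | _) <;> simp [f, onRail]
    refine ⟨((f (.rung 0), f (.right 0)),
      (fun i => (f (.left i.castSucc), f (.rung i.castSucc.succ), f (.right i.succ))),
      (f (.left (Fin.last n)), f (.rung (Fin.last (n + 1))))), Set.ext ?_⟩
    rw [forall_dart_iff]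
    simp [hf]

/-- The steps at an inner rung. -/
def blockWord (b : (Bool × Bool) × (Bool × Bool) × (Bool × Bool)) : List LadderStep :=
  [rails b.1, rung b.2.1, rails b.2.2]

/-- The sequence of steps that build the ladder. -/
def word (c : LadderConfig n) : List LadderStep :=
  rung c.1.1 :: rails c.1.2 :: ((List.ofFn c.2.1).flatMap blockWord ++
    [rails c.2.2.1, rung c.2.2.2])

theorem sat_blocks (q : Fin n → (Bool × Bool) × (Bool × Bool) × (Bool × Bool))
    (w : List LadderStep) (g y : ℕ → Bool → ℚ) (r : ℕ → ℚ) :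
    Sat ((List.ofFn q).flatMap blockWord ++ w) g y r ↔
      (∀ i : Fin n, (∀ t, onRail (q i).1 t → y (3 * i + 1) t - y (3 * i) t = g (3 * i) t) ∧
        (∀ t, y (3 * i + 2) t = y (3 * i + 1) t) ∧
        (∀ t, onRail (q i).2.1 t → r (3 * i + 1) - y (3 * i + 1) t = g (3 * i + 1) t) ∧
        (∀ t, onRail (q i).2.2 t → y (3 * i + 3) t - y (3 * i + 2) t = g (3 * i + 2) t)) ∧
      Sat w (fun k => g (k + 3 * n)) (fun k => y (k + 3 * n)) fun k => r (k + 3 * n) := by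
  induction n generalizing g y r with
  | zero => simp
  | succ n ih =>
    rw [List.ofFn_succ, List.flatMap_cons, List.append_assoc, Fin.forall_fin_succ]
    simp only [blockWord, List.cons_append, List.nil_append, Sat]
    rw [ih]
    constructor
    · rintro ⟨h1, h2, h3, h4, h5, h6⟩
      exact ⟨⟨⟨h1, h2, h3, h4⟩, h5⟩, h6⟩
    · rintro ⟨⟨⟨h1, h2, h3, h4⟩, h5⟩, h6⟩
      exact ⟨h1, h2, h3, h4, h5, h6⟩

theorem allEq_blocks (q : Fin n → (Bool × Bool) × (Bool × Bool) × (Bool × Bool))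
    (w : List LadderStep) (a : ℚ) (y : ℕ → Bool → ℚ) (r : ℕ → ℚ) :
    AllEq ((List.ofFn q).flatMap blockWord ++ w) a y r ↔
      (∀ i : Fin n, (∀ t, y (3 * i) t = a) ∧ (∀ t, y (3 * i + 1) t = a) ∧ r (3 * i + 1) = a ∧
        ∀ t, y (3 * i + 2) t = a) ∧
      AllEq w a (fun k => y (k + 3 * n)) fun k => r (k + 3 * n) := by
  induction n generalizing y r with
  | zero => simp
  | succ n ih =>
    rw [List.ofFn_succ, List.flatMap_cons, List.append_assoc, Fin.forall_fin_succ]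
    simp only [blockWord, List.cons_append, List.nil_append, AllEq]
    rw [ih]
    constructor
    · rintro ⟨h1, h2, h3, h4, h5, h6⟩
      exact ⟨⟨⟨h1, h2, h3, h4⟩, h5⟩, h6⟩
    · rintro ⟨⟨⟨h1, h2, h3, h4⟩, h5⟩, h6⟩
      exact ⟨h1, h2, h3, h4, h5, h6⟩

/-- The values of potentials on the edges of the ladder. -/
def edgeValue (y : ℕ → Bool → ℚ) (r : ℕ → ℚ) {m : ℕ} : RailDart m × Bool → ℚ
  | (.rung i, _) => r (3 * i)
  | (.right i, t) => y (3 * i + 2) t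
  | (.left i, t) => y (3 * i + 2) t

/-- The values of potentials on the vertices of the ladder. -/
def vertexValue (y : ℕ → Bool → ℚ) {m : ℕ} : RailDart m × Bool → ℚ
  | (.rung i, t) => y (3 * i) t
  | (.right i, t) => y (3 * i) t
  | (.left i, t) => y (3 * i + 3) t

/-- The difference along a dart from the vertex to the edge. -/
def dartValue (g : ℕ → Bool → ℚ) {m : ℕ} : RailDart m × Bool → ℚ
  | (.rung i, t) => g (3 * i) t
  | (.right i, t) => g (3 * i + 1) t
  | (.left i, t) => - g (3 * i + 2) t

theorem edgeValue_invariant (y : ℕ → Bool → ℚ) (r : ℕ → ℚ) {m : ℕ} (x : RailDart m × Bool) :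
    edgeValue y r ((ladderMap m).α x) = edgeValue y r x := by
  revert x
  rw [ladderMap_forall_α_iff]
  exact ⟨fun _ => rfl, fun _ _ => rfl⟩

theorem vertexValue_invariant (y : ℕ → Bool → ℚ) {m : ℕ} (x : RailDart m × Bool) :
    vertexValue y ((ladderMap m).σ x) = vertexValue y x := by
  revert x
  rw [ladderMap_forall_σ_iff]
  exact ⟨fun _ _ => rfl, fun _ _ => rfl⟩

theorem exists_edgeValue_vertexValue {m : ℕ} (φ ψ : RailDart m × Bool → ℚ)
    (hφ : ∀ x, φ ((ladderMap m).α x) = φ x) (hψ : ∀ x, ψ ((ladderMap m).σ x) = ψ x) :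
    ∃ y r, edgeValue y r = φ ∧ vertexValue y = ψ ∧ ∀ i t, y (3 * i + 1) t = y (3 * i) t := by
  obtain ⟨hφ1, hφ2⟩ := (ladderMap_forall_α_iff φ).1 hφ
  obtain ⟨hψ1, hψ2⟩ := (ladderMap_forall_σ_iff ψ).1 hψ
  let rung (f : RailDart m × Bool → ℚ) (i : ℕ) (t : Bool) : ℚ :=
    if h : i < m + 1 then f (.rung ⟨i, h⟩, t) else 0
  let right (f : RailDart m × Bool → ℚ) (i : ℕ) (t : Bool) : ℚ :=
    if h : i < m then f (.right ⟨i, h⟩, t) else 0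
  have hrung : ∀ f (i : Fin (m + 1)) t, rung f i t = f (.rung i, t) := fun f i t => dif_pos i.2
  have hright : ∀ f (i : Fin m) t, right f i t = f (.right i, t) := fun f i t => dif_pos i.2
  let y : ℕ → Bool → ℚ := fun k t => if k % 3 = 2 then right φ (k / 3) t else rung ψ (k / 3) t
  have h0 : ∀ i t, y (3 * i) t = rung ψ i t := fun i t => by
    simp only [y]
    rw [if_neg (by omega), show 3 * i / 3 = i by omega]
  have h1 : ∀ i t, y (3 * i + 1) t = rung ψ i t := fun i t => by
    simp only [y]
    rw [if_neg (by omega), show (3 * i + 1) / 3 = i by omega]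
  have h2 : ∀ i t, y (3 * i + 2) t = right φ i t := fun i t => by
    simp only [y]
    rw [if_pos (by omega), show (3 * i + 2) / 3 = i by omega]
  refine ⟨y, fun k => rung φ (k / 3) true, funext ?_, funext ?_, fun i t => by rw [h0, h1]⟩
  · rintro ⟨i | i | i, t⟩
    · simp only [edgeValue]
      rw [show 3 * i.val / 3 = i by omega, hrung]
      cases t
      · exact (hφ1 i).symm
      · rfl
    · simp only [edgeValue, h2, hright]
    · simp only [edgeValue, h2, hright, hφ2]
  · rintro ⟨i | i | i, t⟩
    · simp only [vertexValue, h0, hrung]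
    · rw [hψ1, ← hrung ψ, ← h0]
      rfl
    · rw [hψ2, ← hrung ψ, ← h0]
      rfl

theorem exists_dartValue {m : ℕ} (f : RailDart m × Bool → ℚ) : ∃ g, dartValue g = f := by
  refine ⟨fun k t => if k % 3 = 0 then (if h : k / 3 < m + 1 then f (.rung ⟨k / 3, h⟩, t) else 0)
    else if k % 3 = 1 then (if h : k / 3 < m then f (.right ⟨k / 3, h⟩, t) else 0)
    else (if h : k / 3 < m then - f (.left ⟨k / 3, h⟩, t) else 0), funext ?_⟩
  rintro ⟨⟨i, hi⟩ | ⟨i, hi⟩ | ⟨i, hi⟩, t⟩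
  · simp only [dartValue]
    rw [if_pos (by omega), dif_pos (by omega)]
    simp only [show 3 * i / 3 = i by omega]
  · simp only [dartValue]
    rw [if_neg (by omega), if_pos (by omega), dif_pos (by omega)]
    simp only [show (3 * i + 1) / 3 = i by omega]
  · simp only [dartValue]
    rw [if_neg (by omega), if_neg (by omega), dif_pos (by omega), neg_neg]
    simp only [show (3 * i + 2) / 3 = i by omega]

/-- Rung `i` is step `3 * i`, and the right and left darts of the `i`-th rail edges are steps `3 * i
+ 1` and `3 * i + 2`. A rung step stays at the same vertices, which is the clause on `3 * i + 1`. -/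
theorem sat_word_iff (c : LadderConfig n) (g y : ℕ → Bool → ℚ) (r : ℕ → ℚ) :
    Sat c.word g y r ↔ (∀ (i : Fin (n + 2)) t, y (3 * i + 1) t = y (3 * i) t) ∧
      ∀ x ∈ c.toSet, edgeValue y r x - vertexValue y x = dartValue g x := by
  have e1 : 1 + 3 * n = 3 * n + 1 := Nat.add_comm _ _
  -- Left darts run from the vertex to the edge against the direction of building, hence the sign in
  -- `dartValue`.
  have hl : ∀ {a b d : ℚ}, a - b = -d ↔ b - a = d := fun {a b d} =>
    ⟨fun h => by linarith, fun h => by linarith⟩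
  have e2 : 2 + 3 * n = 3 * n + 2 := Nat.add_comm _ _
  simp only [word, Sat, sat_blocks, zero_add, e1, e2, and_true]
  rw [forall_dart_iff, Fin.forall_fin_succ, Fin.forall_fin_succ']
  simp only [mem_toSet, bit_rung_zero, bit_right_zero, bit_left_castSucc, bit_rung_succ,
    bit_right_succ, bit_left_last, bit_rung_last, edgeValue, vertexValue, dartValue, hl,
    Fin.val_succ, Fin.val_castSucc, Fin.val_last, Fin.val_zero, mul_zero, zero_add, mul_add,
    mul_one, add_assoc, Nat.reduceAdd]
  constructor
  · rintro ⟨h1, h2, h3, h4, h5, h6, h7⟩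
    refine ⟨⟨h1, fun i => (h4 i).2.1, h6⟩, fun t => ⟨h2 t, fun h => ?_⟩, fun i t =>
      ⟨(h4 i).1 t, (h4 i).2.2.1 t, fun h => ?_⟩, fun t => ⟨h5 t, h7 t⟩⟩
    · rw [← h1]; exact h3 t h
    · rw [← (h4 i).2.1]; exact (h4 i).2.2.2 t h
  · rintro ⟨⟨h1, h4, h6⟩, h2, h3, h5⟩
    refine ⟨h1, fun t => (h2 t).1, fun t h => ?_, fun i => ⟨fun t => (h3 i t).1, h4 i,
      fun t => (h3 i t).2.1, fun t h => ?_⟩, fun t => (h5 t).1, h6, fun t => (h5 t).2⟩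
    · rw [h1]; exact (h2 t).2 h
    · rw [h4 i]; exact (h3 i t).2.2 h

theorem allEq_word_iff (c : LadderConfig n) (a : ℚ) (y : ℕ → Bool → ℚ) (r : ℕ → ℚ) :
    AllEq c.word a y r ↔ (∀ (i : Fin (n + 2)) t, y (3 * i + 1) t = y (3 * i) t) ∧
      ∀ x : RailDart (n + 1) × Bool, edgeValue y r x = a ∧ vertexValue y x = a := by
  have e1 : 1 + 3 * n = 3 * n + 1 := Nat.add_comm _ _
  have e2 : 2 + 3 * n = 3 * n + 2 := Nat.add_comm _ _
  simp only [word, AllEq, allEq_blocks, zero_add, e1, e2]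
  rw [forall_dart_iff, Fin.forall_fin_succ, Fin.forall_fin_succ']
  simp only [edgeValue, vertexValue,
    Fin.val_succ, Fin.val_castSucc, Fin.val_last, Fin.val_zero, mul_zero, zero_add, mul_add,
    mul_one, add_assoc, Nat.reduceAdd]
  constructor
  · rintro ⟨h1, h2, h3, h4, h5, h6, h7, h8⟩
    have h9 : ∀ j ≤ n, ∀ t, y (3 * j + 2) t = a := by
      intro j hj t
      rcases hj.lt_or_eq with hj | rfl
      · exact (h4 ⟨j, hj⟩).1 t
      · exact h5 t
    exact ⟨⟨fun t => by rw [h1, h3], fun i t => by rw [(h4 i).2.1, (h4 i).2.2.2],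
      fun t => by rw [h6, h8]⟩, fun t => ⟨⟨h2, h1 t⟩, h9 0 n.zero_le t, h1 t⟩,
      fun i t => ⟨⟨(h4 i).1 t, (h4 i).2.1 t⟩, ⟨(h4 i).2.2.1, (h4 i).2.1 t⟩,
        h9 (i + 1) i.2 t, (h4 i).2.1 t⟩,
      fun t => ⟨⟨h5 t, h6 t⟩, h7, h6 t⟩⟩
  · rintro ⟨⟨h1, h4, h6⟩, h2, h3, h5⟩
    have h0 : ∀ t, y 0 t = a := fun t => (h2 t).1.2
    exact ⟨h0, (h2 true).1.1, fun t => by rw [h1, h0],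
      fun i => ⟨fun t => (h3 i t).1.1, fun t => (h3 i t).1.2, (h3 i true).2.1.1,
        fun t => by rw [h4, (h3 i t).1.2]⟩,
      fun t => (h5 t).1.1, fun t => (h5 t).1.2, (h5 true).2.1,
      fun t => by rw [h6, (h5 t).1.2]⟩

/-- The spanning trees of the subdivided ladder are given by the accepted words. -/
theorem isIncidenceTree_toSet_iff (c : LadderConfig n) :
    IsIncidenceTree (ladderMap (n + 1)).α (ladderMap (n + 1)).σ c.toSet ↔
      run c.word false = some true := by
  rw [← isTree_iff_run]
  have h0 : ∀ x : RailDart (n + 1) × Bool, dartValue (fun _ _ => 0) x = 0 := by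
    rintro ⟨i | i | i, t⟩ <;> simp [dartValue]
  constructor
  · rintro ⟨h1, h2⟩
    refine ⟨fun g _ => ?_, fun y r hS _ => ?_⟩
    · obtain ⟨φ, ψ, hφ, hψ, hg⟩ := h1 (dartValue g)
      obtain ⟨y, r, rfl, rfl, hy⟩ := exists_edgeValue_vertexValue φ ψ hφ hψ
      exact ⟨y, r, (sat_word_iff c g y r).2 ⟨fun i t => hy i t, hg⟩, by simp⟩
    · obtain ⟨h3, h4⟩ := (sat_word_iff c _ y r).1 hS
      have h5 := h2 (edgeValue y r) (vertexValue y) (edgeValue_invariant y r)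
        (vertexValue_invariant y) fun x hx => by
          have := h4 x hx
          rw [h0] at this
          exact sub_eq_zero.1 this
      have h6 : ∀ x : RailDart (n + 1) × Bool, edgeValue y r x = y 0 true := fun x =>
        h5 x (.rung 0, true)
      exact (allEq_word_iff c _ y r).2 ⟨h3, fun x => ⟨h6 x, by rw [← h5 x x, h6]⟩⟩
  · rintro ⟨h1, h2⟩
    constructor
    · intro f
      obtain ⟨g, rfl⟩ := exists_dartValue f
      obtain ⟨y, r, hS, -⟩ := h1 g 0
      exact ⟨_, _, edgeValue_invariant y r, vertexValue_invariant y,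
        ((sat_word_iff c g y r).1 hS).2⟩
    · intro φ ψ hφ hψ hφψ x z
      obtain ⟨y, r, rfl, rfl, hy⟩ := exists_edgeValue_vertexValue φ ψ hφ hψ
      have hS := (sat_word_iff c (fun _ _ => 0) y r).2 ⟨fun i t => hy i t, fun x hx => by
        rw [h0, hφψ x hx, sub_self]⟩
      have h3 := ((allEq_word_iff c _ y r).1 (h2 y r hS (by simp))).2
      rw [(h3 x).1, (h3 z).2]

end LadderConfig


/-! ### Counting accepted words -/

namespace LadderConfig

open LadderStep

/-- The choices at one end of the ladder. -/
abbrev EndChoice : Type := (Bool × Bool) × (Bool × Bool)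

/-- The choices at an inner rung. -/
abbrev BlockChoice : Type := (Bool × Bool) × (Bool × Bool) × (Bool × Bool)

/-- The effect of the left end of the ladder, if the choice there is allowed. -/
def leftRun (ok : EndChoice → Bool) (p : EndChoice) : Option Bool :=
  if ok p then run [rung p.1, rails p.2] false else none

/-- The effect of an inner rung, if the choice there is allowed. -/
def blockRun (ok : BlockChoice → Bool) (b : BlockChoice) (s : Bool) : Option Bool :=
  if ok b then run (blockWord b) s else none

/-- The effect of the inner rungs, if the choices there are allowed. -/
def blocksRun (ok : BlockChoice → Bool) : {n : ℕ} → (Fin n → BlockChoice) → Bool → Option Bool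
  | 0, _, s => some s
  | _ + 1, q, s => (blockRun ok (q 0) s).bind (blocksRun ok (Fin.tail q))

/-- The effect of the right end of the ladder, if the choice there is allowed. -/
def rightRun (ok : EndChoice → Bool) (e : EndChoice) (s : Bool) : Option Bool :=
  if ok e then run [rails e.1, rung e.2] s else none

theorem blocksRun_eq_some_iff (ok : BlockChoice → Bool) {n : ℕ} (q : Fin n → BlockChoice)
    (s s' : Bool) : blocksRun ok q s = some s' ↔
      (∀ i, ok (q i) = true) ∧ run ((List.ofFn q).flatMap blockWord) s = some s' := by
  induction n generalizing s with
  | zero => simp [blocksRun, run]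
  | succ n ih =>
    rw [List.ofFn_succ, List.flatMap_cons, run_append, Fin.forall_fin_succ, blocksRun, blockRun]
    split_ifs with h
    · simp only [h, true_and, Option.bind_eq_some_iff, ih, Fin.tail]
      constructor
      · rintro ⟨a, h1, h2, h3⟩
        exact ⟨h2, a, h1, h3⟩
      · rintro ⟨h2, a, h1, h3⟩
        exact ⟨a, h1, h2, h3⟩
    · simp [h]

theorem run_word_eq_some_iff (okL okR : EndChoice → Bool) (okB : BlockChoice → Bool) {n : ℕ}
    (c : LadderConfig n) :
    (okL c.1 = true ∧ (∀ i, okB (c.2.1 i) = true) ∧ okR c.2.2 = true) ∧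
        run c.word false = some true ↔
      (leftRun okL c.1).bind (fun s => (blocksRun okB c.2.1 s).bind (rightRun okR c.2.2)) =
        some true := by
  have hw : c.word = [rung c.1.1, rails c.1.2] ++ ((List.ofFn c.2.1).flatMap blockWord ++
    [rails c.2.2.1, rung c.2.2.2]) := rfl
  simp only [hw, run_append, Option.bind_eq_some_iff, blocksRun_eq_some_iff, leftRun, rightRun,
    Option.ite_none_right_eq_some]
  constructor
  · rintro ⟨⟨h1, h2, h3⟩, a, h4, b, h5, h6⟩
    exact ⟨a, ⟨h1, h4⟩, b, ⟨h2, h5⟩, h3, h6⟩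
  · rintro ⟨a, ⟨h1, h4⟩, b, ⟨h2, h5⟩, h3, h6⟩
    exact ⟨⟨h1, h2, h3⟩, a, h4, b, h5, h6⟩

/-- The number of elements with a given image. -/
def fiberCard {B Y : Type*} [Fintype B] [DecidableEq Y] (u : B → Y) (y : Y) : ℕ :=
  (Finset.univ.filter fun b => u b = y).card

/-- This is matrix multiplication: a sum over the intermediate state, to which failed words
contribute nothing. -/
theorem fiberCard_bind {B Z : Type*} [Fintype B] [Fintype Z] (u : B → Option Bool)
    (v : Z → Bool → Option Bool) (a : Bool) :
    fiberCard (fun x : B × Z => (u x.1).bind (v x.2)) (some a) =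
      fiberCard u (some true) * fiberCard (fun z => v z true) (some a) +
        fiberCard u (some false) * fiberCard (fun z => v z false) (some a) := by
  simp only [fiberCard, Finset.card_filter, Fintype.sum_prod_type, Finset.sum_mul]
  rw [← Finset.sum_add_distrib]
  refine Finset.sum_congr rfl fun b _ => ?_
  rcases u b with _ | _ | _ <;> simp

theorem fiberCard_equiv {B C Y : Type*} [Fintype B] [Fintype C] [DecidableEq Y] (e : B ≃ C)
    (u : B → Y) (v : C → Y) (h : ∀ b, u b = v (e b)) (y : Y) : fiberCard u y = fiberCard v y := by
  simp only [fiberCard, Finset.card_filter, h]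
  exact Equiv.sum_comp e fun c => if v c = y then 1 else 0

/-- The numbers of ways to complete a subgraph of the ladder to a spanning tree, when the ends of
the rails are connected and when they are not, after the addition of `n` rungs. -/
def transfer (k : ℕ) (v : ℕ × ℕ) : ℕ → ℕ × ℕ
  | 0 => v
  | n + 1 => (4 * (transfer k v n).1 + k * (transfer k v n).2,
      (transfer k v n).1 + 4 * (transfer k v n).2)

/-- Three entries of the matrix of an inner rung are fixed because they agree for all conditions
considered below; only the passage from connected to disconnected ends varies. -/
theorem fiberCard_blocksRun (okR : EndChoice → Bool) (okB : BlockChoice → Bool) (k : ℕ)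
    (v : ℕ × ℕ)
    (h1 : fiberCard (fun b => blockRun okB b true) (some true) = 4)
    (h2 : fiberCard (fun b => blockRun okB b true) (some false) = k)
    (h3 : fiberCard (fun b => blockRun okB b false) (some true) = 1)
    (h4 : fiberCard (fun b => blockRun okB b false) (some false) = 4)
    (h5 : fiberCard (fun e => rightRun okR e true) (some true) = v.1)
    (h6 : fiberCard (fun e => rightRun okR e false) (some true) = v.2) (n : ℕ) :
    fiberCard (fun x : (Fin n → BlockChoice) × EndChoice =>
      (blocksRun okB x.1 true).bind (rightRun okR x.2)) (some true) = (transfer k v n).1 ∧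
    fiberCard (fun x : (Fin n → BlockChoice) × EndChoice =>
      (blocksRun okB x.1 false).bind (rightRun okR x.2)) (some true) = (transfer k v n).2 := by
  induction n with
  | zero =>
    have h : ∀ s, fiberCard (fun x : (Fin 0 → BlockChoice) × EndChoice =>
        (blocksRun okB x.1 s).bind (rightRun okR x.2)) (some true) =
        fiberCard (fun e => rightRun okR e s) (some true) := fun s =>
      fiberCard_equiv (Equiv.uniqueProd EndChoice (Fin 0 → BlockChoice))
        (fun x : (Fin 0 → BlockChoice) × EndChoice => (blocksRun okB x.1 s).bind (rightRun okR x.2))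
        (fun e => rightRun okR e s) (fun x => rfl) _
    rw [h, h]
    exact ⟨h5, h6⟩
  | succ n ih =>
    have h : ∀ s, fiberCard (fun x : (Fin (n + 1) → BlockChoice) × EndChoice =>
        (blocksRun okB x.1 s).bind (rightRun okR x.2)) (some true) =
        fiberCard (fun x : BlockChoice × ((Fin n → BlockChoice) × EndChoice) =>
          (blockRun okB x.1 s).bind fun s => (blocksRun okB x.2.1 s).bind (rightRun okR x.2.2))
            (some true) := fun s =>
      fiberCard_equiv (((Fin.consEquiv fun _ => BlockChoice).symm.prodCongr
        (Equiv.refl _)).trans (Equiv.prodAssoc _ _ _)) _ _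
        (fun x => by
          simp only [blocksRun, Option.bind_assoc]
          rfl) _
    rw [h, h]
    rw [fiberCard_bind (fun b => blockRun okB b true) (fun (z : (Fin n → BlockChoice) × EndChoice)
      s => (blocksRun okB z.1 s).bind (rightRun okR z.2)),
      fiberCard_bind (fun b => blockRun okB b false) (fun (z : (Fin n → BlockChoice) × EndChoice)
      s => (blocksRun okB z.1 s).bind (rightRun okR z.2)), h1, h2, h3, h4, ih.1, ih.2]
    simp [transfer]

/-- The number of spanning trees of the subdivided ladder that are subject to local conditions. -/
theorem ncard_isIncidenceTree {n : ℕ} (okL okR : EndChoice → Bool) (okB : BlockChoice → Bool)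
    (Q : Set (RailDart (n + 1) × Bool) → Prop)
    (hQ : ∀ c : LadderConfig n, Q c.toSet ↔
      okL c.1 = true ∧ (∀ i, okB (c.2.1 i) = true) ∧ okR c.2.2 = true) :
    Set.ncard {A | Q A ∧ IsIncidenceTree (ladderMap (n + 1)).α (ladderMap (n + 1)).σ A} =
      fiberCard (leftRun okL) (some true) *
        fiberCard (fun x : (Fin n → BlockChoice) × EndChoice =>
          (blocksRun okB x.1 true).bind (rightRun okR x.2)) (some true) +
      fiberCard (leftRun okL) (some false) *
        fiberCard (fun x : (Fin n → BlockChoice) × EndChoice =>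
          (blocksRun okB x.1 false).bind (rightRun okR x.2)) (some true) := by
  rw [← fiberCard_bind (leftRun okL) (fun (x : (Fin n → BlockChoice) × EndChoice) s =>
    (blocksRun okB x.1 s).bind (rightRun okR x.2)), fiberCard, ← Set.ncard_coe_finset]
  symm
  refine Set.ncard_congr (fun c _ => toSet c) (fun c hc => ?_)
    (fun c d _ _ h => toSet_bijective.1 h) (fun A hA => ?_)
  · simp only [Finset.coe_filter, Finset.mem_univ, true_and, Set.mem_ofPred_eq] at hc
    have := (run_word_eq_some_iff okL okR okB c).2 hc
    exact ⟨(hQ c).2 this.1, (isIncidenceTree_toSet_iff c).2 this.2⟩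
  · obtain ⟨c, rfl⟩ := toSet_bijective.2 A
    refine ⟨c, ?_, rfl⟩
    simp only [Finset.coe_filter, Finset.mem_univ, true_and, Set.mem_ofPred_eq]
    exact (run_word_eq_some_iff okL okR okB c).1
      ⟨(hQ c).1 hA.1, (isIncidenceTree_toSet_iff c).1 hA.2⟩

theorem forall_onRail_iff {c : Bool × Bool} :
    (∀ t, onRail c t = true) ↔ decide (c = (true, true)) = true := by
  revert c
  decide

theorem forall_onRail_or_iff {b : BlockChoice} :
    (∀ t, onRail b.2.1 t = true ∨ (onRail b.1 t = true ∧ onRail b.2.2 t = true)) ↔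
      ((b.2.1.1 || (b.1.1 && b.2.2.1)) && (b.2.1.2 || (b.1.2 && b.2.2.2))) = true := by
  rw [Bool.forall_bool]
  simp [onRail, and_comm]

/-- The number of spanning trees of the subdivided ladder. -/
theorem ncard_isIncidenceTree_of_forall {n : ℕ} (Q : Set (RailDart (n + 1) × Bool) → Prop)
    (hQ : ∀ A, Q A) :
    Set.ncard {A | Q A ∧ IsIncidenceTree (ladderMap (n + 1)).α (ladderMap (n + 1)).σ A} =
      (transfer 12 (4, 1) n).1 + 4 * (transfer 12 (4, 1) n).2 := by
  rw [ncard_isIncidenceTree (fun _ => true) (fun _ => true) (fun _ => true) Q (by simp [hQ])]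
  -- The 12 ways to disconnect the ends: 4 with one rail cut before the rung and half a rung, 4 with
  -- one rail cut after it and half a rung, 4 with a cut on each side and a full rung.
  obtain ⟨h1, h2⟩ := fiberCard_blocksRun (fun _ => true) (fun _ => true) 12 (4, 1)
    (by decide) (by decide) (by decide) (by decide) (by decide) (by decide) n
  rw [h1, h2, show fiberCard (leftRun fun _ => true) (some true) = 1 by decide,
    show fiberCard (leftRun fun _ => true) (some false) = 4 by decide, one_mul]

/-- The number of spanning trees of the subdivided ladder that contain the darts at the left ends
of the rails. -/
theorem ncard_isIncidenceTree_of_left {n : ℕ} (Q : Set (RailDart (n + 1) × Bool) → Prop)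
    (hQ : ∀ A, Q A ↔ ∀ t, (.right 0, t) ∈ A) :
    Set.ncard {A | Q A ∧ IsIncidenceTree (ladderMap (n + 1)).α (ladderMap (n + 1)).σ A} =
      (transfer 12 (4, 1) n).1 + 2 * (transfer 12 (4, 1) n).2 := by
  rw [ncard_isIncidenceTree (fun p => decide (p.2 = (true, true))) (fun _ => true)
    (fun _ => true) Q (by
      intro c
      simp only [hQ, mem_toSet, bit_right_zero, forall_onRail_iff]
      simp)]
  obtain ⟨h1, h2⟩ := fiberCard_blocksRun (fun _ => true) (fun _ => true) 12 (4, 1)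
    (by decide) (by decide) (by decide) (by decide) (by decide) (by decide) n
  rw [h1, h2,
    show fiberCard (leftRun fun p => decide (p.2 = (true, true))) (some true) = 1 by decide,
    show fiberCard (leftRun fun p => decide (p.2 = (true, true))) (some false) = 2 by decide,
    one_mul]

/-- The number of spanning trees of the subdivided ladder that contain the darts at the ends
of the rails. -/
theorem ncard_isIncidenceTree_of_left_right {n : ℕ} (Q : Set (RailDart (n + 1) × Bool) → Prop)
    (hQ : ∀ A, Q A ↔ (∀ t, (.right 0, t) ∈ A) ∧ ∀ t, (.left (Fin.last n), t) ∈ A) :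
    Set.ncard {A | Q A ∧ IsIncidenceTree (ladderMap (n + 1)).α (ladderMap (n + 1)).σ A} =
      (transfer 12 (2, 1) n).1 + 2 * (transfer 12 (2, 1) n).2 := by
  rw [ncard_isIncidenceTree (fun p => decide (p.2 = (true, true)))
    (fun e => decide (e.1 = (true, true))) (fun _ => true) Q (by
      intro c
      simp only [hQ, mem_toSet, bit_right_zero, bit_left_last, forall_onRail_iff]
      simp)]
  obtain ⟨h1, h2⟩ := fiberCard_blocksRun (fun e => decide (e.1 = (true, true))) (fun _ => true)
    12 (2, 1) (by decide) (by decide) (by decide) (by decide) (by decide) (by decide) n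
  rw [h1, h2,
    show fiberCard (leftRun fun p => decide (p.2 = (true, true))) (some true) = 1 by decide,
    show fiberCard (leftRun fun p => decide (p.2 = (true, true))) (some false) = 2 by decide,
    one_mul]

/-- The number of spanning trees of the subdivided ladder that contain the darts at the ends
of the rails and such that the only edge at a vertex of degree three can only be a rung. -/
theorem ncard_isIncidenceTree_of_rung {n : ℕ} (Q : Set (RailDart (n + 1) × Bool) → Prop)
    (hQ : ∀ A, Q A ↔ (∀ t, (.right 0, t) ∈ A) ∧
      (∀ (i : Fin n) t, (.rung i.castSucc.succ, t) ∈ A ∨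
        ((.left i.castSucc, t) ∈ A ∧ (.right i.succ, t) ∈ A)) ∧
      ∀ t, (.left (Fin.last n), t) ∈ A) :
    Set.ncard {A | Q A ∧ IsIncidenceTree (ladderMap (n + 1)).α (ladderMap (n + 1)).σ A} =
      (transfer 8 (2, 1) n).1 + 2 * (transfer 8 (2, 1) n).2 := by
  rw [ncard_isIncidenceTree (fun p => decide (p.2 = (true, true)))
    (fun e => decide (e.1 = (true, true)))
    (fun b => (b.2.1.1 || (b.1.1 && b.2.2.1)) && (b.2.1.2 || (b.1.2 && b.2.2.2))) Q (by
      intro c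
      simp only [hQ, mem_toSet, bit_right_zero, bit_rung_succ, bit_left_castSucc, bit_right_succ,
        bit_left_last, forall_onRail_iff, ← forall_onRail_or_iff])]
  -- Of the 12 ways the 4 are lost in which one rail is cut on one side only and the half rung hangs
  -- on the other rail: the vertex next to the cut is then a leaf on its rail.
  obtain ⟨h1, h2⟩ := fiberCard_blocksRun (fun e => decide (e.1 = (true, true)))
    (fun b => (b.2.1.1 || (b.1.1 && b.2.2.1)) && (b.2.1.2 || (b.1.2 && b.2.2.2)))
    8 (2, 1) (by decide) (by decide) (by decide) (by decide) (by decide) (by decide) n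
  rw [h1, h2,
    show fiberCard (leftRun fun p => decide (p.2 = (true, true))) (some true) = 1 by decide,
    show fiberCard (leftRun fun p => decide (p.2 = (true, true))) (some false) = 2 by decide,
    one_mul]

end LadderConfig

/-! ### The four counting functions as transfer products -/

open LadderConfig

theorem ladderF_succ (n : ℕ) :
    ladderF (n + 1) = (transfer 12 (4, 1) n).1 + 4 * (transfer 12 (4, 1) n).2 := by
  have h : ({x | Even x} : Set ℕ) = {x | x = 0 ∨ Even x} := by
    ext x
    simp only [Set.mem_ofPred_eq]
    exact ⟨Or.inr, by rintro (rfl | h); exacts [Even.zero, h]⟩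
  rw [ladderF, if_neg n.succ_ne_zero, octagonChain, h,
    numSpanningTrees_polygonChain zero_le_one (by omega), ncard_isIncidenceTree_of_forall]
  rintro A x ⟨h, -⟩
  cases h

theorem ladderG_succ (n : ℕ) :
    ladderG (n + 1) = (transfer 12 (4, 1) n).1 + 2 * (transfer 12 (4, 1) n).2 := by
  rw [ladderG, if_neg n.succ_ne_zero, hexagonOctagonChain,
    numSpanningTrees_polygonChain le_rfl (by omega), ncard_isIncidenceTree_of_left]
  intro A
  constructor
  · exact fun h t => h ⟨rfl, 0, rfl, rfl⟩
  · rintro h ⟨d, t⟩ ⟨-, i, hi, hd⟩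
    obtain rfl : i = 0 := Fin.ext hi
    simp only at hd
    subst hd
    exact h t

theorem ladderH_succ (n : ℕ) :
    ladderH (n + 1) = (transfer 12 (2, 1) n).1 + 2 * (transfer 12 (2, 1) n).2 := by
  have := (isShortTransversal_chosenDarts (n := n)).numSpanningTrees_twoColoredGraph
    (M := (ladderMap (n + 1)).reciprocal)
  rw [ladderH, this]
  exact ncard_isIncidenceTree_of_left_right _ chosenDarts_subset_iff

theorem ladderT_succ (n : ℕ) :
    ladderT (n + 1) = (transfer 8 (2, 1) n).1 + 2 * (transfer 8 (2, 1) n).2 := by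
  have := (isShortTransversal_chosenDarts (n := n)).numSpanningHypertrees_eq
    (M := (ladderMap (n + 1)).reciprocal)
  rw [ladderT, this]
  exact ncard_isIncidenceTree_of_rung _ leavesIn_chosenDarts_iff

/-- With a single rung all cycles of `σ_0` are fixed points, and both conditions require every dart.
-/
theorem ladderT_zero : ladderT 0 = ladderH 0 := by
  have hσ : ∀ x, (ladderMap 0).σ x = x := by
    rintro ⟨i | i | i, _ | _⟩
    · rw [ladderMap_σ_false, upperRotation_symm_rung]
      simp
    · rw [ladderMap_σ_true, upperRotation_rung]
      simp
    all_goals exact i.elim0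
  have h : IsShortTransversal (ladderMap 0).reciprocal.α Set.univ :=
    ⟨fun x => Or.inl ((hσ _).trans (hσ x)), fun x => Or.inl trivial, fun x _ _ => hσ x,
      fun x _ _ => (hσ _).trans (hσ x)⟩
  rw [ladderT, ladderH, h.numSpanningHypertrees_eq, h.numSpanningTrees_twoColoredGraph]
  congr 1
  ext A
  refine and_congr_left fun _ => ⟨fun hA x _ => ?_, fun hA x _ => Or.inl (hA ⟨trivial, ?_⟩)⟩
  · rcases hA x trivial with h | h
    · exact h
    · have := h.1
      rwa [show (ladderMap 0).reciprocal.α x = x from hσ x] at this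
  · exact fun h => h.1 (hσ x)

/-! ### Comparison of the two transfer matrices -/

theorem transfer_succ' (k : ℕ) (v : ℕ × ℕ) (n : ℕ) :
    transfer k v (n + 1) = transfer k (4 * v.1 + k * v.2, v.1 + 4 * v.2) n := by
  induction n with
  | zero => rfl
  | succ n ih => rw [transfer, ih, transfer]

theorem transfer_one_zero_succ (n : ℕ) : transfer 12 (1, 0) (n + 1) = transfer 12 (4, 1) n :=
  transfer_succ' 12 (1, 0) n

/-- The row (1, 4) of the left end is the second row of the matrix, and the column (4, 1) of the
right end is its first column. So each end acts as one more step, and the convention `F(0) = 1`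
fits. -/
theorem ladderF_eq (n : ℕ) : ladderF n = (transfer 12 (1, 0) (n + 1)).2 := by
  cases n with
  | zero => simp [ladderF, transfer]
  | succ n => rw [ladderF_succ, transfer, transfer_one_zero_succ]

theorem ladderG_eq (n : ℕ) :
    ladderG n = (transfer 12 (1, 0) n).1 + 2 * (transfer 12 (1, 0) n).2 := by
  cases n with
  | zero => simp [ladderG, transfer]
  | succ n => rw [ladderG_succ, transfer_one_zero_succ]

/-- A power of the matrix with rows (4, 12), (1, 4) again has the form with rows (a, 12b), (b, a),
so its first column (a, b) determines its action on (2, 1). The second entry shows that `G` may be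
read from either end of the ladder. -/
theorem transfer_two_one (n : ℕ) :
    (transfer 12 (2, 1) n).1 = 2 * (transfer 12 (1, 0) n).1 + 12 * (transfer 12 (1, 0) n).2 ∧
    (transfer 12 (2, 1) n).2 = (transfer 12 (1, 0) n).1 + 2 * (transfer 12 (1, 0) n).2 := by
  induction n with
  | zero => simp [transfer]
  | succ n ih =>
    simp only [transfer, ih.1, ih.2]
    constructor <;> ring

theorem transfer_two_one_snd (n : ℕ) : (transfer 12 (2, 1) n).2 = ladderG n := by
  rw [(transfer_two_one n).2, ladderG_eq]

/-- The variation of constants formula which compares two transfer matrices. -/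
theorem transfer_eight (v : ℕ × ℕ) (n : ℕ) (p q : ℤ) :
    p * (transfer 8 v n).1 + q * (transfer 8 v n).2 =
      p * (transfer 12 v n).1 + q * (transfer 12 v n).2 +
        ∑ j ∈ Finset.range n, -4 * ((transfer 8 v j).2 : ℤ) *
          (p * (transfer 12 (1, 0) (n - 1 - j)).1 + q * (transfer 12 (1, 0) (n - 1 - j)).2) := by
  induction n generalizing p q with
  | zero => simp [transfer]
  | succ n ih =>
    have h : ∀ j ∈ Finset.range n, -4 * ((transfer 8 v j).2 : ℤ) *
        (p * (transfer 12 (1, 0) (n + 1 - 1 - j)).1 +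
          q * (transfer 12 (1, 0) (n + 1 - 1 - j)).2) =
        -4 * ((transfer 8 v j).2 : ℤ) *
        ((4 * p + q) * (transfer 12 (1, 0) (n - 1 - j)).1 +
          (12 * p + 4 * q) * (transfer 12 (1, 0) (n - 1 - j)).2) := fun j hj => by
      rw [Finset.mem_range] at hj
      rw [show n + 1 - 1 - j = (n - 1 - j) + 1 by omega, transfer]
      push_cast
      ring
    rw [Finset.sum_range_succ, Finset.sum_congr rfl h]
    -- The new row is (p, q) times the matrix with entry 12. The other matrix adds the term `-4 * p`
    -- times the second entry, which is the last summand.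
    have := ih (4 * p + q) (12 * p + 4 * q)
    simp only [Nat.add_sub_cancel, Nat.sub_self, transfer]
    push_cast
    linarith

theorem sum_range_eq_sum_Icc {M : Type*} [AddCommMonoid M] (f : ℕ → M) (n : ℕ) :
    ∑ j ∈ Finset.range n, f j = ∑ i ∈ Finset.Icc 1 n, f (i - 1) := by
  rw [Finset.range_eq_Ico, Finset.sum_Ico_eq_sum_range, Finset.sum_bij' (fun j _ => j + 1)
    (fun i _ => i - 1)] <;> simp <;> omega

/-- A recurrence for the second entry of the transfer vector in terms of octagon chains. -/
theorem transfer_eight_snd {i : ℕ} (hi : 1 ≤ i) :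
    ((transfer 8 (2, 1) (i - 1)).2 : ℤ) = ladderG (i - 1) +
      ∑ j ∈ Finset.Icc 1 (i - 2), -4 * ((transfer 8 (2, 1) (j - 1)).2 : ℤ) *
        ladderF (i - j - 2) := by
  have h := transfer_eight (2, 1) (i - 1) 0 1
  simp only [zero_mul, one_mul, zero_add, transfer_two_one_snd] at h
  rw [h]
  congr 1
  obtain ⟨_ | n, rfl⟩ := Nat.exists_eq_add_of_le' hi
  · simp
  -- The last summand, an insertion at the rung just before `i`, contains the second entry of (1, 0)
  -- and vanishes. This is where sparsity comes from.
  · rw [show n + 1 + 1 - 1 = n + 1 by omega, Finset.sum_range_succ]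
    simp only [Nat.sub_self, Nat.add_sub_cancel, transfer, Nat.cast_zero, mul_zero, add_zero]
    rw [sum_range_eq_sum_Icc, show n + 1 + 1 - 2 = n by omega]
    refine Finset.sum_congr rfl fun j hj => ?_
    rw [Finset.mem_Icc] at hj
    rw [ladderF_eq, show n - (j - 1) = n + 1 + 1 - j - 2 + 1 by omega]

/-- The row (1, 2) is the left end common to `T` and `H`; applied to powers starting from (1, 0) it
gives `G`. The index `i` marks the last insertion. -/
theorem ladderT_succ_eq (n : ℕ) :
    (ladderT (n + 1) : ℤ) = ladderH (n + 1) + ∑ i ∈ Finset.Icc 1 n,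
      -4 * ((transfer 8 (2, 1) (i - 1)).2 : ℤ) * ladderG (n - i) := by
  have h := transfer_eight (2, 1) n 1 2
  simp only [one_mul] at h
  rw [ladderT_succ, ladderH_succ]
  push_cast
  rw [h, sum_range_eq_sum_Icc]
  congr 1
  refine Finset.sum_congr rfl fun j hj => ?_
  rw [Finset.mem_Icc] at hj
  rw [ladderG_eq, show n - 1 - (j - 1) = n - j by omega]
  push_cast
  rfl

/-! ### Sparse sets -/

open Classical in
theorem ithElement_insert_of_le {s : Finset ℕ} {i : ℕ} (h : ∀ x ∈ s, x < i) {j : ℕ}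
    (hj : 1 ≤ j) (hj' : j ≤ s.card) : ithElement (insert i s) j = ithElement s j := by
  have hfin : (Set.ofPred fun x => x ∈ s).Finite := s.finite_toSet
  have hcard : j - 1 < hfin.toFinset.card := by
    have : hfin.toFinset = s := by ext; simp
    rw [this]
    omega
  have hmem : ithElement s j ∈ s := Nat.nth_mem_of_lt_card hfin hcard
  have hcount : Nat.count (fun x => x ∈ insert i s) (ithElement s j) = j - 1 := by
    rw [← Nat.count_nth_of_lt_card_finite hfin hcard]
    simp only [Nat.count_eq_card_filter_range]
    congr 1
    ext x
    have := h _ hmem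
    simp only [Finset.mem_filter, Finset.mem_range, Finset.mem_insert]
    refine and_congr_right fun hx => ⟨fun hx' => hx'.resolve_left ?_, Or.inr⟩
    exact (hx.trans this).ne
  have := Nat.nth_count (p := fun x => x ∈ insert i s) (Finset.mem_insert_of_mem hmem)
  rwa [hcount] at this

open Classical in
theorem ithElement_insert_card {s : Finset ℕ} {i : ℕ} (h : ∀ x ∈ s, x < i) :
    ithElement (insert i s) (s.card + 1) = i := by
  have hcount : Nat.count (fun x => x ∈ insert i s) i = s.card := by
    rw [Nat.count_eq_card_filter_range]
    congr 1
    ext x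
    simp only [Finset.mem_filter, Finset.mem_range, Finset.mem_insert]
    exact ⟨fun hx => hx.2.resolve_left hx.1.ne, fun hx => ⟨h x hx, Or.inr hx⟩⟩
  have := Nat.nth_count (p := fun x => x ∈ insert i s) (Finset.mem_insert_self i s)
  rwa [hcount] at this

/-! ### Summation over sparse sets by their maximum -/

/-- The nonempty sparse subsets of `{1, …, n}`. -/
noncomputable def sparseSets (n : ℕ) : Finset (Finset ℕ) :=
  open Classical in (Finset.Icc 1 n).powerset.filter fun s => IsSparse s ∧ s.Nonempty

/-- The sparse sets of positive integers with maximum `i`. -/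
noncomputable def sparseSetsMax (i : ℕ) : Finset (Finset ℕ) :=
  open Classical in (Finset.Icc 1 i).powerset.filter fun s => IsSparse s ∧ i ∈ s

theorem mem_sparseSets {n : ℕ} {s : Finset ℕ} :
    s ∈ sparseSets n ↔ (∀ x ∈ s, 1 ≤ x ∧ x ≤ n) ∧ IsSparse s ∧ s.Nonempty := by
  simp [sparseSets, Finset.subset_iff]

theorem mem_sparseSetsMax {i : ℕ} {s : Finset ℕ} :
    s ∈ sparseSetsMax i ↔ (∀ x ∈ s, 1 ≤ x ∧ x ≤ i) ∧ IsSparse s ∧ i ∈ s := by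
  simp [sparseSetsMax, Finset.subset_iff]

theorem sum_sparseSets {M : Type*} [AddCommMonoid M] (f : Finset ℕ → M) (n : ℕ) :
    ∑ s ∈ sparseSets n, f s = ∑ i ∈ Finset.Icc 1 n, ∑ s ∈ sparseSetsMax i, f s := by
  classical
  induction n with
  | zero =>
    refine Finset.sum_eq_zero fun s hs => ?_
    obtain ⟨h, -, x, hx⟩ := mem_sparseSets.1 hs
    have := h x hx
    omega
  | succ n ih =>
    rw [Finset.sum_Icc_succ_top (by omega), ← ih, ← Finset.sum_union]
    · congr 1
      ext s
      rw [Finset.mem_union, mem_sparseSets, mem_sparseSets, mem_sparseSetsMax]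
      constructor
      · rintro ⟨h1, h2, h3⟩
        by_cases hn : n + 1 ∈ s
        · exact Or.inr ⟨h1, h2, hn⟩
        · refine Or.inl ⟨fun x hx => ⟨(h1 x hx).1, ?_⟩, h2, h3⟩
          have := (h1 x hx).2
          have : x ≠ n + 1 := fun h => hn (h ▸ hx)
          omega
      · rintro (⟨h1, h2, h3⟩ | ⟨h1, h2, h3⟩)
        · exact ⟨fun x hx => ⟨(h1 x hx).1, (h1 x hx).2.trans n.le_succ⟩, h2, h3⟩
        · exact ⟨h1, h2, _, h3⟩
    · rw [Finset.disjoint_left]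
      intro s hs hs'
      have := ((mem_sparseSets.1 hs).1 _ (mem_sparseSetsMax.1 hs').2.2).2
      omega

/-- Removing the maximum `i` leaves the empty set or a sparse set that avoids `i - 1`. For `i = 1`
the truncated bound 0 correctly leaves no nonempty set. -/
theorem sum_sparseSetsMax {M : Type*} [AddCommMonoid M] (f : Finset ℕ → M) {i : ℕ} (hi : 1 ≤ i) :
    ∑ s ∈ sparseSetsMax i, f s = f {i} + ∑ s ∈ sparseSets (i - 2), f (insert i s) := by
  classical
  have hlt : ∀ s ∈ sparseSets (i - 2), ∀ x ∈ s, x + 1 < i := fun s hs x hx => by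
    have := (mem_sparseSets.1 hs).1 x hx
    omega
  have h : sparseSetsMax i = insert {i} ((sparseSets (i - 2)).image (insert i)) := by
    ext s
    simp only [Finset.mem_insert, Finset.mem_image, mem_sparseSetsMax]
    constructor
    · rintro ⟨h1, h2, h3⟩
      rcases (s.erase i).eq_empty_or_nonempty with h | h
      · exact Or.inl ((Finset.insert_erase h3).symm.trans (by rw [h]; rfl))
      · refine Or.inr ⟨s.erase i, mem_sparseSets.2 ⟨fun x hx => ?_, fun x hx hx' => ?_, h⟩,
          Finset.insert_erase h3⟩
        · obtain ⟨hxi, hx⟩ := Finset.mem_erase.1 hx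
          have h4 := h1 x hx
          have : x + 1 ≠ i := fun e => h2 x hx (e ▸ h3)
          omega
        · exact h2 x (Finset.mem_of_mem_erase hx) (Finset.mem_of_mem_erase hx')
    · rintro (rfl | ⟨s, hs, rfl⟩)
      · exact ⟨fun x hx => by rw [Finset.mem_singleton] at hx; omega,
          fun x hx hx' => by rw [Finset.mem_singleton] at hx hx'; omega,
          Finset.mem_singleton_self i⟩
      · have hs' := hlt s hs
        obtain ⟨h1, h2, h3⟩ := mem_sparseSets.1 hs
        refine ⟨fun x hx => ?_, fun x hx hx' => ?_, Finset.mem_insert_self _ _⟩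
        · rcases Finset.mem_insert.1 hx with rfl | hx
          · omega
          · have := h1 x hx
            omega
        · rcases Finset.mem_insert.1 hx with rfl | hx <;>
            rcases Finset.mem_insert.1 hx' with hxi | hx'
          · omega
          · have := hs' _ hx'
            omega
          · have := hs' _ hx
            omega
          · exact h2 x hx hx'
  rw [h, Finset.sum_insert, Finset.sum_image]
  · intro s hs t ht hst
    have hs' : i ∉ s := fun h => by have := hlt s hs i h; omega
    have ht' : i ∉ t := fun h => by have := hlt t ht i h; omega
    rw [← Finset.erase_insert hs', ← Finset.erase_insert ht']
    exact congrArg (fun u => Finset.erase u i) hst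
  · rw [Finset.mem_image]
    rintro ⟨s, hs, hsi⟩
    obtain ⟨x, hx⟩ := (mem_sparseSets.1 hs).2.2
    have := hlt s hs x hx
    have hxi : x ∈ ({i} : Finset ℕ) := hsi ▸ Finset.mem_insert_of_mem hx
    rw [Finset.mem_singleton] at hxi
    omega

theorem ithElement_card {i : ℕ} {s : Finset ℕ} (hs : s ∈ sparseSetsMax i) :
    ithElement s s.card = i := by
  classical
  obtain ⟨h1, -, h3⟩ := mem_sparseSetsMax.1 hs
  have hlt : ∀ x ∈ s.erase i, x < i := fun x hx =>
    lt_of_le_of_ne (h1 x (Finset.mem_of_mem_erase hx)).2 (Finset.ne_of_mem_erase hx)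
  have := ithElement_insert_card hlt
  rwa [Finset.insert_erase h3, Finset.card_erase_add_one h3] at this

/-- The contribution of a sparse set, up to a factor that depends on its maximum. -/
noncomputable def sparseWeight (s : Finset ℕ) : ℤ :=
  (-4) ^ s.card * ((ladderG (ithElement s 1 - 1) : ℤ) *
    ∏ j ∈ Finset.Icc 1 (s.card - 1), (ladderF (ithElement s (j + 1) - ithElement s j - 2) : ℤ))

theorem sparseWeight_singleton (i : ℕ) : sparseWeight {i} = -4 * ladderG (i - 1) := by
  have : ithElement {i} 1 = i :=
    ithElement_insert_card (s := ∅) (i := i) (fun x hx => absurd hx (Finset.notMem_empty x))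
  simp [sparseWeight, this]

/-- A new maximum changes the weight only by one sign factor and one gap, because the smaller
elements keep their ranks. -/
theorem sparseWeight_insert {i j : ℕ} (hij : i < j) {s : Finset ℕ} (hs : s ∈ sparseSetsMax i) :
    sparseWeight (insert j s) = -4 * sparseWeight s * ladderF (j - i - 2) := by
  have hlt : ∀ x ∈ s, x < j := fun x hx => ((mem_sparseSetsMax.1 hs).1 x hx).2.trans_lt hij
  have hj : j ∉ s := fun h => (hlt j h).false
  have hc : 1 ≤ s.card := Finset.card_pos.2 ⟨i, (mem_sparseSetsMax.1 hs).2.2⟩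
  rw [sparseWeight, sparseWeight, Finset.card_insert_of_notMem hj, Nat.add_sub_cancel,
    ithElement_insert_of_le hlt le_rfl hc]
  obtain ⟨c, hc'⟩ := Nat.exists_eq_add_of_le' hc
  have hprod : ∏ l ∈ Finset.Icc 1 s.card,
      (ladderF (ithElement (insert j s) (l + 1) - ithElement (insert j s) l - 2) : ℤ) =
      (∏ l ∈ Finset.Icc 1 (s.card - 1), (ladderF (ithElement s (l + 1) - ithElement s l - 2) : ℤ)) *
        ladderF (j - i - 2) := by
    have htop := ithElement_insert_card hlt
    have htop' := ithElement_insert_of_le hlt hc le_rfl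
    rw [ithElement_card hs] at htop'
    rw [hc'] at htop htop' ⊢
    rw [Finset.prod_Icc_succ_top (by omega), htop, htop', Nat.add_sub_cancel]
    congr 1
    refine Finset.prod_congr rfl fun l hl => ?_
    rw [Finset.mem_Icc] at hl
    rw [ithElement_insert_of_le hlt (by omega) (by omega),
      ithElement_insert_of_le hlt (by omega) (by omega)]
  rw [hprod]
  ring

/-- The weights of the sparse sets with given maximum add up to an entry of the transfer matrix. -/
theorem sum_sparseWeight {i : ℕ} (hi : 1 ≤ i) :
    ∑ s ∈ sparseSetsMax i, sparseWeight s = -4 * ((transfer 8 (2, 1) (i - 1)).2 : ℤ) := by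
  induction i using Nat.strong_induction_on with
  | _ i ih =>
    -- Both sides satisfy the same recurrence; `j` is the second largest element on one side and the
    -- preceding insertion on the other.
    rw [sum_sparseSetsMax _ hi, sum_sparseSets, sparseWeight_singleton, transfer_eight_snd hi,
      mul_add, Finset.mul_sum]
    congr 1
    refine Finset.sum_congr rfl fun j hj => ?_
    rw [Finset.mem_Icc] at hj
    have hji : j < i := by omega
    rw [← ih j hji hj.1, Finset.sum_mul, Finset.mul_sum]
    refine Finset.sum_congr rfl fun s hs => ?_
    rw [sparseWeight_insert hji hs, mul_assoc]

/-- A sparse set is disjoint from its translate by one. The bound shows that stopping at `k = m / 2`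
omits no sparse set. -/
theorem IsSparse.two_mul_card_le {s : Finset ℕ} (h : IsSparse s) {n : ℕ}
    (hs : s ⊆ Finset.Icc 1 n) : 2 * s.card ≤ n + 1 := by
  have hdisj : Disjoint s (s.map (addRightEmbedding 1)) := by
    rw [Finset.disjoint_left]
    intro x hx hx'
    obtain ⟨y, hy, rfl⟩ := Finset.mem_map.1 hx'
    exact h y hy hx
  have hsub : s.disjUnion _ hdisj ⊆ Finset.Icc 1 (n + 1) := by
    intro x hx
    rw [Finset.mem_disjUnion, Finset.mem_map] at hx
    rw [Finset.mem_Icc]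
    rcases hx with hx | ⟨y, hy, rfl⟩
    · have := Finset.mem_Icc.1 (hs hx)
      omega
    · have := Finset.mem_Icc.1 (hs hy)
      simp only [addRightEmbedding_apply]
      omega
  have := Finset.card_le_card hsub
  rw [Finset.card_disjUnion, Finset.card_map, Nat.card_Icc] at this
  omega

theorem sparseSubsets_eq_filter {m k : ℕ} (hk : 1 ≤ k) :
    sparseSubsets m k = (sparseSets (m - 1)).filter fun s => s.card = k := by
  classical
  ext s
  simp only [sparseSubsets, sparseSets, Finset.mem_filter, Finset.mem_powersetCard,
    Finset.mem_powerset]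
  constructor
  · rintro ⟨⟨h1, h2⟩, h3⟩
    exact ⟨⟨h1, h3, Finset.card_pos.1 (by omega)⟩, h2⟩
  · rintro ⟨⟨h1, h3, -⟩, h2⟩
    exact ⟨⟨h1, h2⟩, h3⟩

/-- The truncated subtractions in the summands are exact: elements of the sets lie between 1 and `m
- 1`, and sparsity makes the gaps at least two. -/
theorem mainTheorem6 (m : ℕ) :
    (ladderT m : ℤ) = (ladderH m : ℤ) +
      ∑ k ∈ Finset.Icc 1 (m / 2), (-4 : ℤ) ^ k *
        ∑ s ∈ sparseSubsets m k,
          (ladderG (ithElement s 1 - 1) : ℤ) *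
            (∏ j ∈ Finset.Icc 1 (k - 1),
              (ladderF (ithElement s (j + 1) - ithElement s j - 2) : ℤ)) *
            (ladderG (m - 1 - ithElement s k) : ℤ) := by
  rcases m with _ | n
  · simp [ladderT_zero]
  rw [ladderT_succ_eq]
  congr 1
  have hmaps : ∀ s ∈ sparseSets n, s.card ∈ Finset.Icc 1 ((n + 1) / 2) := fun s hs => by
    obtain ⟨h1, h2, h3⟩ := mem_sparseSets.1 hs
    have := h2.two_mul_card_le (n := n) fun x hx => Finset.mem_Icc.2 (h1 x hx)
    have := Finset.card_pos.2 h3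
    rw [Finset.mem_Icc]
    omega
  -- One sum over all nonempty sparse sets is sorted in two ways: by cardinality as in the
  -- statement, and by maximum as in `ladderT_succ_eq`.
  have hsum := Finset.sum_fiberwise_of_maps_to hmaps
    fun s => sparseWeight s * (ladderG (n - ithElement s s.card) : ℤ)
  rw [sum_sparseSets] at hsum
  trans ∑ i ∈ Finset.Icc 1 n, ∑ s ∈ sparseSetsMax i,
    sparseWeight s * (ladderG (n - ithElement s s.card) : ℤ)
  · refine Finset.sum_congr rfl fun i hi => ?_
    rw [← sum_sparseWeight (Finset.mem_Icc.1 hi).1, Finset.sum_mul]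
    refine Finset.sum_congr rfl fun s hs => ?_
    rw [ithElement_card hs]
  · rw [← hsum]
    refine Finset.sum_congr rfl fun k hk => ?_
    rw [sparseSubsets_eq_filter (Finset.mem_Icc.1 hk).1, Nat.add_sub_cancel, Finset.mul_sum]
    refine Finset.sum_congr rfl fun s hs => ?_
    obtain rfl := (Finset.mem_filter.1 hs).2
    rw [sparseWeight]
    ring
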